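/- Let $k\in\mathbb C$ with $\Re(k)>0$, and let $f:\mathbb Q\to\mathbb C$ and $h:\mathbb R\setminus\{0\}\to\mathbb C$ satisfy $f(x+1)=f(x)$ for all $x\in\mathbb Q\setminus[-1,0]$ and $$h(x)=f(x)-|x|^{-k}f(-1/x)\qquad(x\in\mathbb Q\setminus\{0\}).$$ Assume that for some $\delta>0$ one has $h(x)=O\big(e^{|x|^{-1+\delta}}\big)$ for $x\in(-1,1)\setminus\{0\}$. For a rational $y=a/q$ in lowest terms with $q\ge1$, write $q(y)=q$ and $\overline y=\overline a/q$, where $\overline a\in\{1,\dots,q\}$ is the inverse of $a$ modulo $q$. For $x\in\mathbb R$ with continued fraction convergents $x_j=[a_0;a_1,\dots,a_j]$ put $$f^\dagger(x)=\lim_{j\to\infty}q(x_{2j+1})^{-k}f(\overline{x_{2j+1}}).$$ This limit exists for almost every $x\in\mathbb R$ and $f^\dagger$ is Lebesgue-measurable. Let $\nu$ be Lebesgue measure on $[0,1]$. (i) As $q\to\infty$, the multisets $\{q^{-k}f(a/q):1\le a\le q,\ (a,q)=1\}$ become distributed according to the push-forward $f^\dagger_*(\mathrm d\nu)$; that is,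 for every bounded continuous $G:\mathbb C\to\mathbb R$, $$\frac1{\varphi(q)}\sum_{\substack{1\le a\le q\\(a,q)=1}}G\big(q^{-k}f(a/q)\big)\longrightarrow\int_0^1G(f^\dagger(x))\,\mathrm dx .$$ (ii) Suppose moreover that $h$ does not vanish identically on $\mathbb Q\setminus\{0\}$, and that either $h|_{[-1,1]\setminus\{0\}}$ extends to a continuous function on $[-1,1]$, or $h(x)\sim c\,x^{-\lambda}$ as $x\to0^+$ for some $c\in\mathbb C\setminus\{0\}$ and some real $\lambda>0$ with $\lambda\ne k$. Then the measure $f^\dagger_*(\mathrm d\nu)$ is diffuse, i.e. it has no atoms. -/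

import Mathlib

open MeasureTheory Filter Topology Asymptotics Set
open scoped BoundedContinuousFunction

/-- For a rational `x = a/q` in lowest terms (`q ≥ 1`), the rational `x̄ = ā/q`, where `ā` is the
representative in `{1, …, q}` of the inverse of `a` modulo `q`. -/
def invRat (x : ℚ) : ℚ :=
  (((((x.num : ZMod x.den)⁻¹ - 1).val + 1 : ℕ) : ℚ)) / x.den

/-- The values `q(x_{2j+1})^{-k} f(x̄_{2j+1})` along the odd-indexed convergents
`x_{2j+1} = [a₀; a₁, …, a_{2j+1}]` of the continued fraction of `x`. -/
noncomputable def daggerSeq (k : ℂ) (f : ℚ → ℂ) (x : ℝ) (j : ℕ) : ℂ :=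
  ((x.convergent (2 * j + 1)).den : ℂ) ^ (-k) * f (invRat (x.convergent (2 * j + 1)))

/-- The function `f†(x) = lim_j q(x_{2j+1})^{-k} f(x̄_{2j+1})` (a junk value where the limit does
not exist). -/
noncomputable def dagger (k : ℂ) (f : ℚ → ℂ) (x : ℝ) : ℂ :=
  limUnder atTop (daggerSeq k f x)

/-- The push-forward by `f†` of Lebesgue measure on `[0, 1]`. -/
noncomputable def daggerLaw (k : ℂ) (f : ℚ → ℂ) : Measure ℂ :=
  Measure.map (dagger k f) (volume.restrict (Icc (0 : ℝ) 1))

/-- The average of `G` over the multiset `{q^{-k} f(a/q) : 1 ≤ a ≤ q, (a, q) = 1}`. -/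
noncomputable def reducedAverage (k : ℂ) (f : ℚ → ℂ) (G : ℂ → ℝ) (q : ℕ) : ℝ :=
  (∑ a ∈ (Finset.Icc 1 q).filter (fun a => Nat.Coprime a q),
    G ((q : ℂ) ^ (-k) * f ((a : ℚ) / (q : ℚ)))) / (Nat.totient q : ℝ)

/-! Iterating f(x) = h(x) + |x|^{-k} f(-1/x) along a continued fraction with convergent denominators
q_n gives an exact formula (`reciprocity_expansion`): q_{n+1}^{-k} f((-1)^n q_n/q_{n+1}) equals
f(-1) plus the sum over j ≤ n of q_{j+1}^{-k} h((-1)^j q_j/q_{j+1}). For an odd convergent the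
inverted fraction is exactly q_{2j}/q_{2j+1}, so f† is f(-1) plus an infinite series. The growth
condition bounds the j-th term by a constant times q_{j+1}^{-Re k} exp((a_{j+1}+1)^e) with e < 1.
Digits large enough to spoil geometric decay place x unusually close to a fraction, and by
Borel-Cantelli this happens only finitely often for almost every x (`ae_eventually_goodDigit`).

Equidistribution. A reduced fraction a/q is an odd convergent of a nearby irrational
(`exists_irrational_convergent_eq`), so q^{-k} f at the inverted fraction is a partial sum of the
same series, and inversion permutes the residues. A bounded number of initial terms is a locally
constant function, handled by equidistribution of reduced fractions. The remaining terms are small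
unless a/q is very close to a fraction of smaller denominator, which is rare among reduced residues
(`exists_card_closeResidues_le`). This gives the liminf inequality for open sets, hence weak
convergence by the portmanteau theorem.

Diffuseness. If there is an atom, the series is constant on a set of positive measure. Zooming in at
a density point yields, for every η > 0, a "state": parameters r, s for which the series with
initial value r and sign s equals one number w off a set of measure η (`exists_isState`). Fixing the
next digit b turns it into another state, with value (b+r)^k w - h(s/(b+r)) and η multiplied by
(b+1)^2 (`IsState.branch`), and the values of states are uniformly bounded
(`exists_norm_le_of_isState`). If h(x) ~ c x^{-l}, comparing two large digits of the same state
forces l = k (`eq_of_asymptotic`). If h is continuous, w tends to 0 with η, so h(s/(b+r)) is small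
at a dense set of arguments and h vanishes (`eq_zero_of_continuousOn`). -/

/-! ### Continued fraction digits and continuants -/

/-- One step of the continued fraction algorithm. -/
noncomputable def cfStep (x : ℝ) : ℝ := (Int.fract x)⁻¹

/-- The partial quotient `a_{n+1}` of `x = [a₀; a₁, …]`. -/
noncomputable def cfDigit (x : ℝ) (n : ℕ) : ℕ := ⌊cfStep^[n + 1] x⌋₊

/-- The denominators of the convergents, shifted by one: `contDen a (n + 1) = q_n`. -/
def contDen (a : ℕ → ℕ) : ℕ → ℕ
  | 0 => 0
  | 1 => 1
  | n + 2 => a n * contDen a (n + 1) + contDen a n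

/-- The continuant recursion with initial values `r, 1`. -/
noncomputable def genDen (r : ℝ) (a : ℕ → ℕ) : ℕ → ℝ
  | 0 => r
  | 1 => 1
  | n + 2 => a n * genDen r a (n + 1) + genDen r a n

theorem contDen_succ_succ (a : ℕ → ℕ) (n : ℕ) :
    contDen a (n + 2) = a n * contDen a (n + 1) + contDen a n := rfl

theorem genDen_succ_succ (r : ℝ) (a : ℕ → ℕ) (n : ℕ) :
    genDen r a (n + 2) = a n * genDen r a (n + 1) + genDen r a n := rfl

theorem irrational_fract {x : ℝ} (hx : Irrational x) : Irrational (Int.fract x) := by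
  rw [← Int.self_sub_floor]; exact hx.sub_intCast _

theorem fract_pos_of_irrational {x : ℝ} (hx : Irrational x) : 0 < Int.fract x :=
  lt_of_le_of_ne (Int.fract_nonneg x) (irrational_fract hx).ne_zero.symm

theorem irrational_cfStep {x : ℝ} (hx : Irrational x) : Irrational (cfStep x) :=
  (irrational_fract hx).inv

theorem one_lt_cfStep {x : ℝ} (hx : Irrational x) : 1 < cfStep x :=
  (one_lt_inv₀ (fract_pos_of_irrational hx)).2 (Int.fract_lt_one x)

theorem irrational_iterate_cfStep {x : ℝ} (hx : Irrational x) (n : ℕ) :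
    Irrational (cfStep^[n] x) := by
  induction n generalizing x with
  | zero => exact hx
  | succ n ih => exact ih (irrational_cfStep hx)

theorem one_lt_iterate_cfStep {x : ℝ} (hx : Irrational x) (n : ℕ) :
    1 < cfStep^[n + 1] x := by
  rw [Function.iterate_succ_apply']
  exact one_lt_cfStep (irrational_iterate_cfStep hx n)

theorem one_le_cfDigit {x : ℝ} (hx : Irrational x) (n : ℕ) : 1 ≤ cfDigit x n :=
  Nat.le_floor (by simpa using (one_lt_iterate_cfStep hx n).le)

theorem cfDigit_cfStep (x : ℝ) (n : ℕ) : cfDigit (cfStep x) n = cfDigit x (n + 1) := rfl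

theorem cfStep_eq_digit_add {x : ℝ} (hx : Irrational x) (n : ℕ) :
    cfStep^[n + 1] x = cfDigit x n + (cfStep^[n + 2] x)⁻¹ := by
  have h0 := (one_lt_iterate_cfStep hx n).le
  rw [Function.iterate_succ_apply' cfStep (n + 1), cfStep, inv_inv, cfDigit,
    natCast_floor_eq_intCast_floor (by linarith), Int.floor_add_fract]

theorem floor_cfStep {x : ℝ} (hx : Irrational x) : ⌊cfStep x⌋ = (cfDigit x 0 : ℤ) := by
  have h0 := (one_lt_cfStep hx).le
  rw [cfDigit, Int.natCast_floor_eq_floor (by simpa using (by linarith))]; rfl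

theorem contDen_pos {a : ℕ → ℕ} (ha : ∀ n, 1 ≤ a n) (n : ℕ) : 1 ≤ contDen a (n + 1) := by
  induction n with
  | zero => exact le_rfl
  | succ n ih => rw [contDen_succ_succ]; nlinarith [ha n]

theorem contDen_le_succ {a : ℕ → ℕ} (ha : ∀ n, 1 ≤ a n) (n : ℕ) :
    contDen a n ≤ contDen a (n + 1) := by
  cases n with
  | zero => simp [contDen]
  | succ n => rw [contDen_succ_succ]; nlinarith [ha n]

theorem contDen_mono {a : ℕ → ℕ} (ha : ∀ n, 1 ≤ a n) : Monotone (contDen a) :=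
  monotone_nat_of_le_succ (contDen_le_succ ha)

theorem contDen_lt_succ {a : ℕ → ℕ} (ha : ∀ n, 1 ≤ a n) (n : ℕ) :
    contDen a (n + 2) < contDen a (n + 3) := by
  rw [contDen_succ_succ a (n + 1)]; nlinarith [ha (n + 1), contDen_pos ha n]

/-- Two steps of the recursion at least double the denominator. The square avoids half-integral
powers of 2. -/
theorem two_pow_le_contDen_sq {a : ℕ → ℕ} (ha : ∀ n, 1 ≤ a n) :
    ∀ n, 2 ^ n ≤ contDen a (n + 2) ^ 2
  | 0 => by simpa using Nat.one_le_pow 2 _ (contDen_pos ha 1)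
  | 1 => by
      have h1 : 2 ≤ contDen a 3 := by simp [contDen]; nlinarith [ha 0, ha 1]
      calc 2 ^ 1 ≤ 2 ^ 2 := by norm_num
        _ ≤ contDen a 3 ^ 2 := Nat.pow_le_pow_left h1 2
  | n + 2 => by
      have h1 := two_pow_le_contDen_sq ha n
      have h2 : 2 * contDen a (n + 2) ≤ contDen a (n + 4) := by
        rw [contDen_succ_succ a (n + 2)]
        have := contDen_le_succ ha (n + 2)
        nlinarith [ha (n + 2)]
      calc 2 ^ (n + 2) = 4 * 2 ^ n := by ring
        _ ≤ 4 * contDen a (n + 2) ^ 2 := by omega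
        _ = (2 * contDen a (n + 2)) ^ 2 := by ring
        _ ≤ _ := Nat.pow_le_pow_left h2 2

theorem le_contDen {a : ℕ → ℕ} (ha : ∀ n, 1 ≤ a n) (n : ℕ) : n ≤ contDen a (n + 1) := by
  induction n with
  | zero => simp
  | succ n ih =>
    cases n with
    | zero => exact contDen_pos ha 1
    | succ n => exact lt_of_le_of_lt ih (contDen_lt_succ ha n)

/-- The recursion appends digits at the end, whereas `Real.convergent` peels them off at the front;
this is the symmetry of continuants that reconciles the two. -/
theorem contDen_head (a : ℕ → ℕ) : ∀ n, contDen a (n + 2) =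
    a 0 * contDen (fun i => a (i + 1)) (n + 1) + contDen (fun i => a (i + 2)) n
  | 0 => by simp [contDen]
  | 1 => by simp [contDen]; ring
  | n + 2 => by
      rw [contDen_succ_succ a (n + 2), contDen_head a n, contDen_head a (n + 1),
        contDen_succ_succ _ (n + 1), contDen_succ_succ (fun i => a (i + 2)) n]
      ring

/-- Up to the integer part, continuants of the shifted digits are the numerators p_n, so this is
p_{n+1} q_n - p_n q_{n+1} = (-1)^n. It supplies both the coprimality of convergents and the inverse
of p_{2j+1} modulo q_{2j+1}. -/
theorem contDen_det (a : ℕ → ℕ) (n : ℕ) :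
    (contDen (fun i => a (i + 1)) (n + 1) : ℤ) * contDen a (n + 1)
      - contDen (fun i => a (i + 1)) n * contDen a (n + 2) = (-1) ^ n := by
  induction n with
  | zero => simp [contDen]
  | succ n ih =>
    rw [contDen_succ_succ a (n + 1), contDen_succ_succ _ n, pow_succ, ← ih]
    push_cast [contDen_succ_succ a n]
    ring

theorem convergent_eq {x : ℝ} (hx : Irrational x) (n : ℕ) :
    x.convergent n = ⌊x⌋ + (contDen (fun i => cfDigit x (i + 1)) n : ℚ)
      / contDen (cfDigit x) (n + 1) := by
  induction n generalizing x with
  | zero => simp [Real.convergent, contDen]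
  | succ n ih =>
    rw [Real.convergent_succ]
    congr 1
    have h1 := ih (irrational_cfStep hx)
    rw [cfStep] at h1
    rw [h1, ← cfStep, floor_cfStep hx, contDen_head]
    have h2 := contDen_pos (one_le_cfDigit (irrational_cfStep hx)) n
    have h3 : contDen (fun i => cfDigit x (i + 1)) (n + 1) ≠ 0 := by
      have : (fun i => cfDigit x (i + 1)) = cfDigit (cfStep x) := rfl
      rw [this]; omega
    have h4 : (cfDigit (cfStep x)) = fun i => cfDigit x (i + 1) := rfl
    rw [h4]
    push_cast
    field_simp

theorem convergent_den_num {x : ℝ} (hx : Irrational x) (n : ℕ) :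
    (x.convergent n).den = contDen (cfDigit x) (n + 1) ∧
    (x.convergent n).num = ⌊x⌋ * contDen (cfDigit x) (n + 1)
      + contDen (fun i => cfDigit x (i + 1)) n := by
  have hpos := contDen_pos (one_le_cfDigit hx) n
  have hq : x.convergent n = Rat.divInt (⌊x⌋ * contDen (cfDigit x) (n + 1)
      + contDen (fun i => cfDigit x (i + 1)) n) (contDen (cfDigit x) (n + 1)) := by
    rw [convergent_eq hx, Rat.divInt_eq_div]
    have : (contDen (cfDigit x) (n + 1) : ℚ) ≠ 0 := by positivity
    push_cast
    field_simp
  have hcop : IsCoprime ((⌊x⌋ * contDen (cfDigit x) (n + 1)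
      + contDen (fun i => cfDigit x (i + 1)) n : ℤ)) (contDen (cfDigit x) (n + 1)) := by
    have hd := contDen_det (cfDigit x) n
    rw [add_comm, IsCoprime.add_mul_right_left_iff]
    refine ⟨-(-1) ^ n * contDen (cfDigit x) (n + 2),
      (-1) ^ n * contDen (fun i => cfDigit x (i + 1)) (n + 1), ?_⟩
    have h1 : ((-1 : ℤ) ^ n) * (-1) ^ n = 1 := by rw [← mul_pow]; simp
    linear_combination (-1 : ℤ) ^ n * hd + h1
  rw [hq]
  have hz : (0 : ℤ) < contDen (cfDigit x) (n + 1) := by exact_mod_cast hpos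
  have hc := Int.isCoprime_iff_gcd_eq_one.1 hcop
  rw [Rat.divInt_eq_div]
  have h1 := Rat.num_div_eq_of_coprime hz hc
  have h2 := Rat.den_div_eq_of_coprime hz hc
  exact ⟨by exact_mod_cast h2, h1⟩

theorem invRat_eq_div {x : ℚ} {m : ℕ} (hm : 1 ≤ m) (hmd : m ≤ x.den)
    (h : (x.num : ZMod x.den) * m = 1) : invRat x = (m : ℚ) / x.den := by
  have : NeZero x.den := ⟨x.den_nz⟩
  have h1 : (x.num : ZMod x.den)⁻¹ = m :=
    ZMod.inv_eq_of_mul_eq_one _ _ _ h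
  rw [invRat, h1]
  have h2 : ((m : ZMod x.den) - 1) = ((m - 1 : ℕ) : ZMod x.den) := by
    push_cast [Nat.cast_sub hm]; rfl
  rw [h2, ZMod.val_natCast_of_lt (by omega)]
  congr 2
  omega

/-- By the determinant, p_{2j+1} q_{2j} ≡ 1 modulo q_{2j+1}. At even indices the sign would be
reversed, which is why only odd convergents appear in f†. -/
theorem invRat_convergent {x : ℝ} (hx : Irrational x) (j : ℕ) :
    invRat (x.convergent (2 * j + 1)) =
      (contDen (cfDigit x) (2 * j + 1) : ℚ) / contDen (cfDigit x) (2 * j + 2) := by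
  obtain ⟨hd, hn⟩ := convergent_den_num hx (2 * j + 1)
  have ha := one_le_cfDigit hx
  rw [invRat_eq_div (m := contDen (cfDigit x) (2 * j + 1)) (contDen_pos ha _), hd]
  · rw [hd]; exact contDen_le_succ ha _
  · have hdet := contDen_det (cfDigit x) (2 * j)
    rw [pow_mul] at hdet
    have : (((x.convergent (2 * j + 1)).num * contDen (cfDigit x) (2 * j + 1) - 1 : ℤ) :
        ZMod (x.convergent (2 * j + 1)).den) = 0 := by
      rw [ZMod.intCast_zmod_eq_zero_iff_dvd, hd, hn]
      refine ⟨⌊x⌋ * contDen (cfDigit x) (2 * j + 1)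
        + contDen (fun i => cfDigit x (i + 1)) (2 * j), ?_⟩
      simp only [even_two, Even.neg_pow, one_pow] at hdet
      linear_combination hdet
    push_cast at this
    exact sub_eq_zero.1 this

theorem sub_convergent {x : ℝ} (hx : Irrational x) (n : ℕ) :
    ∃ e : ℝ, 0 < e ∧ e < 1 / (contDen (cfDigit x) (n + 1) * contDen (cfDigit x) (n + 2)) ∧
      x - x.convergent n = (-1) ^ n * e := by
  -- The fractional part as the Möbius image of the complete quotient `cfStep^[n + 2] x`, with
  -- denominators cleared.
  have key : ∀ n, Int.fract x * (cfStep^[n + 2] x * contDen (cfDigit x) (n + 2)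
      + contDen (cfDigit x) (n + 1)) = cfStep^[n + 2] x *
      contDen (fun i => cfDigit x (i + 1)) (n + 1) + contDen (fun i => cfDigit x (i + 1)) n := by
    intro n
    induction n with
    | zero =>
      have h := cfStep_eq_digit_add hx 0
      have h2 := one_lt_iterate_cfStep hx 1
      have h0 := fract_pos_of_irrational hx
      simp only [zero_add, Function.iterate_one] at h h2 ⊢
      rw [cfStep] at h
      simp [contDen]
      have h3 : cfStep^[2] x ≠ 0 := by intro h; norm_num [h] at h2
      field_simp at h
      change Int.fract x * (cfStep^[2] x * _ + 1) = cfStep^[2] x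
      linear_combination -h
    | succ n ih =>
      have h := cfStep_eq_digit_add hx (n + 1)
      have h2 := one_lt_iterate_cfStep hx (n + 2)
      have h3 : cfStep^[n + 1 + 2] x ≠ 0 := by
        intro h; rw [show n + 2 + 1 = n + 1 + 2 by ring] at h2; norm_num [h] at h2
      rw [show n + 1 + 1 = n + 2 by ring] at h
      rw [h] at ih
      rw [contDen_succ_succ (cfDigit x) (n + 1), contDen_succ_succ (fun i => cfDigit x (i + 1)) n]
      field_simp at ih
      push_cast
      linear_combination ih
  have hk := key n
  have hdet : (contDen (fun i => cfDigit x (i + 1)) (n + 1) : ℝ) * contDen (cfDigit x) (n + 1)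
      - contDen (fun i => cfDigit x (i + 1)) n * contDen (cfDigit x) (n + 2) = (-1) ^ n := by
    exact_mod_cast contDen_det (cfDigit x) n
  have hξ := one_lt_iterate_cfStep hx (n + 1)
  have hQ1 : (0 : ℝ) < contDen (cfDigit x) (n + 1) := by
    exact_mod_cast contDen_pos (one_le_cfDigit hx) n
  have hQ2 : (0 : ℝ) < contDen (cfDigit x) (n + 2) := by
    exact_mod_cast contDen_pos (one_le_cfDigit hx) (n + 1)
  set ξ := cfStep^[n + 2] x
  set A : ℝ := (contDen (cfDigit x) (n + 1) : ℝ)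
  set B : ℝ := (contDen (cfDigit x) (n + 2) : ℝ)
  have hξ0 : 0 < ξ := by linarith
  refine ⟨ξ / (A * (ξ * B + A)), by positivity, ?_, ?_⟩
  · rw [div_lt_div_iff₀ (by positivity) (by positivity)]
    nlinarith [mul_pos hQ1 hQ1]
  · rw [convergent_eq hx]
    push_cast
    rw [← sub_sub, Int.self_sub_floor]
    change Int.fract x - (contDen (fun i => cfDigit x (i + 1)) n : ℝ) / A = _
    field_simp
    linear_combination A * hk + ξ * hdet

/-! ### Generalised continuants -/

theorem genDen_zero_eq (a : ℕ → ℕ) : ∀ n, genDen 0 a n = contDen a n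
  | 0 => by simp [genDen, contDen]
  | 1 => by simp [genDen, contDen]
  | n + 2 => by
      rw [genDen_succ_succ, contDen_succ_succ, genDen_zero_eq a n, genDen_zero_eq a (n + 1)]
      push_cast; ring

theorem contDen_le_genDen {r : ℝ} (hr : 0 ≤ r) (a : ℕ → ℕ) : ∀ n, (contDen a n : ℝ) ≤ genDen r a n
  | 0 => by simpa [genDen, contDen]
  | 1 => by simp [genDen, contDen]
  | n + 2 => by
      rw [genDen_succ_succ, contDen_succ_succ]
      have h1 := contDen_le_genDen hr a n
      have h2 := contDen_le_genDen hr a (n + 1)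
      push_cast
      gcongr

theorem genDen_pos {r : ℝ} (hr : 0 ≤ r) {a : ℕ → ℕ} (ha : ∀ n, 1 ≤ a n) (n : ℕ) :
    0 < genDen r a (n + 1) :=
  lt_of_lt_of_le (by exact_mod_cast contDen_pos ha n) (contDen_le_genDen hr a (n + 1))

theorem genDen_nonneg {r : ℝ} (hr : 0 ≤ r) (a : ℕ → ℕ) (n : ℕ) : 0 ≤ genDen r a n :=
  le_trans (Nat.cast_nonneg _) (contDen_le_genDen hr a n)

theorem genDen_le_succ {r : ℝ} (hr : 0 ≤ r) (hr1 : r ≤ 1) {a : ℕ → ℕ} (ha : ∀ n, 1 ≤ a n)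
    (n : ℕ) : genDen r a n ≤ genDen r a (n + 1) := by
  cases n with
  | zero => simpa [genDen]
  | succ n =>
    rw [genDen_succ_succ]
    have h1 : (1 : ℝ) ≤ a n := by exact_mod_cast ha n
    nlinarith [genDen_pos hr ha n, genDen_nonneg hr a n]

theorem genDen_ratio_le {r : ℝ} (hr : 0 ≤ r) (hr1 : r ≤ 1) {a : ℕ → ℕ} (ha : ∀ n, 1 ≤ a n)
    (n : ℕ) : genDen r a (n + 2) / genDen r a (n + 1) ≤ a n + 1 := by
  rw [div_le_iff₀ (genDen_pos hr ha n), genDen_succ_succ]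
  linarith [genDen_le_succ hr hr1 ha n]

/-- After one step the initial pair (r, 1) has become (1, a₀ + r), which is a₀ + r times (1/(a₀ +
r), 1). Dropping a digit therefore acts on the parameter by r ↦ 1/(a₀ + r). -/
theorem genDen_shift {r : ℝ} {a : ℕ → ℕ} (h0 : (a 0 : ℝ) + r ≠ 0) : ∀ n,
    genDen r a (n + 1) = (a 0 + r) * genDen (1 / (a 0 + r)) (fun i => a (i + 1)) n
  | 0 => by simp [genDen]; field_simp
  | 1 => by simp [genDen]
  | n + 2 => by
      rw [genDen_succ_succ r a (n + 1), genDen_shift h0 n, genDen_shift h0 (n + 1),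
        genDen_succ_succ _ _ n]
      ring

/-! ### The reciprocity expansion -/

/-- The `j`-th term of the series obtained by iterating the reciprocity formula. -/
noncomputable def cfTerm (k : ℂ) (h : ℝ → ℂ) (r s : ℝ) (a : ℕ → ℕ) (j : ℕ) : ℂ :=
  (genDen r a (j + 2) : ℂ) ^ (-k) * h (s * (-1) ^ j * (genDen r a (j + 1) / genDen r a (j + 2)))

/-- The sum of the series of `cfTerm`s over the digits of `y`. -/
noncomputable def cfSum (k : ℂ) (h : ℝ → ℂ) (r s y : ℝ) : ℂ :=
  ∑' j, cfTerm k h r s (cfDigit y) j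

theorem periodic_pos {f : ℚ → ℂ} (hper : ∀ x : ℚ, x ∉ Icc (-1 : ℚ) 0 → f (x + 1) = f x)
    {y : ℚ} (hy : 0 < y) (b : ℕ) : f (b + y) = f y := by
  induction b with
  | zero => simp
  | succ b ih =>
    rw [← ih, ← hper (b + y)]
    · congr 1; push_cast; ring
    · intro hm
      have : (0 : ℚ) ≤ b := Nat.cast_nonneg b
      linarith [hm.2]

theorem periodic_neg {f : ℚ → ℂ} (hper : ∀ x : ℚ, x ∉ Icc (-1 : ℚ) 0 → f (x + 1) = f x)
    {y : ℚ} (hy : 0 < y) (b : ℕ) : f (-(b + y)) = f (-y) := by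
  induction b with
  | zero => simp
  | succ b ih =>
    rw [← ih, ← hper (-((b + 1 : ℕ) + y))]
    · congr 1; push_cast; ring
    · intro hm
      have : (0 : ℚ) ≤ b := Nat.cast_nonneg b
      have := hm.1
      push_cast at this
      linarith

/-- The excluded interval [-1, 0] decouples the two half-lines: an argument can be reduced towards 0
from either side but never carried across. -/
theorem periodic_signed {f : ℚ → ℂ} (hper : ∀ x : ℚ, x ∉ Icc (-1 : ℚ) 0 → f (x + 1) = f x)
    {y : ℚ} (hy : 0 < y) (b n : ℕ) : f ((-1) ^ n * (b + y)) = f ((-1) ^ n * y) := by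
  rcases neg_one_pow_eq_or ℚ n with h | h <;> rw [h]
  · simpa using periodic_pos hper hy b
  · simpa using periodic_neg hper hy b

/-- Each application of the reciprocity formula produces one term and inverts the argument; since
q_{n+1}/q_n = a_{n+1} + q_{n-1}/q_n, periodicity then removes the digit. The powers of the arguments
telescope into powers of the denominators. -/
theorem reciprocity_expansion {k : ℂ} {f : ℚ → ℂ} {h : ℝ → ℂ}
    (hper : ∀ x : ℚ, x ∉ Icc (-1 : ℚ) 0 → f (x + 1) = f x)
    (hrec : ∀ x : ℚ, x ≠ 0 → h (x : ℝ) = f x - (((|x| : ℚ) : ℂ) ^ (-k)) * f (-1 / x))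
    {a : ℕ → ℕ} (ha : ∀ n, 1 ≤ a n) (n : ℕ) :
    (contDen a (n + 2) : ℂ) ^ (-k) *
      f ((-1) ^ n * ((contDen a (n + 1) : ℚ) / contDen a (n + 2)))
      = f (-1) + ∑ j ∈ Finset.range (n + 1), cfTerm k h 0 1 a j := by
  have main : ∀ n, (contDen a (n + 2) : ℂ) ^ (-k) *
      f ((-1) ^ n * ((contDen a (n + 1) : ℚ) / contDen a (n + 2))) = cfTerm k h 0 1 a n +
      (contDen a (n + 1) : ℂ) ^ (-k) *
        f ((-1) ^ (n + 1) * ((contDen a (n + 2) : ℚ) / contDen a (n + 1))) := by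
    intro n
    have h1 : (0 : ℚ) < contDen a (n + 1) := by exact_mod_cast contDen_pos ha n
    have h2 : (0 : ℚ) < contDen a (n + 2) := by exact_mod_cast contDen_pos ha (n + 1)
    have hs : ((-1 : ℚ) ^ n) ≠ 0 := pow_ne_zero _ (by norm_num)
    have hs2 : ((-1 : ℚ) ^ n) * (-1) ^ n = 1 := by rw [← mul_pow]; simp
    have hr := hrec ((-1) ^ n * ((contDen a (n + 1) : ℚ) / contDen a (n + 2))) (by positivity)
    have habs : |(-1) ^ n * ((contDen a (n + 1) : ℚ) / contDen a (n + 2))| =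
        (contDen a (n + 1) : ℚ) / contDen a (n + 2) := by
      rw [abs_mul, abs_pow, abs_neg, abs_one, one_pow, one_mul, abs_of_pos (by positivity)]
    have hinv : -1 / ((-1) ^ n * ((contDen a (n + 1) : ℚ) / contDen a (n + 2))) =
        (-1) ^ (n + 1) * ((contDen a (n + 2) : ℚ) / contDen a (n + 1)) := by
      field_simp
      rw [pow_succ]
      linear_combination hs2
    rw [habs, hinv] at hr
    rw [cfTerm, genDen_zero_eq, genDen_zero_eq, one_mul]
    push_cast at hr ⊢
    rw [hr]
    have hc : ((contDen a (n + 1) : ℂ)) ^ (-k) = (contDen a (n + 2) : ℂ) ^ (-k) *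
        ((contDen a (n + 1) : ℂ) / contDen a (n + 2)) ^ (-k) := by
      have h3 : (0 : ℝ) ≤ (contDen a (n + 1) : ℝ) / contDen a (n + 2) := by positivity
      have := Complex.mul_cpow_ofReal_nonneg (Nat.cast_nonneg (contDen a (n + 2))) h3 (-k)
      push_cast at this
      rw [← this]
      congr 1
      have : (contDen a (n + 2) : ℂ) ≠ 0 := by exact_mod_cast h2.ne'
      field_simp
    rw [hc]
    ring
  induction n with
  | zero =>
    rw [main 0]
    -- The last argument is the negative integer -a₁. Periodicity moves it to -1 but not on to 0,
    -- hence the constant f(-1).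
    have h1 : f ((-1) ^ (0 + 1) * ((contDen a (0 + 2) : ℚ) / contDen a (0 + 1))) = f (-1) := by
      have := periodic_neg hper one_pos (a 0 - 1)
      rw [← this]
      congr 1
      push_cast [contDen, Nat.cast_sub (ha 0)]
      ring
    rw [h1]
    simp [contDen]
    ring
  | succ n ih =>
    rw [main (n + 1), Finset.sum_range_succ, ← add_assoc, ← ih, add_comm]
    congr 2
    have h1 : (0 : ℚ) < contDen a (n + 1) := by exact_mod_cast contDen_pos ha n
    have h2 : (0 : ℚ) < contDen a (n + 2) := by exact_mod_cast contDen_pos ha (n + 1)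
    have h3 : (contDen a (n + 1 + 2) : ℚ) / contDen a (n + 1 + 1) =
        a (n + 1) + (contDen a (n + 1) : ℚ) / contDen a (n + 2) := by
      rw [contDen_succ_succ a (n + 1)]
      push_cast
      field_simp
    rw [h3, periodic_signed hper (by positivity), pow_succ, pow_succ]
    congr 1
    ring

theorem daggerSeq_eq {k : ℂ} {f : ℚ → ℂ} {h : ℝ → ℂ}
    (hper : ∀ x : ℚ, x ∉ Icc (-1 : ℚ) 0 → f (x + 1) = f x)
    (hrec : ∀ x : ℚ, x ≠ 0 → h (x : ℝ) = f x - (((|x| : ℚ) : ℂ) ^ (-k)) * f (-1 / x))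
    {x : ℝ} (hx : Irrational x) (j : ℕ) :
    daggerSeq k f x j =
      f (-1) + ∑ i ∈ Finset.range (2 * j + 1), cfTerm k h 0 1 (cfDigit x) i := by
  rw [daggerSeq, invRat_convergent hx, (convergent_den_num hx _).1,
    ← reciprocity_expansion hper hrec (one_le_cfDigit hx) (2 * j)]
  rw [pow_mul]
  simp

/-! ### Recursion for the series -/

theorem cfTerm_zero (k : ℂ) (h : ℝ → ℂ) (r s : ℝ) (a : ℕ → ℕ) :
    cfTerm k h r s a 0 = ((a 0 + r : ℝ) : ℂ) ^ (-k) * h (s / (a 0 + r)) := by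
  simp [cfTerm, genDen, div_eq_mul_inv]

theorem cfTerm_succ (k : ℂ) (h : ℝ → ℂ) {r : ℝ} (hr : 0 ≤ r) (s : ℝ) {a : ℕ → ℕ}
    (ha : ∀ n, 1 ≤ a n) (j : ℕ) :
    cfTerm k h r s a (j + 1) = ((a 0 + r : ℝ) : ℂ) ^ (-k) *
      cfTerm k h (1 / (a 0 + r)) (-s) (fun i => a (i + 1)) j := by
  have h0 : (0 : ℝ) < a 0 + r := by
    have : (1 : ℝ) ≤ a 0 := by exact_mod_cast ha 0
    linarith
  have hp := genDen_pos (r := 1 / (a 0 + r)) (by positivity) (fun n => ha (n + 1)) (j + 1)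
  rw [cfTerm, cfTerm, genDen_shift h0.ne' (j + 2), genDen_shift h0.ne' (j + 1),
    Complex.ofReal_mul, Complex.mul_cpow_ofReal_nonneg h0.le hp.le, mul_assoc]
  congr 3
  rw [mul_div_mul_left _ _ h0.ne']
  ring

theorem summable_cfTerm_of_shift (k : ℂ) (h : ℝ → ℂ) {r : ℝ} (hr : 0 ≤ r) (s : ℝ) {a : ℕ → ℕ}
    (ha : ∀ n, 1 ≤ a n)
    (hs : Summable (cfTerm k h (1 / (a 0 + r)) (-s) (fun i => a (i + 1)))) :
    Summable (cfTerm k h r s a) := by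
  rw [← summable_nat_add_iff 1]
  simp only [cfTerm_succ k h hr s ha]
  exact hs.mul_left _

theorem tsum_cfTerm_eq (k : ℂ) (h : ℝ → ℂ) {r : ℝ} (hr : 0 ≤ r) (s : ℝ) {a : ℕ → ℕ}
    (ha : ∀ n, 1 ≤ a n)
    (hs : Summable (cfTerm k h (1 / (a 0 + r)) (-s) (fun i => a (i + 1)))) :
    ∑' j, cfTerm k h r s a j = ((a 0 + r : ℝ) : ℂ) ^ (-k) * (h (s / (a 0 + r)) +
      ∑' j, cfTerm k h (1 / (a 0 + r)) (-s) (fun i => a (i + 1)) j) := by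
  rw [(summable_cfTerm_of_shift k h hr s ha hs).tsum_eq_zero_add, cfTerm_zero, mul_add]
  simp only [cfTerm_succ k h hr s ha]
  rw [tsum_mul_left]

theorem cfDigit_branch {b : ℕ} (hb : 1 ≤ b) {y : ℝ} (hy : y ∈ Ioo (0 : ℝ) 1) :
    cfDigit (1 / (b + y)) 0 = b ∧ (fun i => cfDigit (1 / (b + y)) (i + 1)) = cfDigit y := by
  have hb' : (1 : ℝ) ≤ b := by exact_mod_cast hb
  have h1 : cfStep (1 / (b + y)) = b + y := by
    rw [cfStep, Int.fract_eq_self.2, one_div, inv_inv]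
    have : 0 < b + y := by linarith [hy.1]
    refine ⟨by positivity, ?_⟩
    rw [div_lt_one this]
    linarith [hy.1]
  have h2 : cfStep (b + y) = cfStep y := by rw [cfStep, cfStep, Int.fract_natCast_add]
  constructor
  · rw [cfDigit, zero_add, Function.iterate_one, h1, Nat.floor_eq_iff (by linarith [hy.1])]
    exact ⟨by linarith [hy.1], by linarith [hy.2]⟩
  · funext i
    rw [← cfDigit_cfStep, h1, cfDigit, cfDigit, Function.iterate_succ_apply, h2,
      ← Function.iterate_succ_apply]

/-- Self-similarity of the series under the inverse branches y ↦ 1/(b+y): one term splits off, r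
moves to 1/(b+r), and the sign flips. The whole analysis of atoms rests on this relation. -/
theorem cfSum_branch (k : ℂ) (h : ℝ → ℂ) {r : ℝ} (hr : 0 ≤ r) (s : ℝ) {b : ℕ} (hb : 1 ≤ b)
    {y : ℝ} (hy : y ∈ Ioo (0 : ℝ) 1) (hirr : Irrational y)
    (hs : Summable (cfTerm k h (1 / (b + r)) (-s) (cfDigit y))) :
    Summable (cfTerm k h r s (cfDigit (1 / (b + y)))) ∧
    cfSum k h r s (1 / (b + y)) = ((b + r : ℝ) : ℂ) ^ (-k) * (h (s / (b + r)) +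
      cfSum k h (1 / (b + r)) (-s) y) := by
  obtain ⟨h1, h2⟩ := cfDigit_branch hb hy
  have hirr' : Irrational (1 / (b + y)) := by
    rw [one_div]; exact (hirr.natCast_add b).inv
  have ha := one_le_cfDigit hirr'
  rw [cfSum, cfSum]
  have key := tsum_cfTerm_eq k h hr s ha
  have key2 := summable_cfTerm_of_shift k h hr s ha
  rw [h1, h2] at key key2
  exact ⟨key2 hs, key hs⟩

/-! ### Bounds for the terms -/

/-- The digit `a_j` is small enough for the `j`-th term to be exponentially small. -/
def GoodDigit (κ e : ℝ) (a : ℕ → ℕ) (j : ℕ) : Prop :=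
  ((a j : ℝ) + 1) ^ e ≤ κ / 2 * Real.log (contDen a (j + 2))

/-- A growth condition at the origin, in terms of the inverse of the variable. -/
def InvExpBound (h : ℝ → ℂ) (C e : ℝ) : Prop :=
  ∀ x : ℝ, |x| < 1 → x ≠ 0 → ‖h x‖ ≤ C * Real.exp (|x|⁻¹ ^ e)

theorem exists_invExpBound {h : ℝ → ℂ}
    (hgrowth : ∃ δ : ℝ, 0 < δ ∧ ∃ C : ℝ, ∀ x ∈ Ioo (-1 : ℝ) 1, x ≠ 0 →
      ‖h x‖ ≤ C * Real.exp (|x| ^ (-1 + δ))) :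
    ∃ C e : ℝ, 0 ≤ C ∧ 0 < e ∧ e < 1 ∧ InvExpBound h C e := by
  obtain ⟨δ, hδ, C, hC⟩ := hgrowth
  -- Truncating δ at 1/2 keeps the new exponent strictly positive as well as below 1.
  refine ⟨max C 0, 1 - min δ (1 / 2), le_max_right _ _, ?_, ?_, ?_⟩
  · have := min_le_right δ (1 / 2); linarith
  · have := lt_min hδ (show (0 : ℝ) < 1 / 2 by norm_num); linarith
  · intro x hx hx0
    have hpos : 0 < |x| := abs_pos.2 hx0
    refine (hC x (abs_lt.1 hx) hx0).trans ?_
    refine (mul_le_mul_of_nonneg_right (le_max_left C 0) (Real.exp_pos _).le).trans ?_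
    refine mul_le_mul_of_nonneg_left (Real.exp_le_exp.2 ?_) (le_max_right C 0)
    rw [Real.inv_rpow hpos.le, ← Real.rpow_neg hpos.le]
    refine Real.rpow_le_rpow_of_exponent_ge hpos hx.le ?_
    have := min_le_left δ (1 / 2)
    linarith

/-- The bound is independent of r and s, because generalised continuants dominate the ordinary ones
and their successive ratios are at most a_j + 1. Positivity of `genDen r a j` keeps the argument of
h strictly inside (-1, 1); it can fail only for j = 0 and r = 0. -/
theorem norm_cfTerm_le {k : ℂ} (hk : 0 < k.re) {h : ℝ → ℂ} {C e : ℝ} (hC : 0 ≤ C) (he : 0 < e)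
    (hh : InvExpBound h C e) {r s : ℝ} (hr : 0 ≤ r) (hr1 : r ≤ 1) (hs : |s| = 1) {a : ℕ → ℕ}
    (ha : ∀ n, 1 ≤ a n) {j : ℕ} (hj : 0 < genDen r a j) :
    ‖cfTerm k h r s a j‖ ≤
      C * ((contDen a (j + 2) : ℝ) ^ (-k.re) * Real.exp (((a j : ℝ) + 1) ^ e)) := by
  have h1 := genDen_pos hr ha j
  have h2 := genDen_pos hr ha (j + 1)
  have h3 : (0 : ℝ) < contDen a (j + 2) := by exact_mod_cast contDen_pos ha (j + 1)
  have hlt : genDen r a (j + 1) < genDen r a (j + 2) := by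
    rw [genDen_succ_succ]
    have : (1 : ℝ) ≤ a j := by exact_mod_cast ha j
    nlinarith
  have habs : |s * (-1) ^ j * (genDen r a (j + 1) / genDen r a (j + 2))| =
      genDen r a (j + 1) / genDen r a (j + 2) := by
    rw [abs_mul, abs_mul, hs, abs_pow, abs_neg, abs_one, one_pow, one_mul, one_mul,
      abs_of_pos (by positivity)]
  have hb := hh (s * (-1) ^ j * (genDen r a (j + 1) / genDen r a (j + 2)))
    (by rw [habs]; exact (div_lt_one h2).2 hlt) (by rw [← abs_pos, habs]; positivity)
  rw [habs, inv_div] at hb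
  rw [cfTerm, norm_mul, Complex.norm_cpow_eq_rpow_re_of_pos h2, Complex.neg_re]
  calc _ ≤ (contDen a (j + 2) : ℝ) ^ (-k.re) * (C * Real.exp (((a j : ℝ) + 1) ^ e)) := by
        gcongr ?_ * ?_
        · exact Real.rpow_le_rpow_of_nonpos h3 (contDen_le_genDen hr a _) (by linarith)
        · refine hb.trans ?_
          gcongr
          exact genDen_ratio_le hr hr1 ha j
    _ = _ := by ring

/-- The geometric ratio governing the series. -/
noncomputable def cfRatio (κ : ℝ) : ℝ := (2 : ℝ) ^ (-(κ / 4))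

theorem cfRatio_pos (κ : ℝ) : 0 < cfRatio κ := Real.rpow_pos_of_pos two_pos _

theorem cfRatio_lt_one {κ : ℝ} (hκ : 0 < κ) : cfRatio κ < 1 :=
  Real.rpow_lt_one_of_one_lt_of_neg one_lt_two (by linarith)

/-- Half of the exponent κ pays for the exponential; the other half decays geometrically because the
squared denominator is at least 2^j. -/
theorem GoodDigit.majorant_le {κ e : ℝ} (hκ : 0 < κ) {a : ℕ → ℕ} (ha : ∀ n, 1 ≤ a n) {j : ℕ}
    (hg : GoodDigit κ e a j) :
    (contDen a (j + 2) : ℝ) ^ (-κ) * Real.exp (((a j : ℝ) + 1) ^ e) ≤ cfRatio κ ^ j := by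
  have h3 : (0 : ℝ) < contDen a (j + 2) := by exact_mod_cast contDen_pos ha (j + 1)
  have h4 : (2 : ℝ) ^ j ≤ (contDen a (j + 2) : ℝ) ^ 2 := by
    exact_mod_cast two_pow_le_contDen_sq ha j
  calc _ ≤ (contDen a (j + 2) : ℝ) ^ (-κ) * Real.exp (κ / 2 * Real.log (contDen a (j + 2))) := by
        gcongr; exact hg
    _ = (contDen a (j + 2) : ℝ) ^ (-(κ / 2)) := by
        rw [mul_comm (κ / 2), ← Real.rpow_def_of_pos h3, ← Real.rpow_add h3]
        congr 1; ring
    _ = ((contDen a (j + 2) : ℝ) ^ 2) ^ (-(κ / 4)) := by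
        rw [← Real.rpow_natCast, ← Real.rpow_mul h3.le]
        congr 1; push_cast; ring
    _ ≤ ((2 : ℝ) ^ j) ^ (-(κ / 4)) :=
        Real.rpow_le_rpow_of_nonpos (by positivity) h4 (by linarith)
    _ = _ := by
        rw [cfRatio, ← Real.rpow_natCast, ← Real.rpow_natCast, ← Real.rpow_mul two_pos.le,
          ← Real.rpow_mul two_pos.le, mul_comm]

theorem GoodDigit.norm_cfTerm_le {k : ℂ} (hk : 0 < k.re) {h : ℝ → ℂ} {C e : ℝ} (hC : 0 ≤ C)
    (he : 0 < e) (hh : InvExpBound h C e) {r s : ℝ} (hr : 0 ≤ r) (hr1 : r ≤ 1) (hs : |s| = 1)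
    {a : ℕ → ℕ} (ha : ∀ n, 1 ≤ a n) {j : ℕ} (hj : 0 < genDen r a j)
    (hg : GoodDigit k.re e a j) :
    ‖cfTerm k h r s a j‖ ≤ C * cfRatio k.re ^ j :=
  (_root_.norm_cfTerm_le hk hC he hh hr hr1 hs ha hj).trans
    (mul_le_mul_of_nonneg_left (hg.majorant_le hk ha) hC)

theorem summable_majorant {κ e : ℝ} (hκ : 0 < κ) {a : ℕ → ℕ} (ha : ∀ n, 1 ≤ a n)
    (hg : ∀ᶠ j in atTop, GoodDigit κ e a j) :
    Summable fun j =>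
      (contDen a (j + 2) : ℝ) ^ (-κ) * Real.exp (((a j : ℝ) + 1) ^ e) := by
  refine Summable.of_norm_bounded_eventually_nat
    (summable_geometric_of_lt_one (cfRatio_pos κ).le (cfRatio_lt_one hκ)) ?_
  filter_upwards [hg] with j hj
  rw [Real.norm_of_nonneg (by positivity)]
  exact hj.majorant_le hκ ha

theorem summable_norm_cfTerm {k : ℂ} (hk : 0 < k.re) {h : ℝ → ℂ} {C e : ℝ} (hC : 0 ≤ C)
    (he : 0 < e) (hh : InvExpBound h C e) {r s : ℝ} (hr : 0 ≤ r) (hr1 : r ≤ 1) (hs : |s| = 1)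
    {a : ℕ → ℕ} (ha : ∀ n, 1 ≤ a n) (hg : ∀ᶠ j in atTop, GoodDigit k.re e a j) :
    Summable fun j => ‖cfTerm k h r s a j‖ := by
  refine Summable.of_norm_bounded_eventually_nat ((summable_majorant hk ha hg).mul_left C) ?_
  filter_upwards [eventually_ge_atTop 1] with j hj
  rw [norm_norm]
  obtain ⟨i, rfl⟩ := Nat.exists_eq_add_of_le' hj
  exact norm_cfTerm_le hk hC he hh hr hr1 hs ha (genDen_pos hr ha i)

theorem norm_tsum_cfTerm_le {k : ℂ} (hk : 0 < k.re) {h : ℝ → ℂ} {C e : ℝ} (hC : 0 ≤ C)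
    (he : 0 < e) (hh : InvExpBound h C e) {r s : ℝ} (hr : 0 < r) (hr1 : r ≤ 1) (hs : |s| = 1)
    {a : ℕ → ℕ} (ha : ∀ n, 1 ≤ a n) (hg : ∀ᶠ j in atTop, GoodDigit k.re e a j) :
    ‖∑' j, cfTerm k h r s a j‖ ≤ ∑' j, C *
      ((contDen a (j + 2) : ℝ) ^ (-k.re) * Real.exp (((a j : ℝ) + 1) ^ e)) := by
  refine tsum_of_norm_bounded ((summable_majorant hk ha hg).mul_left C).hasSum fun j => ?_
  refine norm_cfTerm_le hk hC he hh hr.le hr1 hs ha ?_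
  cases j with
  | zero => exact hr
  | succ j => exact genDen_pos hr.le ha j

theorem norm_sum_sub_sum_le {k : ℂ} (hk : 0 < k.re) {h : ℝ → ℂ} {C e : ℝ} (hC : 0 ≤ C)
    (he : 0 < e) (hh : InvExpBound h C e) {r s : ℝ} (hr : 0 ≤ r) (hr1 : r ≤ 1) (hs : |s| = 1)
    {a : ℕ → ℕ} (ha : ∀ n, 1 ≤ a n) {M n : ℕ} (hM : 1 ≤ M) (hMn : M ≤ n)
    (hg : ∀ j, M ≤ j → j < n → GoodDigit k.re e a j) :
    ‖∑ j ∈ Finset.range n, cfTerm k h r s a j - ∑ j ∈ Finset.range M, cfTerm k h r s a j‖ ≤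
      C * (cfRatio k.re ^ M / (1 - cfRatio k.re)) := by
  rw [← Finset.sum_Ico_eq_sub _ hMn]
  refine (norm_sum_le_of_le _ (n := fun j => C * cfRatio k.re ^ j) fun j hj => ?_).trans ?_
  · rw [Finset.mem_Ico] at hj
    obtain ⟨i, rfl⟩ := Nat.exists_eq_add_of_le' (hM.trans hj.1)
    exact (hg _ hj.1 hj.2).norm_cfTerm_le hk hC he hh hr hr1 hs ha (genDen_pos hr ha i)
  · rw [← Finset.mul_sum]
    refine mul_le_mul_of_nonneg_left ?_ hC
    exact geom_sum_Ico_le_of_lt_one (cfRatio_pos _).le (cfRatio_lt_one hk)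

theorem norm_tsum_sub_sum_le {k : ℂ} (hk : 0 < k.re) {h : ℝ → ℂ} {C e : ℝ} (hC : 0 ≤ C)
    (he : 0 < e) (hh : InvExpBound h C e) {r s : ℝ} (hr : 0 ≤ r) (hr1 : r ≤ 1) (hs : |s| = 1)
    {a : ℕ → ℕ} (ha : ∀ n, 1 ≤ a n) {M : ℕ} (hM : 1 ≤ M)
    (hg : ∀ j, M ≤ j → GoodDigit k.re e a j) :
    ‖∑' j, cfTerm k h r s a j - ∑ j ∈ Finset.range M, cfTerm k h r s a j‖ ≤
      C * (cfRatio k.re ^ M / (1 - cfRatio k.re)) := by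
  have hsum := (summable_norm_cfTerm hk hC he hh hr hr1 hs ha
    (eventually_atTop.2 ⟨M, hg⟩)).of_norm.hasSum.tendsto_sum_nat
  refine le_of_tendsto (hsum.sub_const _).norm ?_
  filter_upwards [eventually_ge_atTop M] with n hn
  exact norm_sum_sub_sum_le hk hC he hh hr hr1 hs ha hM hn fun j hj _ => hg j hj

/-! ### Metric theory of the digits -/

/-- A summable approximation function. -/
noncomputable def logGap (κ β : ℝ) (c : ℕ) : ℝ := 4 / (c * (κ / 2 * Real.log c) ^ β)

theorem logGap_nonneg {κ : ℝ} (hκ : 0 < κ) (β : ℝ) (c : ℕ) : 0 ≤ logGap κ β c := by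
  have : 0 ≤ Real.log c := Real.log_natCast_nonneg c
  rw [logGap]; positivity

theorem logGap_pos {κ : ℝ} (hκ : 0 < κ) (β : ℝ) {c : ℕ} (hc : 2 ≤ c) : 0 < logGap κ β c := by
  have : 0 < Real.log c := Real.log_pos (by exact_mod_cast hc)
  have : (0 : ℝ) < c := by positivity
  rw [logGap]; positivity

/-- Cauchy condensation turns the sum of 1/(c log^β c) into the sum of n^{-β}. -/
theorem summable_logGap {κ β : ℝ} (hκ : 0 < κ) (hβ : 1 < β) : Summable (logGap κ β) := by
  rw [← summable_condensed_iff_of_eventually_nonneg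
    (Eventually.of_forall fun c => logGap_nonneg hκ β c)]
  · have h1 : Summable fun n : ℕ =>
        4 / (κ / 2 * Real.log 2) ^ β * ((n : ℝ) ^ β)⁻¹ :=
      (Real.summable_nat_rpow_inv.2 hβ).mul_left _
    refine h1.congr fun n => ?_
    have hl : 0 < Real.log 2 := Real.log_pos one_lt_two
    rw [logGap]
    push_cast
    rw [Real.log_pow, show κ / 2 * (n * Real.log 2) = κ / 2 * Real.log 2 * n by ring,
      Real.mul_rpow (x := κ / 2 * Real.log 2) (by positivity) (by positivity)]
    have : (2 : ℝ) ^ n ≠ 0 := by positivity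
    rw [← div_eq_mul_inv, div_div, mul_div_assoc', mul_div_mul_left _ _ this]
  · filter_upwards [eventually_ge_atTop 2] with c hc
    have hl : 0 < Real.log c := Real.log_pos (by exact_mod_cast hc)
    have hc0 : (0 : ℝ) < c := by positivity
    rw [logGap, logGap]
    have h1 : (c : ℝ) ≤ (c + 1 : ℕ) := by push_cast; linarith
    gcongr

/-- Let c and d be the denominators before and after the digit. A bad digit exceeds a constant times
(log c)^{1/e}, and d is at least the digit times c, so 1/(cd) is of size at most 1/(c² (log
c)^{1/e}). The numerator 2 leaves room to replace an irrational point by a nearby reduced fraction.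
-/
theorem two_div_lt_logGap_of_not_goodDigit {κ e : ℝ} (hκ : 0 < κ) (he : 0 < e) {a : ℕ → ℕ}
    (ha : ∀ n, 1 ≤ a n) {j : ℕ} (hj : 2 ≤ j) (hg : ¬ GoodDigit κ e a j) :
    2 / ((contDen a (j + 1) : ℝ) * contDen a (j + 2)) <
      logGap κ (1 / e) (contDen a (j + 1)) / contDen a (j + 1) := by
  have hc2 : (2 : ℝ) ≤ contDen a (j + 1) := by exact_mod_cast hj.trans (le_contDen ha j)
  have hcd : (contDen a (j + 1) : ℝ) ≤ contDen a (j + 2) := by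
    exact_mod_cast contDen_le_succ ha (j + 1)
  have hac : (a j : ℝ) * contDen a (j + 1) ≤ contDen a (j + 2) := by
    rw [contDen_succ_succ]; push_cast; linarith [Nat.cast_nonneg (α := ℝ) (contDen a j)]
  have ha1 : (1 : ℝ) ≤ a j := by exact_mod_cast ha j
  rw [GoodDigit, not_le] at hg
  set c : ℝ := (contDen a (j + 1) : ℝ) with hc
  set d : ℝ := (contDen a (j + 2) : ℝ) with hd
  have hc0 : 0 < c := by linarith
  have hd0 : 0 < d := by linarith
  have hlog : 0 < Real.log c := Real.log_pos (by linarith)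
  have h1 : (a j : ℝ) + 1 ≤ 2 * d / c := by
    rw [le_div_iff₀ hc0]; nlinarith
  have h2 : κ / 2 * Real.log c < (2 * d / c) ^ e :=
    calc κ / 2 * Real.log c ≤ κ / 2 * Real.log d := by gcongr
      _ < ((a j : ℝ) + 1) ^ e := hg
      _ ≤ _ := by gcongr
  have h3 : (κ / 2 * Real.log c) ^ (1 / e) < 2 * d / c := by
    have := Real.rpow_lt_rpow (by positivity) h2 (show 0 < 1 / e by positivity)
    rwa [← Real.rpow_mul (by positivity), mul_one_div_cancel he.ne', Real.rpow_one] at this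
  rw [logGap, ← hc, div_div, div_lt_div_iff₀ (by positivity) (by positivity)]
  rw [lt_div_iff₀ hc0] at h3
  nlinarith

/-- `y` is unusually close to a fraction with denominator at least `C₀`. -/
def CloseToFrac (κ β : ℝ) (C₀ : ℕ) (y : ℝ) : Prop :=
  ∃ c : ℕ, C₀ ≤ c ∧ ∃ p : ℤ, |y - p / c| ≤ logGap κ β c / c

theorem volume_near_frac_le {c : ℕ} (hc : 1 ≤ c) {η : ℝ} (hη0 : 0 ≤ η) (hη : η < 1) :
    volume {y : ℝ | y ∈ Icc (0 : ℝ) 1 ∧ ∃ p : ℤ, |y - p / c| ≤ η / c} ≤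
      ENNReal.ofReal (4 * η) := by
  have hc0 : (0 : ℝ) < c := by exact_mod_cast hc
  have hsub : {y : ℝ | y ∈ Icc (0 : ℝ) 1 ∧ ∃ p : ℤ, |y - p / c| ≤ η / c} ⊆
      ⋃ p ∈ Finset.range (c + 1), Metric.closedBall ((p : ℝ) / c) (η / c) := by
    rintro y ⟨hy, p, hp⟩
    have h1 := abs_le.1 hp
    have h2 : -1 < (p : ℝ) := by
      have : (0 : ℝ) ≤ (p + η) / c := by rw [add_div]; linarith [hy.1]
      have := mul_nonneg this hc0.le
      rw [div_mul_cancel₀ _ hc0.ne'] at this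
      linarith
    have h3 : (p : ℝ) < c + 1 := by
      have : (p - η) / c ≤ 1 := by rw [sub_div]; linarith [hy.2]
      rw [div_le_one hc0] at this
      linarith
    have h2' : -1 < p := by exact_mod_cast h2
    have h3' : p < c + 1 := by exact_mod_cast h3
    lift p to ℕ using by omega
    simp only [mem_iUnion]
    exact ⟨p, by simp; omega, by simpa [Real.dist_eq] using hp⟩
  refine (measure_mono hsub).trans ((measure_biUnion_finset_le _ _).trans ?_)
  simp only [Real.volume_closedBall, Finset.sum_const, Finset.card_range, nsmul_eq_mul]
  rw [← ENNReal.ofReal_natCast, ← ENNReal.ofReal_mul (by positivity)]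
  refine ENNReal.ofReal_le_ofReal ?_
  have h1 : (1 : ℝ) ≤ c := by exact_mod_cast hc
  push_cast
  rw [← mul_assoc, mul_div_assoc', div_le_iff₀ hc0]
  nlinarith

/-- Quantitative Borel-Cantelli: a denominator c contributes measure at most 4 `logGap κ β c`, and
the tail of a convergent series is small. -/
theorem exists_volume_closeToFrac_le {κ β : ℝ} (hκ : 0 < κ) (hβ : 1 < β) {τ : ENNReal}
    (hτ : 0 < τ) : ∀ᶠ C₀ : ℕ in atTop,
      volume {y : ℝ | y ∈ Icc (0 : ℝ) 1 ∧ CloseToFrac κ β C₀ y} ≤ τ := by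
  have hs := summable_logGap hκ hβ
  have h0 := (hs.mul_left 4).tsum_ofReal_ne_top
  have h1 := ENNReal.tendsto_sum_nat_add _ h0
  have h2 : ∀ᶠ c in atTop, logGap κ β c < 1 := hs.tendsto_atTop_zero.eventually_lt_const one_pos
  obtain ⟨N, hN⟩ := eventually_atTop.1 h2
  filter_upwards [h1.eventually_le_const hτ, eventually_ge_atTop N, eventually_ge_atTop 1]
    with C₀ hC hCN hC1
  refine le_trans ?_ hC
  have hsub : {y : ℝ | y ∈ Icc (0 : ℝ) 1 ∧ CloseToFrac κ β C₀ y} ⊆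
      ⋃ i : ℕ, {y : ℝ | y ∈ Icc (0 : ℝ) 1 ∧ ∃ p : ℤ,
        |y - p / (i + C₀ : ℕ)| ≤ logGap κ β (i + C₀) / (i + C₀ : ℕ)} := by
    rintro y ⟨hy, c, hc, p, hp⟩
    obtain ⟨i, rfl⟩ := Nat.exists_eq_add_of_le' hc
    exact mem_iUnion.2 ⟨i, hy, p, hp⟩
  refine (measure_mono hsub).trans ((measure_iUnion_le _).trans (ENNReal.tsum_le_tsum fun i => ?_))
  exact volume_near_frac_le (by omega) (logGap_nonneg hκ β _) (hN _ (by omega))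

theorem abs_fract_sub_lt {x : ℝ} (hx : Irrational x) (n : ℕ) :
    |Int.fract x - (contDen (fun i => cfDigit x (i + 1)) n : ℤ) / contDen (cfDigit x) (n + 1)| <
      1 / (contDen (cfDigit x) (n + 1) * contDen (cfDigit x) (n + 2)) := by
  obtain ⟨e, he0, he1, he⟩ := sub_convergent hx n
  rw [convergent_eq hx] at he
  push_cast at he ⊢
  rw [← sub_sub, Int.self_sub_floor] at he
  rw [he, abs_mul, abs_pow, abs_neg, abs_one, one_pow, one_mul, abs_of_pos he0]
  exact he1

theorem goodDigit_of_not_closeToFrac {κ e : ℝ} (hκ : 0 < κ) (he : 0 < e) {x : ℝ}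
    (hx : Irrational x) {C₀ : ℕ} (hC : ¬ CloseToFrac κ (1 / e) C₀ (Int.fract x)) {j : ℕ}
    (hj : 2 ≤ j) (hjC : C₀ ≤ j) : GoodDigit κ e (cfDigit x) j := by
  by_contra hg
  have ha := one_le_cfDigit hx
  refine hC ⟨contDen (cfDigit x) (j + 1), hjC.trans (le_contDen ha j), _,
    (abs_fract_sub_lt hx j).le.trans
    (le_trans ?_ (two_div_lt_logGap_of_not_goodDigit hκ he ha hj hg).le)⟩
  gcongr
  norm_num

theorem ae_fract {P : ℝ → Prop} (h : ∀ᵐ y ∂volume.restrict (Icc (0 : ℝ) 1), P y) :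
    ∀ᵐ x : ℝ, P (Int.fract x) := by
  rw [ae_restrict_iff' measurableSet_Icc, ae_iff] at h
  rw [ae_iff]
  refine measure_mono_null (t := ⋃ n : ℤ, (fun x : ℝ => x - n) ⁻¹'
    {y | ¬ (y ∈ Icc (0 : ℝ) 1 → P y)}) ?_ ?_
  · intro x hx
    refine mem_iUnion.2 ⟨⌊x⌋, ?_⟩
    simp only [mem_preimage, Int.self_sub_floor, mem_ofPred_eq, Classical.not_imp]
    exact ⟨⟨Int.fract_nonneg x, (Int.fract_lt_one x).le⟩, hx⟩
  · refine measure_iUnion_null fun n => ?_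
    simp only [sub_eq_add_neg]
    rw [measure_preimage_add_right, h]

theorem ae_irrational : ∀ᵐ x : ℝ, Irrational x := by
  have : (range ((↑) : ℚ → ℝ)).Countable := countable_range _
  exact this.ae_notMem volume

theorem ae_eventually_goodDigit {κ e : ℝ} (hκ : 0 < κ) (he : 0 < e) (he1 : e < 1) :
    ∀ᵐ x : ℝ, ∀ᶠ j in atTop, GoodDigit κ e (cfDigit x) j := by
  -- The strict inequality e < 1 enters here: it makes the gaps summable.
  have hβ : 1 < 1 / e := by rw [lt_div_iff₀ he]; linarith
  have h1 : ∀ᵐ y ∂volume.restrict (Icc (0 : ℝ) 1), ∃ C₀, ¬ CloseToFrac κ (1 / e) C₀ y := by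
    rw [ae_restrict_iff' measurableSet_Icc, ae_iff]
    refine le_antisymm (le_of_forall_pos_le_add fun τ hτ => ?_) bot_le
    rw [zero_add]
    obtain ⟨C₀, hC⟩ := (exists_volume_closeToFrac_le hκ hβ hτ).exists
    refine (measure_mono fun y hy => ?_).trans hC
    simp only [mem_ofPred_eq, Classical.not_imp, not_exists, not_not] at hy
    exact ⟨hy.1, hy.2 C₀⟩
  filter_upwards [ae_fract h1, ae_irrational] with x ⟨C₀, hC⟩ hx
  filter_upwards [eventually_ge_atTop 2, eventually_ge_atTop C₀] with j h2 hj
  exact goodDigit_of_not_closeToFrac hκ he hx hC h2 hj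

/-! ### Local constancy and measurability -/

theorem continuousAt_cfStep {x : ℝ} (hx : Irrational x) : ContinuousAt cfStep x := by
  have h1 : Ioo (⌊x⌋ : ℝ) (⌊x⌋ + 1) ∈ 𝓝 x :=
    Ioo_mem_nhds (lt_of_le_of_ne (Int.floor_le x) (hx.ne_int _).symm) (Int.lt_floor_add_one x)
  have h2 : (fun y : ℝ => (y - ⌊x⌋)⁻¹) =ᶠ[𝓝 x] cfStep := by
    filter_upwards [h1] with y hy
    rw [cfStep, ← Int.self_sub_floor, Int.floor_eq_iff.2 ⟨hy.1.le, hy.2⟩]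
  refine ContinuousAt.congr ?_ h2
  refine ContinuousAt.inv₀ (by fun_prop) ?_
  exact sub_ne_zero.2 (hx.ne_int _)

theorem continuousAt_iterate_cfStep {x : ℝ} (hx : Irrational x) (n : ℕ) :
    ContinuousAt cfStep^[n] x := by
  induction n generalizing x with
  | zero => exact continuousAt_id
  | succ n ih => exact ContinuousAt.comp (ih (irrational_cfStep hx)) (continuousAt_cfStep hx)

/-- Complete quotients of an irrational are irrational, hence away from the jumps of the floor
function. -/
theorem eventually_cfDigit_eq {x : ℝ} (hx : Irrational x) (n : ℕ) :
    ∀ᶠ y in 𝓝 x, cfDigit y n = cfDigit x n := by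
  have h1 := one_lt_iterate_cfStep hx n
  have h2 := irrational_iterate_cfStep hx (n + 1)
  have h3 : Ioo (cfDigit x n : ℝ) (cfDigit x n + 1) ∈ 𝓝 (cfStep^[n + 1] x) :=
    Ioo_mem_nhds (lt_of_le_of_ne (Nat.floor_le (by linarith)) (h2.ne_nat _).symm)
      (Nat.lt_floor_add_one _)
  filter_upwards [continuousAt_iterate_cfStep hx (n + 1) h3] with y hy
  exact (Nat.floor_eq_iff ((Nat.cast_nonneg _).trans hy.1.le)).2 ⟨hy.1.le, hy.2⟩

theorem eventually_cfDigit_eq_of_lt {x : ℝ} (hx : Irrational x) (N : ℕ) :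
    ∀ᶠ y in 𝓝 x, ∀ n < N, cfDigit y n = cfDigit x n := by
  exact (eventually_all_finite (finite_lt_nat N)).2 fun n _ => eventually_cfDigit_eq hx n

theorem contDen_congr {a b : ℕ → ℕ} : ∀ {n : ℕ}, (∀ i, i + 1 < n → a i = b i) →
    contDen a n = contDen b n
  | 0, _ => rfl
  | 1, _ => rfl
  | n + 2, h => by
      rw [contDen_succ_succ, contDen_succ_succ, h n (by omega),
        contDen_congr (n := n + 1) fun i hi => h i (by omega),
        contDen_congr (n := n) fun i hi => h i (by omega)]

theorem cfTerm_zero_congr (k : ℂ) (h : ℝ → ℂ) (s : ℝ) {a b : ℕ → ℕ} {j : ℕ}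
    (hab : ∀ i ≤ j, a i = b i) : cfTerm k h 0 s a j = cfTerm k h 0 s b j := by
  simp only [cfTerm, genDen_zero_eq]
  rw [contDen_congr (n := j + 2) fun i hi => hab i (by omega),
    contDen_congr (n := j + 1) fun i hi => hab i (by omega)]

theorem measurable_convergent (n : ℕ) : Measurable fun x : ℝ => x.convergent n := by
  induction n with
  | zero =>
    simp only [Real.convergent_zero]
    exact (measurable_from_top (f := fun m : ℤ => (m : ℚ))).comp Int.measurable_floor
  | succ n ih =>
    simp only [Real.convergent_succ]
    have h1 : Measurable fun x : ℝ => ((⌊x⌋ : ℤ) : ℚ) :=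
      (measurable_from_top (f := fun m : ℤ => (m : ℚ))).comp Int.measurable_floor
    have h2 : Measurable fun x : ℝ => (Real.convergent (Int.fract x)⁻¹ n)⁻¹ :=
      (measurable_of_countable (fun q : ℚ => q⁻¹)).comp (ih.comp measurable_fract.inv)
    exact h1.add h2

theorem measurable_daggerSeq (k : ℂ) (f : ℚ → ℂ) (j : ℕ) :
    Measurable fun x => daggerSeq k f x j :=
  (measurable_of_countable (fun q : ℚ => (q.den : ℂ) ^ (-k) * f (invRat q))).comp
    (measurable_convergent _)

theorem tendsto_daggerSeq {k : ℂ} (hk : 0 < k.re) {f : ℚ → ℂ} {h : ℝ → ℂ}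
    (hper : ∀ x : ℚ, x ∉ Icc (-1 : ℚ) 0 → f (x + 1) = f x)
    (hrec : ∀ x : ℚ, x ≠ 0 → h (x : ℝ) = f x - (((|x| : ℚ) : ℂ) ^ (-k)) * f (-1 / x))
    {C e : ℝ} (hC : 0 ≤ C) (he : 0 < e) (hh : InvExpBound h C e) {x : ℝ} (hx : Irrational x)
    (hg : ∀ᶠ j in atTop, GoodDigit k.re e (cfDigit x) j) :
    Tendsto (daggerSeq k f x) atTop (𝓝 (f (-1) + cfSum k h 0 1 x)) := by
  have h1 := (summable_norm_cfTerm hk hC he hh le_rfl zero_le_one abs_one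
    (one_le_cfDigit hx) hg).of_norm.hasSum.tendsto_sum_nat
  have h2 : Tendsto (fun j : ℕ => 2 * j + 1) atTop atTop :=
    tendsto_atTop_mono (fun j => by simp only [id]; omega) tendsto_id
  refine ((h1.comp h2).const_add (f (-1))).congr fun j => ?_
  rw [daggerSeq_eq hper hrec hx]; rfl

theorem dagger_eq {k : ℂ} (hk : 0 < k.re) {f : ℚ → ℂ} {h : ℝ → ℂ}
    (hper : ∀ x : ℚ, x ∉ Icc (-1 : ℚ) 0 → f (x + 1) = f x)
    (hrec : ∀ x : ℚ, x ≠ 0 → h (x : ℝ) = f x - (((|x| : ℚ) : ℂ) ^ (-k)) * f (-1 / x))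
    {C e : ℝ} (hC : 0 ≤ C) (he : 0 < e) (hh : InvExpBound h C e) {x : ℝ} (hx : Irrational x)
    (hg : ∀ᶠ j in atTop, GoodDigit k.re e (cfDigit x) j) :
    dagger k f x = f (-1) + cfSum k h 0 1 x :=
  (tendsto_daggerSeq hk hper hrec hC he hh hx hg).limUnder_eq

theorem ae_tendsto_dagger {k : ℂ} (hk : 0 < k.re) {f : ℚ → ℂ} {h : ℝ → ℂ}
    (hper : ∀ x : ℚ, x ∉ Icc (-1 : ℚ) 0 → f (x + 1) = f x)
    (hrec : ∀ x : ℚ, x ≠ 0 → h (x : ℝ) = f x - (((|x| : ℚ) : ℂ) ^ (-k)) * f (-1 / x))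
    {C e : ℝ} (hC : 0 ≤ C) (he : 0 < e) (he1 : e < 1) (hh : InvExpBound h C e) :
    ∀ᵐ x : ℝ, Tendsto (daggerSeq k f x) atTop (𝓝 (dagger k f x)) := by
  filter_upwards [ae_irrational, ae_eventually_goodDigit hk he he1] with x hx hg
  rw [dagger_eq hk hper hrec hC he hh hx hg]
  exact tendsto_daggerSeq hk hper hrec hC he hh hx hg

theorem aemeasurable_dagger {k : ℂ} {f : ℚ → ℂ}
    (h : ∀ᵐ x : ℝ, Tendsto (daggerSeq k f x) atTop (𝓝 (dagger k f x))) :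
    AEMeasurable (dagger k f) (volume : Measure ℝ) :=
  aemeasurable_of_tendsto_metrizable_ae atTop
    (fun j => (measurable_daggerSeq k f j).aemeasurable) h

/-! ### A lower bound for the totient -/

theorem exists_primeCounting_le_mul {ε : ℝ} (hε : 0 < ε) :
    ∃ N₀ : ℕ, ∀ n : ℕ, N₀ ≤ n → (Nat.primeCounting n : ℝ) ≤ ε * n := by
  have h1 := tendsto_natCast_atTop_atTop.eventually
    (Chebyshev.eventually_primeCounting_le (ε := 1) one_pos)
  have h2 : Tendsto (fun n : ℕ => Real.log n) atTop atTop :=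
    Real.tendsto_log_atTop.comp tendsto_natCast_atTop_atTop
  have h3 := h2.eventually_ge_atTop ((Real.log 4 + 1) / ε)
  obtain ⟨N₀, h⟩ := eventually_atTop.1 (h1.and (h3.and (eventually_ge_atTop 2)))
  refine ⟨N₀, fun n hn => ?_⟩
  obtain ⟨h1, h2, h3⟩ := h n hn
  rw [Nat.floor_natCast] at h1
  refine h1.trans ?_
  have hl : 0 < Real.log n := Real.log_pos (by exact_mod_cast h3)
  rw [div_le_iff₀ hl]
  rw [div_le_iff₀ hε] at h2
  have : (0 : ℝ) ≤ n := Nat.cast_nonneg n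
  nlinarith

/-- If p is the i-th smallest element of S, then i ≤ π(p) ≤ εp, so 1/p ≤ ε/i. Induction by inserting
the maximum makes this comparison with the harmonic sum. -/
theorem sum_inv_primes_le {ε : ℝ} {N₀ : ℕ}
    (hN : ∀ n : ℕ, N₀ ≤ n → (Nat.primeCounting n : ℝ) ≤ ε * n) (S : Finset ℕ) :
    (∀ p ∈ S, p.Prime ∧ N₀ ≤ p) → ∑ p ∈ S, (p : ℝ)⁻¹ ≤ ε * (harmonic S.card : ℝ) := by
  induction S using Finset.induction_on_max with
  | empty => simp
  | insert p S hmax ih =>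
    intro hS
    have hp : p ∉ S := fun h => lt_irrefl _ (hmax p h)
    rw [Finset.sum_insert hp, Finset.card_insert_of_notMem hp, harmonic_succ]
    have h1 := ih fun r hr => hS r (Finset.mem_insert_of_mem hr)
    have h2 := hN p (hS p (Finset.mem_insert_self _ _)).2
    have h3 : S.card + 1 ≤ Nat.primeCounting p := by
      rw [← Nat.primesLE_card_eq_primeCounting, ← Finset.card_insert_of_notMem hp]
      refine Finset.card_le_card fun r hr => ?_
      rw [Nat.mem_primesLE]
      refine ⟨?_, (hS r hr).1⟩
      rcases Finset.mem_insert.1 hr with rfl | h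
      · exact le_rfl
      · exact (hmax r h).le
    have h3' : ((S.card : ℝ) + 1) ≤ Nat.primeCounting p := by exact_mod_cast h3
    have hp0 : (0 : ℝ) < p := by exact_mod_cast (hS p (Finset.mem_insert_self _ _)).1.pos
    have h4 : (p : ℝ)⁻¹ ≤ ε * ((S.card : ℝ) + 1)⁻¹ := by
      rw [← div_eq_mul_inv, le_div_iff₀ (by positivity), inv_mul_le_iff₀ hp0]
      linarith
    push_cast
    linarith

theorem card_primeFactors_le_log {q : ℕ} (hq : q ≠ 0) :
    (q.primeFactors.card : ℝ) ≤ 2 * Real.log q := by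
  have h1 : 2 ^ q.primeFactors.card ≤ q :=
    calc 2 ^ q.primeFactors.card ≤ ∏ p ∈ q.primeFactors, p :=
          Finset.pow_card_le_prod _ _ _ fun p hp => (Nat.prime_of_mem_primeFactors hp).two_le
      _ ≤ q := Nat.le_of_dvd (Nat.pos_of_ne_zero hq) (Nat.prod_primeFactors_dvd q)
  have h2 : (2 : ℝ) ^ q.primeFactors.card ≤ q := by exact_mod_cast h1
  have h3 := Real.log_le_log (by positivity) h2
  rw [Real.log_pow] at h3
  have := Real.log_two_gt_d9
  have : (0 : ℝ) ≤ q.primeFactors.card := Nat.cast_nonneg _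
  nlinarith

/-- An arbitrarily small power of log q is needed here: later error terms beat q only by such a
power and must still be negligible against φ(q). It comes from the density zero of the primes and
the bound 2 log q for the number of prime factors. -/
theorem exists_le_totient_mul_log_rpow {γ : ℝ} (hγ : 0 < γ) :
    ∃ A : ℝ, 0 < A ∧ ∀ q : ℕ, 2 ≤ q → (q : ℝ) ≤ A * q.totient * Real.log q ^ γ := by
  obtain ⟨N₀, hN⟩ := exists_primeCounting_le_mul (half_pos hγ)
  refine ⟨Real.exp (2 * N₀ + γ) * 2 ^ γ, by positivity, fun q hq => ?_⟩
  have hq0 : q ≠ 0 := by omega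
  set S := q.primeFactors with hS
  have hω : 1 ≤ S.card := by
    rw [Nat.one_le_iff_ne_zero, Finset.card_ne_zero, Nat.nonempty_primeFactors]; omega
  have hω' : (1 : ℝ) ≤ S.card := by exact_mod_cast hω
  have hsum : ∑ p ∈ S, (p : ℝ)⁻¹ ≤ N₀ + γ / 2 * (1 + Real.log S.card) := by
    rw [← Finset.sum_filter_add_sum_filter_not S (fun p => p < N₀)]
    refine add_le_add ?_ ?_
    · calc ∑ p ∈ S with p < N₀, (p : ℝ)⁻¹ ≤ ∑ p ∈ S with p < N₀, (1 : ℝ) := by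
            refine Finset.sum_le_sum fun p hp => ?_
            refine inv_le_one_of_one_le₀ ?_
            exact_mod_cast (Nat.prime_of_mem_primeFactors (Finset.mem_filter.1 hp).1).pos
        _ ≤ ∑ p ∈ Finset.range N₀, (1 : ℝ) := by
            refine Finset.sum_le_sum_of_subset_of_nonneg (fun p hp => ?_) fun _ _ _ => zero_le_one
            simpa using (Finset.mem_filter.1 hp).2
        _ = N₀ := by simp
    · refine (sum_inv_primes_le hN _ fun p hp => ?_).trans ?_
      · rw [Finset.mem_filter, not_lt] at hp
        exact ⟨Nat.prime_of_mem_primeFactors hp.1, hp.2⟩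
      · refine mul_le_mul_of_nonneg_left ?_ (half_pos hγ).le
        refine le_trans ?_ (harmonic_le_one_add_log S.card)
        have : harmonic (S.filter fun p => ¬ p < N₀).card ≤ harmonic S.card := by
          refine Finset.sum_le_sum_of_subset_of_nonneg ?_ fun _ _ _ => by positivity
          exact Finset.range_subset_range.2 (Finset.card_filter_le _ _)
        exact_mod_cast this
  have hprod : (q.totient : ℝ) = q * ∏ p ∈ S, (1 - (p : ℝ)⁻¹) := by
    have := Nat.totient_eq_mul_prod_factors q
    have := congrArg (fun z : ℚ => (z : ℝ)) this
    push_cast at this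
    exact this
  -- Factorwise this is 1 - t ≥ exp(-2t) for 0 < t ≤ 1/2.
  have hge : Real.exp (-(2 * ∑ p ∈ S, (p : ℝ)⁻¹)) ≤ ∏ p ∈ S, (1 - (p : ℝ)⁻¹) := by
    rw [Finset.mul_sum, ← Finset.sum_neg_distrib, Real.exp_sum]
    refine Finset.prod_le_prod (fun _ _ => (Real.exp_pos _).le) fun p hp => ?_
    have h2 : (2 : ℝ) ≤ p := by exact_mod_cast (Nat.prime_of_mem_primeFactors hp).two_le
    have hx : (p : ℝ)⁻¹ ≤ 1 / 2 := by rw [one_div]; exact inv_anti₀ two_pos h2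
    have hx0 : 0 < (p : ℝ)⁻¹ := by positivity
    rw [Real.exp_neg, inv_le_iff_one_le_mul₀ (Real.exp_pos _)]
    have := Real.add_one_le_exp (2 * (p : ℝ)⁻¹)
    nlinarith
  have hlogS : (S.card : ℝ) ≤ 2 * Real.log q := card_primeFactors_le_log hq0
  have hfin : Real.exp (2 * ∑ p ∈ S, (p : ℝ)⁻¹) ≤
      Real.exp (2 * N₀ + γ) * 2 ^ γ * Real.log q ^ γ := by
    have hlog : 0 ≤ Real.log q := Real.log_natCast_nonneg q
    calc _ ≤ Real.exp (2 * N₀ + γ + Real.log S.card * γ) := by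
          refine Real.exp_le_exp.2 ?_; linarith
      _ = Real.exp (2 * N₀ + γ) * (S.card : ℝ) ^ γ := by
          rw [Real.exp_add, Real.rpow_def_of_pos (by linarith)]
      _ ≤ Real.exp (2 * N₀ + γ) * (2 * Real.log q) ^ γ := by gcongr
      _ = _ := by rw [Real.mul_rpow two_pos.le hlog, mul_assoc]
  have hE := Real.exp_pos (2 * ∑ p ∈ S, (p : ℝ)⁻¹)
  rw [Real.exp_neg, inv_le_iff_one_le_mul₀ hE] at hge
  have hq1 : (0 : ℝ) ≤ q := Nat.cast_nonneg q
  calc (q : ℝ) = q * 1 := (mul_one _).symm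
    _ ≤ q * ((∏ p ∈ S, (1 - (p : ℝ)⁻¹)) * Real.exp (2 * ∑ p ∈ S, (p : ℝ)⁻¹)) := by gcongr
    _ = q.totient * Real.exp (2 * ∑ p ∈ S, (p : ℝ)⁻¹) := by rw [hprod, mul_assoc]
    _ ≤ q.totient * (Real.exp (2 * N₀ + γ) * 2 ^ γ * Real.log q ^ γ) := by gcongr
    _ = _ := by ring

theorem tendsto_log_natCast : Tendsto (fun n : ℕ => Real.log n) atTop atTop :=
  Real.tendsto_log_atTop.comp tendsto_natCast_atTop_atTop

theorem eventually_mul_log_rpow_neg_le_totient {γ ε : ℝ} (hγ : 0 < γ) (hε : 0 < ε) :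
    ∀ᶠ q : ℕ in atTop, (q : ℝ) * Real.log q ^ (-γ) ≤ ε * q.totient := by
  obtain ⟨A, hA, h⟩ := exists_le_totient_mul_log_rpow (half_pos hγ)
  have h1 : Tendsto (fun q : ℕ => A * Real.log q ^ (-(γ / 2))) atTop (𝓝 (A * 0)) :=
    ((tendsto_rpow_neg_atTop (half_pos hγ)).comp tendsto_log_natCast).const_mul A
  rw [mul_zero] at h1
  filter_upwards [h1.eventually_le_const hε, eventually_ge_atTop 2] with q hq h2
  have hl : 0 < Real.log q := Real.log_pos (by exact_mod_cast h2)
  calc (q : ℝ) * Real.log q ^ (-γ) ≤ A * q.totient * Real.log q ^ (γ / 2) * Real.log q ^ (-γ) := by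
        gcongr; exact h q h2
    _ = A * Real.log q ^ (-(γ / 2)) * q.totient := by
        rw [mul_assoc, ← Real.rpow_add hl, show γ / 2 + -γ = -(γ / 2) by ring]; ring
    _ ≤ _ := by gcongr

theorem eventually_mul_rpow_le_totient {s ε A : ℝ} (hs : s < 1) (hε : 0 < ε) (hA : 0 < A) :
    ∀ᶠ q : ℕ in atTop, A * (q : ℝ) ^ s ≤ ε * q.totient := by
  have h1 : ∀ᶠ x : ℝ in atTop, ‖Real.log x ^ (1 : ℝ)‖ ≤ 1 * ‖x ^ (1 - s)‖ :=
    (isLittleO_log_rpow_rpow_atTop 1 (sub_pos.2 hs)).bound one_pos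
  filter_upwards [tendsto_natCast_atTop_atTop.eventually h1,
    eventually_mul_log_rpow_neg_le_totient one_pos (div_pos hε hA), eventually_ge_atTop 2]
    with q h2 h3 hq
  have hl : 0 < Real.log q := Real.log_pos (by exact_mod_cast hq)
  have hq0 : (0 : ℝ) < q := by positivity
  rw [Real.rpow_one, one_mul, Real.norm_of_nonneg hl.le, Real.norm_of_nonneg (by positivity)] at h2
  have h4 : (q : ℝ) ^ s ≤ q * Real.log q ^ (-1 : ℝ) := by
    rw [Real.rpow_neg_one, ← div_eq_mul_inv, le_div_iff₀ hl]
    calc (q : ℝ) ^ s * Real.log q ≤ (q : ℝ) ^ s * (q : ℝ) ^ (1 - s) := by gcongr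
      _ = q := by rw [← Real.rpow_add hq0]; simp
  calc A * (q : ℝ) ^ s ≤ A * (ε / A * q.totient) := by gcongr; exact h4.trans h3
    _ = _ := by field_simp

/-! ### Counting reduced residues -/

/-- Of two complementary divisors, one is at most √q. -/
theorem card_divisors_le_two_mul_sqrt (q : ℕ) : (q.divisors.card : ℝ) ≤ 2 * √(q : ℝ) := by
  have h1 : q.divisors ⊆ Finset.Icc 1 (Nat.sqrt q) ∪ (Finset.Icc 1 (Nat.sqrt q)).image (q / ·) := by
    intro d hd
    obtain ⟨⟨c, hc⟩, hq⟩ := Nat.mem_divisors.1 hd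
    have hd0 : 0 < d := Nat.pos_of_mem_divisors hd
    have hc0 : 0 < c := Nat.pos_of_ne_zero fun h => hq (by simp [hc, h])
    rw [Finset.mem_union, Finset.mem_image]
    by_cases h : d ≤ Nat.sqrt q
    · left; rw [Finset.mem_Icc]; exact ⟨hd0, h⟩
    · right
      refine ⟨c, Finset.mem_Icc.2 ⟨hc0, ?_⟩, by rw [hc, Nat.mul_div_cancel _ hc0]⟩
      by_contra hcs
      have h1 := Nat.lt_succ_sqrt q
      have h2 := Nat.mul_le_mul (Nat.succ_le_of_lt (not_le.1 h)) (Nat.succ_le_of_lt (not_le.1 hcs))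
      rw [← hc] at h2
      exact absurd h1 (not_lt.2 h2)
  have h2 : q.divisors.card ≤ 2 * Nat.sqrt q := by
    refine (Finset.card_le_card h1).trans ((Finset.card_union_le _ _).trans ?_)
    have := Finset.card_image_le (s := Finset.Icc 1 (Nat.sqrt q)) (f := (q / ·))
    simp only [Nat.card_Icc, Nat.add_sub_cancel] at this ⊢
    omega
  calc (q.divisors.card : ℝ) ≤ 2 * Nat.sqrt q := by exact_mod_cast h2
    _ ≤ _ := by gcongr; exact Real.nat_sqrt_le_real_sqrt

theorem sum_divisors_gcd_moebius {a q : ℕ} (hq : q ≠ 0) :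
    ∑ d ∈ q.divisors with d ∣ a, ArithmeticFunction.moebius d =
      if Nat.Coprime a q then 1 else 0 := by
  have h1 : q.divisors.filter (· ∣ a) = (Nat.gcd a q).divisors := by
    ext d
    simp [Nat.dvd_gcd_iff, hq, and_comm]
  have h2 := congrArg (fun F => F (Nat.gcd a q)) ArithmeticFunction.moebius_mul_coe_zeta
  rw [ArithmeticFunction.coe_mul_zeta_apply, ArithmeticFunction.one_apply] at h2
  rw [h1, h2]

theorem card_coprime_le_eq {q : ℕ} (hq : q ≠ 0) (n : ℕ) :
    (((Finset.Ioc 0 n).filter fun a => Nat.Coprime a q).card : ℤ) =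
      ∑ d ∈ q.divisors, ArithmeticFunction.moebius d * ((n / d : ℕ) : ℤ) := by
  rw [Finset.card_filter]
  simp only [Nat.cast_sum, Nat.cast_ite, Nat.cast_one, Nat.cast_zero, ← sum_divisors_gcd_moebius hq, Finset.sum_filter]
  rw [Finset.sum_comm]
  refine Finset.sum_congr rfl fun d _ => ?_
  rw [← Finset.sum_filter, Finset.sum_const, Nat.Ioc_filter_dvd_card_eq_div, nsmul_eq_mul,
    mul_comm]

theorem totient_eq_sum_moebius {q : ℕ} (hq : q ≠ 0) :
    (q.totient : ℝ) = q * ∑ d ∈ q.divisors, (ArithmeticFunction.moebius d : ℝ) / d := by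
  have h1 := card_coprime_le_eq hq q
  have h2 : ((Finset.Ioc 0 q).filter fun a => Nat.Coprime a q).card = q.totient := by
    have := Nat.filter_coprime_Ico_eq_totient q 1
    rw [← this]
    congr 1
    ext a
    simp [Nat.coprime_comm]
    omega
  rw [h2] at h1
  have h3 : (q.totient : ℝ) =
      ∑ d ∈ q.divisors, (ArithmeticFunction.moebius d : ℝ) * ((q / d : ℕ) : ℝ) := by
    simpa only [Int.cast_sum, Int.cast_mul, Int.cast_natCast] using
      congrArg (fun z : ℤ => (z : ℝ)) h1
  rw [h3, Finset.mul_sum]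
  refine Finset.sum_congr rfl fun d hd => ?_
  rw [Nat.cast_div (Nat.dvd_of_mem_divisors hd)
    (by exact_mod_cast (Nat.pos_of_mem_divisors hd).ne')]
  ring

/-- Möbius inversion, with an error of at most 1 from the floor for each divisor. -/
theorem abs_card_coprime_sub_le {q : ℕ} (hq : q ≠ 0) {X : ℝ} (hX : 0 ≤ X) :
    |(((Finset.Ioc 0 ⌊X⌋₊).filter fun a => Nat.Coprime a q).card : ℝ) - X * (q.totient / q)| ≤
      q.divisors.card := by
  have h1 : (((Finset.Ioc 0 ⌊X⌋₊).filter fun a => Nat.Coprime a q).card : ℝ) =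
      ∑ d ∈ q.divisors, (ArithmeticFunction.moebius d : ℝ) * ((⌊X⌋₊ / d : ℕ) : ℝ) := by
    simpa only [Int.cast_sum, Int.cast_mul, Int.cast_natCast] using
      congrArg (fun z : ℤ => (z : ℝ)) (card_coprime_le_eq hq ⌊X⌋₊)
  have hq0 : (q : ℝ) ≠ 0 := by exact_mod_cast hq
  rw [h1, totient_eq_sum_moebius hq, mul_div_cancel_left₀ _ hq0, Finset.mul_sum,
    ← Finset.sum_sub_distrib, Finset.card_eq_sum_ones]
  push_cast
  refine (Finset.abs_sum_le_sum_abs _ _).trans (Finset.sum_le_sum fun d hd => ?_)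
  have hm : |(ArithmeticFunction.moebius d : ℝ)| ≤ 1 := by
    exact_mod_cast ArithmeticFunction.abs_moebius_le_one (n := d)
  have hd0 : (0 : ℝ) < d := by exact_mod_cast Nat.pos_of_mem_divisors hd
  rw [show (ArithmeticFunction.moebius d : ℝ) * ((⌊X⌋₊ / d : ℕ) : ℝ) -
    X * (ArithmeticFunction.moebius d / d) =
    ArithmeticFunction.moebius d * (((⌊X⌋₊ / d : ℕ) : ℝ) - X / d) by ring, abs_mul,
    ← Nat.floor_div_natCast]
  have h2 : |(⌊X / d⌋₊ : ℝ) - X / d| ≤ 1 := by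
    rw [abs_sub_comm, abs_le]
    have := Nat.floor_le (div_nonneg hX hd0.le)
    have := Nat.lt_floor_add_one (X / d)
    constructor <;> linarith
  calc _ ≤ 1 * (1 : ℝ) := by gcongr
    _ = 1 := one_mul 1

/-- The residues `1 ≤ a ≤ q` coprime to `q`. -/
def reducedResidues (q : ℕ) : Finset ℕ := (Finset.Icc 1 q).filter fun a => Nat.Coprime a q

theorem card_reducedResidues (q : ℕ) : (reducedResidues q).card = q.totient := by
  rw [reducedResidues, ← Nat.filter_coprime_Ico_eq_totient q 1]
  congr 1
  ext a
  simp [Nat.coprime_comm]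
  omega

theorem card_coprime_Ioc_eq {q : ℕ} {α β : ℝ} (hα : 0 ≤ α) (hαβ : α ≤ β) :
    ((((Finset.Ioc 0 ⌊β⌋₊).filter fun a => Nat.Coprime a q).filter
      fun a : ℕ => α < a ∧ (a : ℝ) ≤ β).card : ℝ) =
      (((Finset.Ioc 0 ⌊β⌋₊).filter fun a => Nat.Coprime a q).card : ℝ) -
      (((Finset.Ioc 0 ⌊α⌋₊).filter fun a => Nat.Coprime a q).card : ℝ) := by
  rw [eq_sub_iff_add_eq]
  norm_cast
  rw [← Finset.card_union_of_disjoint]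
  · congr 1
    ext a
    simp only [Finset.mem_union, Finset.mem_filter, Finset.mem_Ioc, Nat.le_floor_iff hα,
      Nat.le_floor_iff (hα.trans hαβ)]
    constructor
    · rintro (h | h)
      · exact h.1
      · exact ⟨⟨h.1.1, h.1.2.trans hαβ⟩, h.2⟩
    · intro h
      by_cases h1 : α < a
      · left; exact ⟨h, h1, h.1.2⟩
      · right; exact ⟨⟨h.1.1, not_lt.1 h1⟩, h.2⟩
  · rw [Finset.disjoint_left]
    intro a h1 h2
    simp only [Finset.mem_filter, Finset.mem_Ioc, Nat.le_floor_iff hα] at h1 h2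
    linarith [h1.2.1, h2.1.2]

theorem card_reducedResidues_Ioc_le {q : ℕ} (hq : q ≠ 0) {α β : ℝ} (hαβ : α ≤ β) (hβ : 0 ≤ β) :
    (((reducedResidues q).filter fun a : ℕ => α < (a : ℝ) / q ∧ (a : ℝ) / q ≤ β).card : ℝ) ≤
      (β - α) * q.totient + 2 * q.divisors.card := by
  have hq0 : (0 : ℝ) < q := by positivity
  -- The left endpoint may be negative when the interval surrounds 0.
  have hm : 0 ≤ max α 0 := le_max_right _ _
  have hmβ : max α 0 ≤ β := max_le hαβ hβ
  have h1 := card_coprime_Ioc_eq (q := q) (mul_nonneg hm hq0.le)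
    (mul_le_mul_of_nonneg_right hmβ hq0.le)
  have h2 := abs_le.1 (abs_card_coprime_sub_le hq (mul_nonneg hβ hq0.le))
  have h3 := abs_le.1 (abs_card_coprime_sub_le hq (mul_nonneg hm hq0.le))
  have h4 : (((reducedResidues q).filter fun a : ℕ => α < (a : ℝ) / q ∧ (a : ℝ) / q ≤ β).card : ℝ)
      ≤ (((Finset.Ioc 0 ⌊β * q⌋₊).filter fun a => Nat.Coprime a q).filter
      fun a : ℕ => max α 0 * q < a ∧ (a : ℝ) ≤ β * q).card := by
    norm_cast
    refine Finset.card_le_card fun a ha => ?_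
    simp only [reducedResidues, Finset.mem_filter, Finset.mem_Icc, Finset.mem_Ioc] at ha ⊢
    obtain ⟨⟨⟨ha1, ha2⟩, hcop⟩, hl, hu⟩ := ha
    rw [div_le_iff₀ hq0] at hu
    rw [lt_div_iff₀ hq0] at hl
    refine ⟨⟨⟨ha1, Nat.le_floor hu⟩, hcop⟩, ?_, hu⟩
    rcases max_choice α 0 with h | h <;> rw [h]
    · exact hl
    · rw [zero_mul]; exact_mod_cast ha1
  have h5 : ∀ y : ℝ, y * q * (q.totient / q) = y * q.totient := fun y => by field_simp
  rw [h5] at h2 h3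
  have h6 : max α 0 * (q.totient : ℝ) ≥ α * q.totient := by
    gcongr; exact le_max_left _ _
  linarith [h2.1, h2.2, h3.1, h3.2]

theorem le_card_reducedResidues_Ioc {q : ℕ} (hq : q ≠ 0) {α β : ℝ} (hα : 0 ≤ α) (hαβ : α ≤ β)
    (hβ : β ≤ 1) : (β - α) * q.totient - 2 * q.divisors.card ≤
    (((reducedResidues q).filter fun a : ℕ => α < (a : ℝ) / q ∧ (a : ℝ) / q ≤ β).card : ℝ) := by
  have hq0 : (0 : ℝ) < q := by positivity
  have h1 := card_coprime_Ioc_eq (q := q) (mul_nonneg hα hq0.le)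
    (mul_le_mul_of_nonneg_right hαβ hq0.le)
  have h2 := abs_le.1 (abs_card_coprime_sub_le hq (mul_nonneg (hα.trans hαβ) hq0.le))
  have h3 := abs_le.1 (abs_card_coprime_sub_le hq (mul_nonneg hα hq0.le))
  have h4 : ((((Finset.Ioc 0 ⌊β * q⌋₊).filter fun a => Nat.Coprime a q).filter
      fun a : ℕ => α * q < a ∧ (a : ℝ) ≤ β * q).card : ℝ) ≤
      ((reducedResidues q).filter fun a : ℕ => α < (a : ℝ) / q ∧ (a : ℝ) / q ≤ β).card := by
    norm_cast
    refine Finset.card_le_card fun a ha => ?_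
    simp only [reducedResidues, Finset.mem_filter, Finset.mem_Icc, Finset.mem_Ioc] at ha ⊢
    obtain ⟨⟨⟨ha1, ha2⟩, hcop⟩, hl, hu⟩ := ha
    refine ⟨⟨⟨ha1, ?_⟩, hcop⟩, by rwa [lt_div_iff₀ hq0], by rwa [div_le_iff₀ hq0]⟩
    have : (a : ℝ) ≤ q := hu.trans (by nlinarith)
    exact_mod_cast this
  have h5 : ∀ y : ℝ, y * q * (q.totient / q) = y * q.totient := fun y => by field_simp
  rw [h5] at h2 h3
  linarith [h2.1, h2.2, h3.1, h3.2]

/-! ### Reduced residues close to fractions with smaller denominator -/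

-- Around each of the c + 1 fractions p/c, reduced residues are counted in an interval of length
-- 3η/c. The error is proportional to c times the number of divisors of q, so the bound is used only
-- for c up to a small power of q.
open Classical in
theorem card_near_frac_le {q c : ℕ} (hq : q ≠ 0) (hc : 1 ≤ c) {η : ℝ} (hη0 : 0 < η) (hη : η < 1) :
    (((reducedResidues q).filter fun a : ℕ => ∃ p : ℤ, |(a : ℝ) / q - p / c| ≤ η / c).card : ℝ) ≤
      6 * η * q.totient + 4 * c * q.divisors.card := by
  have hq0 : (0 : ℝ) < q := by positivity
  have hc0 : (0 : ℝ) < c := by exact_mod_cast hc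
  have hc1 : (1 : ℝ) ≤ c := by exact_mod_cast hc
  have hsub : (reducedResidues q).filter (fun a : ℕ => ∃ p : ℤ, |(a : ℝ) / q - p / c| ≤ η / c) ⊆
      (Finset.range (c + 1)).biUnion fun p => (reducedResidues q).filter fun a : ℕ =>
        -- Taking 2η instead of η on the left makes the strict inequality of the half-open interval
        -- hold.
        ((p : ℝ) - 2 * η) / c < (a : ℝ) / q ∧ (a : ℝ) / q ≤ (p + η) / c := by
    intro a ha
    rw [Finset.mem_filter] at ha
    obtain ⟨ha, p, hp⟩ := ha
    have ha' := ha
    rw [reducedResidues, Finset.mem_filter, Finset.mem_Icc] at ha'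
    have h1 := abs_le.1 hp
    have hy0 : 0 ≤ (a : ℝ) / q := by positivity
    have hy1 : (a : ℝ) / q ≤ 1 := (div_le_one hq0).2 (by exact_mod_cast ha'.1.2)
    have hu : (a : ℝ) / q ≤ (p + η) / c := by rw [add_div]; linarith
    have hl : (p - η) / c ≤ (a : ℝ) / q := by rw [sub_div]; linarith
    have h2 : -1 < (p : ℝ) := by
      have := mul_nonneg (hy0.trans hu) hc0.le
      rw [div_mul_cancel₀ _ hc0.ne'] at this
      linarith
    have h3 : (p : ℝ) < c + 1 := by
      have := hl.trans hy1
      rw [div_le_one hc0] at this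
      linarith
    have h2' : -1 < p := by exact_mod_cast h2
    have h3' : p < c + 1 := by exact_mod_cast h3
    lift p to ℕ using by omega
    rw [Finset.mem_biUnion]
    refine ⟨p, by simp; omega, Finset.mem_filter.2 ⟨ha, lt_of_lt_of_le ?_ hl, hu⟩⟩
    refine div_lt_div_of_pos_right ?_ hc0
    push_cast
    linarith
  have h1 : (((reducedResidues q).filter
      fun a : ℕ => ∃ p : ℤ, |(a : ℝ) / q - p / c| ≤ η / c).card : ℝ) ≤
      ∑ p ∈ Finset.range (c + 1), (((reducedResidues q).filter fun a : ℕ =>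
        ((p : ℝ) - 2 * η) / c < (a : ℝ) / q ∧ (a : ℝ) / q ≤ (p + η) / c).card : ℝ) := by
    exact_mod_cast (Finset.card_le_card hsub).trans Finset.card_biUnion_le
  refine h1.trans ((Finset.sum_le_sum fun p _ => card_reducedResidues_Ioc_le hq ?_ ?_).trans ?_)
  · gcongr; linarith
  · positivity
  · have h2 : ∀ p : ℝ, (p + η) / c - (p - 2 * η) / c = 3 * η / c := fun p => by
      rw [← sub_div]; ring
    simp only [h2, Finset.sum_const, Finset.card_range, nsmul_eq_mul]
    push_cast
    have h3 : ((c : ℝ) + 1) * (3 * η / c) ≤ 6 * η := by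
      rw [mul_div_assoc', div_le_iff₀ hc0]; nlinarith
    have h4 : (0 : ℝ) ≤ q.totient := Nat.cast_nonneg _
    have h5 : (0 : ℝ) ≤ q.divisors.card := Nat.cast_nonneg _
    nlinarith [mul_le_mul_of_nonneg_right h3 h4]

-- There is no error term, which makes the bound usable for large c. With g = gcd(c, q), c = c'g, q
-- = q'g, a residue near p/c yields the integer u = a c' - p q' with |u| ≤ qη/g. It is nonzero
-- because c < q and a is coprime to q, and it determines a modulo q'; so at most g residues share
-- each u.
open Classical in
theorem card_near_frac_le_of_lt {q c : ℕ} (hc : 1 ≤ c) (hcq : c < q) {η : ℝ} (hη : 0 ≤ η) :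
    (((reducedResidues q).filter fun a : ℕ => ∃ p : ℤ, |(a : ℝ) / q - p / c| ≤ η / c).card : ℝ) ≤
      2 * q * η := by
  obtain ⟨g, c', q', hg, hcop, hc', hq'⟩ : ∃ g c' q' : ℕ, 0 < g ∧ Nat.Coprime c' q' ∧
      c = c' * g ∧ q = q' * g := by
    obtain ⟨c', q', h1, h2, h3⟩ := Nat.exists_coprime c q
    exact ⟨_, c', q', Nat.gcd_pos_of_pos_left _ (by omega), h1, h2, h3⟩
  have hg0 : (0 : ℝ) < g := by exact_mod_cast hg
  have hq0 : (0 : ℝ) < q := by exact_mod_cast (show 0 < q by omega)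
  have hc0 : (0 : ℝ) < c := by exact_mod_cast hc
  have hq'0 : 0 < q' := by
    rcases Nat.eq_zero_or_pos q' with h | h
    · simp [h] at hq'; omega
    · exact h
  have hcr : (c : ℝ) = c' * g := by exact_mod_cast hc'
  have hqr : (q : ℝ) = q' * g := by exact_mod_cast hq'
  set X : ℝ := q * η / g with hX
  have hX0 : 0 ≤ X := by positivity
  have hex : ∀ a : ℕ, ∃ p : ℤ, (∃ p' : ℤ, |(a : ℝ) / q - p' / c| ≤ η / c) →
      |(a : ℝ) / q - p / c| ≤ η / c := by
    intro a
    by_cases h : ∃ p' : ℤ, |(a : ℝ) / q - p' / c| ≤ η / c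
    · exact ⟨h.choose, fun _ => h.choose_spec⟩
    · exact ⟨0, fun h' => absurd h' h⟩
  choose p hp using hex
  set u : ℕ → ℤ := fun a => a * c' - p a * q' with hu
  set T : Finset (ℤ × ℕ) :=
    ((Finset.Icc (-(⌊X⌋₊ : ℤ)) ⌊X⌋₊).erase 0) ×ˢ Finset.range g with hT
  have hcard : (T.card : ℝ) ≤ 2 * q * η := by
    rw [hT, Finset.card_product, Finset.card_erase_of_mem (by simp), Int.card_Icc,
      Finset.card_range]
    have h1 : (⌊X⌋₊ + 1 - -(⌊X⌋₊ : ℤ)).toNat - 1 = 2 * ⌊X⌋₊ := by omega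
    rw [h1]
    push_cast
    have h2 : (⌊X⌋₊ : ℝ) ≤ X := Nat.floor_le hX0
    calc (2 * ⌊X⌋₊ * g : ℝ) ≤ 2 * X * g := by gcongr
      _ = 2 * q * η := by rw [hX]; field_simp
  refine le_trans ?_ hcard
  refine Nat.cast_le.2 (Finset.card_le_card_of_injOn (fun a => (u a, (a - 1) / q')) ?_ ?_)
  · intro a ha
    rw [Finset.mem_coe, Finset.mem_filter] at ha
    obtain ⟨ha, hpa⟩ := ha
    rw [reducedResidues, Finset.mem_filter, Finset.mem_Icc] at ha
    obtain ⟨⟨ha1, haq⟩, hac⟩ := ha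
    have h1 := hp a hpa
    rw [Finset.mem_coe, hT, Finset.mem_product, Finset.mem_erase, Finset.mem_Icc, Finset.mem_range]
    have hub : |(u a : ℝ)| ≤ X := by
      have h2 : (u a : ℝ) = ((a : ℝ) / q - p a / c) * (c * q / g) := by
        rw [hu]; push_cast
        field_simp
        rw [hcr, hqr]; ring
      have hcg : (0 : ℝ) ≤ c * q / g := by positivity
      rw [h2, abs_mul, abs_of_nonneg hcg]
      calc _ ≤ η / c * (c * q / g) := by gcongr
        _ = X := by rw [hX]; field_simp
    have hub' : |u a| ≤ ⌊X⌋₊ := by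
      rw [Int.abs_eq_natAbs]
      have h3 : ((u a).natAbs : ℝ) ≤ X := by
        rw [Nat.cast_natAbs]; push_cast; exact hub
      exact_mod_cast Nat.le_floor h3
    refine ⟨⟨fun h0 => ?_, abs_le.1 hub'⟩, ?_⟩
    -- If u = 0, then q' divides both a and q, so q' = 1 and q = g ≤ c, a contradiction.
    · have h2 : (q' : ℤ) ∣ a * c' := ⟨p a, by simp only [hu] at h0; linarith⟩
      have h3 : q' ∣ a * c' := by exact_mod_cast h2
      have h4 : q' ∣ a := hcop.symm.dvd_of_dvd_mul_right h3
      have h5 : q' ∣ Nat.gcd a q := Nat.dvd_gcd h4 ⟨g, hq'⟩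
      rw [hac, Nat.dvd_one] at h5
      rw [h5, one_mul] at hq'
      have : g ≤ c := Nat.le_of_dvd hc ⟨c', by rw [hc', mul_comm]⟩
      omega
    · rw [Nat.div_lt_iff_lt_mul hq'0, mul_comm, ← hq']; omega
  · intro a ha b hb hab
    rw [Finset.mem_coe, Finset.mem_filter, reducedResidues, Finset.mem_filter,
      Finset.mem_Icc] at ha hb
    simp only [Prod.mk.injEq, hu] at hab
    have h1 : (q' : ℤ) ∣ ((a : ℤ) - b) * c' := ⟨p a - p b, by linarith [hab.1]⟩
    have h2 : (q' : ℤ) ∣ (a : ℤ) - b :=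
      (Int.isCoprime_iff_gcd_eq_one.2 (by simpa using hcop.symm)).dvd_of_dvd_mul_right h1
    have h3 : (b - 1) % q' = (a - 1) % q' := by
      refine (Nat.modEq_iff_dvd.2 ?_)
      rw [Nat.cast_sub ha.1.1.1, Nat.cast_sub hb.1.1.1]
      simpa using h2
    have h4 := Nat.div_add_mod (a - 1) q'
    have h5 := Nat.div_add_mod (b - 1) q'
    rw [hab.2, ← h3, h5] at h4
    have := ha.1.1.1
    have := hb.1.1.1
    omega

theorem exists_sum_logGap_le {κ β : ℝ} (hκ : 0 < κ) (hβ : 1 < β) {ε : ℝ} (hε : 0 < ε) :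
    ∃ C₁ : ℕ, ∀ t : Finset ℕ, (∀ c ∈ t, C₁ ≤ c) → ∑ c ∈ t, logGap κ β c ≤ ε := by
  obtain ⟨s, hs⟩ := summable_iff_vanishing_norm.1 (summable_logGap hκ hβ) ε hε
  obtain ⟨N, hN⟩ := s.exists_nat_subset_range
  refine ⟨N, fun t ht => ?_⟩
  refine (le_abs_self _).trans (hs t ?_).le
  rw [Finset.disjoint_left]
  intro c hc hcs
  have h1 := ht c hc
  have h2 := Finset.mem_range.1 (hN hcs)
  omega

/-- Half of the excess β - 1 is given up for a factor that is a negative power of L, and the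
remaining gap function is still summable. -/
theorem logGap_le_of_log_le {κ β : ℝ} (hκ : 0 < κ) (hβ : 1 < β) {c : ℕ} {L : ℝ}
    (hL : 0 < L) (hLc : L ≤ Real.log c) :
    logGap κ β c ≤ logGap κ ((1 + β) / 2) c * (κ / 2 * L) ^ (-((β - 1) / 2)) := by
  have hl : 0 < Real.log c := hL.trans_le hLc
  have hc0 : (0 : ℝ) < c := by
    rcases Nat.eq_zero_or_pos c with h | h
    · simp [h] at hl
    · exact_mod_cast h
  have h1 : logGap κ β c =
      logGap κ ((1 + β) / 2) c * (κ / 2 * Real.log c) ^ (-((β - 1) / 2)) := by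
    rw [logGap, logGap, Real.rpow_neg (by positivity), ← div_eq_mul_inv, div_div, mul_assoc,
      ← Real.rpow_add (by positivity)]
    congr 4; ring
  rw [h1]
  refine mul_le_mul_of_nonneg_left ?_ (logGap_nonneg hκ _ _)
  exact Real.rpow_le_rpow_of_nonpos (by positivity) (by gcongr) (by linarith)

open Classical in
/-- The reduced residues `a` such that `a / q` is unusually close to a fraction with denominator
in `[C₀, q)`. -/
noncomputable def closeResidues (κ β : ℝ) (C₀ q : ℕ) : Finset ℕ :=
  (reducedResidues q).filter fun a : ℕ => ∃ c : ℕ, C₀ ≤ c ∧ c < q ∧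
    ∃ p : ℤ, |(a : ℝ) / q - p / c| ≤ logGap κ β c / c

/-- The denominators are split at q^{1/10}. Below, interval counting costs a small tail sum times
φ(q) plus a power saving; above, the arithmetic bound gives q times a negative power of log q,
negligible by the totient estimate. -/
theorem exists_card_closeResidues_le {κ β : ℝ} (hκ : 0 < κ) (hβ : 1 < β) {τ : ℝ} (hτ : 0 < τ) :
    ∃ C₁ : ℕ, ∀ C₀, C₁ ≤ C₀ → ∀ᶠ q : ℕ in atTop,
      ((closeResidues κ β C₀ q).card : ℝ) ≤ τ * q.totient := by
  classical
  have hs := summable_logGap hκ hβ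
  obtain ⟨N, hN⟩ := eventually_atTop.1 (hs.tendsto_atTop_zero.eventually_lt_const one_pos)
  obtain ⟨C₁, hC₁⟩ := exists_sum_logGap_le hκ hβ (show 0 < τ / 18 by positivity)
  refine ⟨max C₁ (max N 2), fun C₀ hC₀ => ?_⟩
  have hC₁0 : C₁ ≤ C₀ := (le_max_left _ _).trans hC₀
  have hN0 : N ≤ C₀ := (le_max_left _ _).trans ((le_max_right _ _).trans hC₀)
  have h20 : 2 ≤ C₀ := (le_max_right _ _).trans ((le_max_right _ _).trans hC₀)
  set γ := (β - 1) / 2 with hγ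
  have hγ0 : 0 < γ := by rw [hγ]; linarith
  set S : ℝ := ∑' c, logGap κ ((1 + β) / 2) c with hS
  have hsum' : Summable (logGap κ ((1 + β) / 2)) := summable_logGap hκ (by linarith)
  have hS0 : 0 ≤ S := tsum_nonneg fun c => logGap_nonneg hκ _ _
  set A : ℝ := 2 * (S + 1) * (κ / 20) ^ (-γ) with hA
  have hA0 : 0 < A := by positivity
  -- The exponent 7/10 is 1/10 for the number of c, 1/10 for the factor c in the error, and 1/2 for
  -- the divisor count.
  have hev1 := eventually_mul_rpow_le_totient (s := 7 / 10) (ε := τ / 3) (A := 8) (by norm_num)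
    (by positivity) (by norm_num)
  have hev2 := eventually_mul_log_rpow_neg_le_totient hγ0 (show 0 < τ / 3 / A by positivity)
  filter_upwards [hev1, hev2, eventually_ge_atTop 2] with q hq1 hq2 hq
  have hq0 : (0 : ℝ) < q := by positivity
  have hφ : (0 : ℝ) ≤ q.totient := Nat.cast_nonneg _
  have hlq : 0 < Real.log q := Real.log_pos (by exact_mod_cast hq)
  set B : ℕ → Finset ℕ := fun c =>
    (reducedResidues q).filter fun a : ℕ => ∃ p : ℤ, |(a : ℝ) / q - p / c| ≤ logGap κ β c / c with hB
  set I₁ := (Finset.Ico C₀ q).filter fun c => c ^ 10 ≤ q with hI₁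
  set I₂ := (Finset.Ico C₀ q).filter fun c => ¬ c ^ 10 ≤ q with hI₂
  have hsub : closeResidues κ β C₀ q ⊆ (Finset.Ico C₀ q).biUnion B := by
    intro a ha
    rw [closeResidues, Finset.mem_filter] at ha
    obtain ⟨ha, c, hc1, hc2, hp⟩ := ha
    exact Finset.mem_biUnion.2 ⟨c, Finset.mem_Ico.2 ⟨hc1, hc2⟩, Finset.mem_filter.2 ⟨ha, hp⟩⟩
  have hle : ((closeResidues κ β C₀ q).card : ℝ) ≤
      ∑ c ∈ I₁, ((B c).card : ℝ) + ∑ c ∈ I₂, ((B c).card : ℝ) := by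
    rw [Finset.sum_filter_add_sum_filter_not]
    exact_mod_cast (Finset.card_le_card hsub).trans Finset.card_biUnion_le
  have hmem1 : ∀ c ∈ I₁, C₀ ≤ c ∧ (c : ℝ) ≤ (q : ℝ) ^ (1 / 10 : ℝ) := by
    intro c hc
    rw [hI₁, Finset.mem_filter, Finset.mem_Ico] at hc
    refine ⟨hc.1.1, ?_⟩
    have h1 : (c : ℝ) ^ (10 : ℕ) ≤ q := by exact_mod_cast hc.2
    calc (c : ℝ) = ((c : ℝ) ^ (10 : ℕ)) ^ (1 / 10 : ℝ) := by
          rw [← Real.rpow_natCast, ← Real.rpow_mul (Nat.cast_nonneg c)]; norm_num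
      _ ≤ _ := by gcongr
  have hsum1 : ∑ c ∈ I₁, ((B c).card : ℝ) ≤ τ / 3 * q.totient + 8 * (q : ℝ) ^ (7 / 10 : ℝ) := by
    have h1 : ∀ c ∈ I₁, ((B c).card : ℝ) ≤ 6 * logGap κ β c * q.totient +
        8 * (q : ℝ) ^ (6 / 10 : ℝ) := by
      intro c hc
      obtain ⟨hc1, hc2⟩ := hmem1 c hc
      refine (card_near_frac_le (by omega) (by omega) (logGap_pos hκ β (by omega))
        (hN c (by omega))).trans ?_
      refine add_le_add le_rfl ?_
      calc (4 * c * q.divisors.card : ℝ) ≤ 4 * (q : ℝ) ^ (1 / 10 : ℝ) * (2 * √(q : ℝ)) := by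
            gcongr; exact card_divisors_le_two_mul_sqrt q
        _ = 8 * ((q : ℝ) ^ (1 / 10 : ℝ) * (q : ℝ) ^ (1 / 2 : ℝ)) := by
            rw [Real.sqrt_eq_rpow]; ring
        _ = 8 * (q : ℝ) ^ (6 / 10 : ℝ) := by rw [← Real.rpow_add hq0]; norm_num
    have hcardI : (I₁.card : ℝ) ≤ (q : ℝ) ^ (1 / 10 : ℝ) := by
      have : I₁ ⊆ Finset.Ioc 0 ⌊(q : ℝ) ^ (1 / 10 : ℝ)⌋₊ := by
        intro c hc
        obtain ⟨hc1, hc2⟩ := hmem1 c hc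
        exact Finset.mem_Ioc.2 ⟨by omega, Nat.le_floor hc2⟩
      have h2 := Finset.card_le_card this
      rw [Nat.card_Ioc, Nat.sub_zero] at h2
      exact (Nat.cast_le.2 h2).trans (Nat.floor_le (by positivity))
    calc _ ≤ ∑ c ∈ I₁, (6 * logGap κ β c * q.totient + 8 * (q : ℝ) ^ (6 / 10 : ℝ)) :=
          Finset.sum_le_sum h1
      _ = 6 * (∑ c ∈ I₁, logGap κ β c) * q.totient + I₁.card * (8 * (q : ℝ) ^ (6 / 10 : ℝ)) := by
          rw [Finset.sum_add_distrib, ← Finset.sum_mul, ← Finset.mul_sum, Finset.sum_const,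
            nsmul_eq_mul]
      _ ≤ 6 * (τ / 18) * q.totient +
          (q : ℝ) ^ (1 / 10 : ℝ) * (8 * (q : ℝ) ^ (6 / 10 : ℝ)) := by
          gcongr
          exact hC₁ I₁ fun c hc => hC₁0.trans (hmem1 c hc).1
      _ = _ := by
          rw [mul_left_comm, ← Real.rpow_add hq0, show (1 / 10 + 6 / 10 : ℝ) = 7 / 10 by norm_num]
          ring
  have hsum2 : ∑ c ∈ I₂, ((B c).card : ℝ) ≤ A * (q * Real.log q ^ (-γ)) := by
    have h1 : ∀ c ∈ I₂, ((B c).card : ℝ) ≤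
        2 * q * (logGap κ ((1 + β) / 2) c * (κ / 2 * (Real.log q / 10)) ^ (-γ)) := by
      intro c hc
      rw [hI₂, Finset.mem_filter, Finset.mem_Ico, not_le] at hc
      refine (card_near_frac_le_of_lt (by omega) hc.1.2 (logGap_nonneg hκ _ _)).trans ?_
      gcongr
      refine logGap_le_of_log_le hκ hβ (by positivity) ?_
      have h2 : (q : ℝ) ≤ (c : ℝ) ^ (10 : ℕ) := by exact_mod_cast hc.2.le
      have h3 := Real.log_le_log hq0 h2
      rw [Real.log_pow] at h3
      push_cast at h3
      linarith
    calc _ ≤ ∑ c ∈ I₂, 2 * q * (logGap κ ((1 + β) / 2) c * (κ / 2 * (Real.log q / 10)) ^ (-γ)) :=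
          Finset.sum_le_sum h1
      _ = 2 * q * ((∑ c ∈ I₂, logGap κ ((1 + β) / 2) c) *
          (κ / 2 * (Real.log q / 10)) ^ (-γ)) := by rw [← Finset.mul_sum, ← Finset.sum_mul]
      _ ≤ 2 * q * ((S + 1) * (κ / 2 * (Real.log q / 10)) ^ (-γ)) := by
          gcongr
          have := hsum'.sum_le_tsum I₂ fun c _ => logGap_nonneg hκ _ c
          linarith
      _ = _ := by
          rw [show κ / 2 * (Real.log q / 10) = κ / 20 * Real.log q by ring,
            Real.mul_rpow (by positivity) hlq.le, hA]
          ring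
  have h3 : A * (q * Real.log q ^ (-γ)) ≤ τ / 3 * q.totient := by
    calc A * (q * Real.log q ^ (-γ)) ≤ A * (τ / 3 / A * q.totient) := by gcongr
      _ = _ := by field_simp
  linarith

/-! ### Equidistribution of reduced fractions -/

/-- A lower bound on open sets is all that the portmanteau theorem requires. The points may be
displaced by 1/q because the fractions are later replaced by irrationals having them as convergents.
-/
theorem eventually_card_mem_open_ge {X : ℕ → ℕ → ℝ}
    (hX : ∀ q, ∀ a ∈ reducedResidues q, |X q a - (a : ℝ) / q| ≤ 1 / q) {U : Set ℝ} (hU : IsOpen U)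
    (hU1 : U ⊆ Ioo 0 1) {τ : ℝ} (hτ : 0 < τ) :
    open Classical in ∀ᶠ q : ℕ in atTop, (volume.real U - τ) * q.totient ≤
      (((reducedResidues q).filter fun a => X q a ∈ U).card : ℝ) := by
  classical
  have hfin : volume U ≠ ⊤ :=
    ((measure_mono hU1).trans_lt (by simp [Real.volume_Ioo])).ne
  obtain ⟨K, hKU, hK, hKvol⟩ : ∃ K ⊆ U, IsCompact K ∧ volume.real U - τ / 2 ≤ volume.real K := by
    by_cases h0 : volume U = 0
    · exact ⟨∅, empty_subset _, isCompact_empty, by simp [Measure.real, h0]; positivity⟩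
    · have hlt : volume U - ENNReal.ofReal (τ / 2) < volume U :=
        ENNReal.sub_lt_self hfin h0 (by simpa using hτ)
      obtain ⟨K, hKU, hK, h1⟩ := hU.exists_lt_isCompact hlt
      refine ⟨K, hKU, hK, ?_⟩
      have hKfin := hK.measure_lt_top (μ := (volume : Measure ℝ)).ne
      have h2 : volume U ≤ volume K + ENNReal.ofReal (τ / 2) := tsub_le_iff_right.1 h1.le
      have h3 := ENNReal.toReal_mono (ENNReal.add_ne_top.2 ⟨hKfin, ENNReal.ofReal_ne_top⟩) h2
      rw [ENNReal.toReal_add hKfin ENNReal.ofReal_ne_top,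
        ENNReal.toReal_ofReal (by positivity)] at h3
      simp only [Measure.real]
      linarith
  -- The margin d absorbs both the width 1/N of a cell meeting K and the displacement 1/q ≤ 1/N.
  obtain ⟨d, hd, hdU⟩ := hK.exists_thickening_subset_open hU hKU
  obtain ⟨N, hN⟩ := exists_nat_gt (2 / d)
  have hN0 : (0 : ℝ) < N := lt_trans (by positivity) hN
  have hNd : 2 / (N : ℝ) < d := by
    rw [div_lt_iff₀ hd] at hN
    rw [div_lt_iff₀ hN0]; linarith
  have hN0' : 0 < N := by exact_mod_cast hN0
  set cell : ℕ → Set ℝ := fun i => Ioc ((i : ℝ) / N) ((i + 1) / N) with hcell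
  set J := (Finset.range N).filter fun i => (cell i ∩ K).Nonempty with hJ
  have hcov : volume.real K ≤ J.card / N := by
    have hsub : K ⊆ ⋃ i ∈ J, cell i := by
      intro x hx
      have hx1 := hU1 (hKU hx)
      set m := ⌈x * N⌉₊ with hm
      have hm1 : 0 < m := Nat.ceil_pos.2 (mul_pos hx1.1 hN0)
      have hmN : m ≤ N := Nat.ceil_le.2 (by nlinarith [hx1.2])
      have hxm : x * N ≤ m := Nat.le_ceil _
      have hmx : (m : ℝ) < x * N + 1 := Nat.ceil_lt_add_one (mul_pos hx1.1 hN0).le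
      have hxc : x ∈ cell (m - 1) := by
        rw [hcell]
        simp only [mem_Ioc]
        rw [Nat.cast_sub hm1, div_lt_iff₀ hN0, le_div_iff₀ hN0]
        push_cast
        constructor <;> linarith
      simp only [mem_iUnion]
      exact ⟨m - 1, Finset.mem_filter.2 ⟨Finset.mem_range.2 (by omega), ⟨x, hxc, hx⟩⟩, hxc⟩
    have h1 : volume K ≤ ENNReal.ofReal (J.card / N) := by
      refine (measure_mono hsub).trans ((measure_biUnion_finset_le _ _).trans ?_)
      have h2 : ∀ i : ℕ, volume (cell i) = ENNReal.ofReal (1 / N) := fun i => by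
        rw [hcell, Real.volume_Ioc, ← sub_div]; congr 2; ring
      simp only [h2, Finset.sum_const, nsmul_eq_mul]
      rw [← ENNReal.ofReal_natCast, ← ENNReal.ofReal_mul (Nat.cast_nonneg _), mul_one_div]
    exact ENNReal.toReal_le_of_le_ofReal (by positivity) h1
  have hev := eventually_mul_rpow_le_totient (s := 1 / 2) (ε := τ / 2) (A := 4 * N) (by norm_num)
    (by positivity) (by positivity)
  filter_upwards [hev, eventually_ge_atTop N] with q hq hqN
  have hq0' : 0 < q := by omega
  have hq0 : (0 : ℝ) < q := by exact_mod_cast hq0'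
  set F : ℕ → Finset ℕ := fun i => (reducedResidues q).filter fun a : ℕ =>
    (i : ℝ) / N < (a : ℝ) / q ∧ (a : ℝ) / q ≤ (i + 1) / N with hF
  have hsub : J.biUnion F ⊆ (reducedResidues q).filter fun a => X q a ∈ U := by
    intro a ha
    obtain ⟨i, hi, ha⟩ := Finset.mem_biUnion.1 ha
    obtain ⟨ha, hai⟩ := Finset.mem_filter.1 ha
    refine Finset.mem_filter.2 ⟨ha, hdU ?_⟩
    obtain ⟨y, hy, hyK⟩ := (Finset.mem_filter.1 hi).2
    refine Metric.mem_thickening_iff.2 ⟨y, hyK, ?_⟩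
    have h1 := abs_le.1 (hX q a ha)
    have h2 : (1 : ℝ) / q ≤ 1 / N := by
      have : (N : ℝ) ≤ q := by exact_mod_cast hqN
      gcongr
    rw [hcell] at hy
    have h3 : ((i : ℝ) + 1) / N = i / N + 1 / N := add_div _ _ _
    have h4 : 2 / (N : ℝ) = 1 / N + 1 / N := by ring
    simp only [mem_Ioc] at hy
    rw [h3] at hy hai
    rw [Real.dist_eq, abs_lt]
    constructor <;> linarith [hy.1, hy.2, hai.1, hai.2, h1.1, h1.2]
  have hdisj : Set.PairwiseDisjoint (J : Set ℕ) F := by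
    intro i _ j _ hij
    rw [Function.onFun, Finset.disjoint_left]
    intro a h1 h2
    obtain ⟨-, h1a, h1b⟩ := Finset.mem_filter.1 h1
    obtain ⟨-, h2a, h2b⟩ := Finset.mem_filter.1 h2
    have h3 := h1a.trans_le h2b
    have h4 := h2a.trans_le h1b
    rw [div_lt_div_iff_of_pos_right hN0] at h3 h4
    have h3' : i < j + 1 := by exact_mod_cast h3
    have h4' : j < i + 1 := by exact_mod_cast h4
    omega
  have hcardF : ∀ i ∈ J, (1 / N : ℝ) * q.totient - 2 * q.divisors.card ≤ ((F i).card : ℝ) := by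
    intro i hi
    have hiN : i < N := Finset.mem_range.1 (Finset.mem_filter.1 hi).1
    have h1 := le_card_reducedResidues_Ioc hq0'.ne' (α := (i : ℝ) / N) (β := (i + 1) / N)
      (by positivity) (by gcongr; linarith) ((div_le_one hN0).2 (by exact_mod_cast hiN))
    rwa [← sub_div, add_sub_cancel_left] at h1
  have hJN : (J.card : ℝ) ≤ N := by
    have := Finset.card_filter_le (Finset.range N) fun i => (cell i ∩ K).Nonempty
    rw [Finset.card_range] at this
    exact_mod_cast this
  have hdiv : (2 * q.divisors.card : ℝ) * N ≤ τ / 2 * q.totient := by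
    refine le_trans ?_ hq
    rw [← Real.sqrt_eq_rpow]
    nlinarith [card_divisors_le_two_mul_sqrt q]
  have hφ : (0 : ℝ) ≤ q.totient := Nat.cast_nonneg _
  have hd0 : (0 : ℝ) ≤ q.divisors.card := Nat.cast_nonneg _
  calc (volume.real U - τ) * q.totient
      ≤ (J.card / N - τ / 2) * q.totient :=
        mul_le_mul_of_nonneg_right (by linarith) hφ
    _ ≤ J.card * ((1 / N : ℝ) * q.totient - 2 * q.divisors.card) := by
        have : (J.card : ℝ) * (2 * q.divisors.card) ≤ N * (2 * q.divisors.card) := by gcongr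
        have h5 : (J.card / N : ℝ) * q.totient = J.card * ((1 / N : ℝ) * q.totient) := by ring
        linarith
    _ = ∑ i ∈ J, ((1 / N : ℝ) * q.totient - 2 * q.divisors.card) := by
        rw [Finset.sum_const, nsmul_eq_mul]
    _ ≤ ∑ i ∈ J, ((F i).card : ℝ) := Finset.sum_le_sum hcardF
    _ = ((J.biUnion F).card : ℝ) := by rw [Finset.card_biUnion hdisj]; push_cast; rfl
    _ ≤ _ := by exact_mod_cast Finset.card_le_card hsub

/-! ### Rationals as odd convergents -/

/-- Legendre's criterion makes r a convergent of any irrational this close to it. Choosing the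
irrational below r forces the index to be odd, since even convergents lie below the number they
approximate. -/
theorem exists_irrational_convergent_eq (r : ℚ) : ∃ x : ℝ, ∃ j : ℕ, Irrational x ∧
    |x - r| < 1 / (2 * (r.den : ℝ) ^ 2) ∧ x < r ∧ x.convergent (2 * j + 1) = r := by
  have hd : (0 : ℝ) < r.den := by exact_mod_cast r.den_pos
  obtain ⟨x, hx, hx1, hx2⟩ := exists_irrational_btwn
    (show (r : ℝ) - 1 / (2 * (r.den : ℝ) ^ 2) < r by
      have : 0 < 1 / (2 * (r.den : ℝ) ^ 2) := by positivity
      linarith)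
  have habs : |x - r| < 1 / (2 * (r.den : ℝ) ^ 2) := by
    rw [abs_lt]; constructor <;> linarith
  obtain ⟨n, hn⟩ := Real.exists_rat_eq_convergent habs
  obtain ⟨e, he0, -, he⟩ := sub_convergent hx n
  rcases Nat.even_or_odd n with h | ⟨j, rfl⟩
  · rw [h.neg_one_pow, ← hn] at he; linarith
  · exact ⟨x, j, hx, habs, hx2, hn.symm⟩

theorem mem_reducedResidues {q a : ℕ} :
    a ∈ reducedResidues q ↔ (1 ≤ a ∧ a ≤ q) ∧ Nat.Coprime a q := by
  rw [reducedResidues, Finset.mem_filter, Finset.mem_Icc]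

theorem den_num_of_mem_reducedResidues {q a : ℕ} (ha : a ∈ reducedResidues q) :
    ((a : ℚ) / q).den = q ∧ ((a : ℚ) / q).num = a := by
  obtain ⟨⟨h1, h2⟩, h3⟩ := mem_reducedResidues.1 ha
  have hz : (0 : ℤ) < q := by exact_mod_cast h1.trans h2
  have hd := Rat.den_div_eq_of_coprime (a := a) hz (by simpa using h3)
  have hn := Rat.num_div_eq_of_coprime (a := a) hz (by simpa using h3)
  push_cast at hd hn
  exact ⟨by exact_mod_cast hd, hn⟩

/-- The representative in `[1, q]` of the inverse modulo `q`. -/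
def invResidue (q a : ℕ) : ℕ := ((a : ZMod q)⁻¹ - 1).val + 1

theorem cast_invResidue {q : ℕ} [NeZero q] (a : ℕ) :
    ((invResidue q a : ℕ) : ZMod q) = (a : ZMod q)⁻¹ := by
  rw [invResidue]; push_cast; rw [ZMod.natCast_zmod_val]; ring

theorem invResidue_mem {q a : ℕ} (ha : a ∈ reducedResidues q) :
    invResidue q a ∈ reducedResidues q := by
  obtain ⟨⟨h1, h2⟩, h3⟩ := mem_reducedResidues.1 ha
  have : NeZero q := ⟨by omega⟩
  refine mem_reducedResidues.2 ⟨⟨by simp [invResidue], ?_⟩, ?_⟩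
  · have := ZMod.val_lt ((a : ZMod q)⁻¹ - 1)
    rw [invResidue]; omega
  · rw [← ZMod.isUnit_iff_coprime, cast_invResidue]
    exact IsUnit.of_mul_eq_one (a : ZMod q)
      (by rw [mul_comm, ZMod.coe_mul_inv_eq_one a h3])

theorem invResidue_invResidue {q a : ℕ} (ha : a ∈ reducedResidues q) :
    invResidue q (invResidue q a) = a := by
  obtain ⟨⟨h1, h2⟩, h3⟩ := mem_reducedResidues.1 ha
  have : NeZero q := ⟨by omega⟩
  have h4 : (a : ZMod q)⁻¹⁻¹ = a := ZMod.inv_eq_of_mul_eq_one _ _ _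
    (by rw [mul_comm, ZMod.coe_mul_inv_eq_one a h3])
  rw [invResidue, cast_invResidue, h4]
  have h5 : (a : ZMod q) - 1 = ((a - 1 : ℕ) : ZMod q) := by push_cast [Nat.cast_sub h1]; rfl
  rw [h5, ZMod.val_natCast_of_lt (by omega)]
  omega

theorem invRat_div {q a : ℕ} (ha : a ∈ reducedResidues q) :
    invRat ((a : ℚ) / q) = (invResidue q a : ℚ) / q := by
  obtain ⟨hd, hn⟩ := den_num_of_mem_reducedResidues ha
  obtain ⟨⟨h1, h2⟩, h3⟩ := mem_reducedResidues.1 ha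
  obtain ⟨⟨h4, h5⟩, h6⟩ := mem_reducedResidues.1 (invResidue_mem ha)
  have : NeZero q := ⟨by omega⟩
  rw [invRat_eq_div (m := invResidue q a) h4 (by rwa [hd]), hd]
  have h7 : ((a * invResidue q a - 1 : ℤ) : ZMod q) = 0 := by
    push_cast
    rw [cast_invResidue, ZMod.coe_mul_inv_eq_one a h3, sub_self]
  rw [ZMod.intCast_zmod_eq_zero_iff_dvd] at h7
  rw [hn]
  have h8 := (ZMod.intCast_zmod_eq_zero_iff_dvd (a * invResidue q a - 1) ((a : ℚ) / q).den).2
    (by rwa [hd])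
  push_cast at h8 ⊢
  exact sub_eq_zero.1 h8

/-- Inversion modulo q is an involution of the reduced residues, so the average may be taken over
the inverted fractions, to which the expansion applies. -/
theorem reducedAverage_eq (k : ℂ) (f : ℚ → ℂ) (G : ℂ → ℝ) (q : ℕ) :
    reducedAverage k f G q = (∑ a ∈ reducedResidues q,
      G ((q : ℂ) ^ (-k) * f (invRat ((a : ℚ) / q)))) / (Nat.totient q : ℝ) := by
  rw [reducedAverage]
  congr 1
  refine Finset.sum_nbij' (invResidue q) (invResidue q) (fun a => invResidue_mem)
    (fun a => invResidue_mem) (fun a => invResidue_invResidue) (fun a => invResidue_invResidue)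
    fun a ha => ?_
  rw [invRat_div (invResidue_mem ha), invResidue_invResidue ha]

/-! ### Weak convergence -/

theorem exists_measure_iUnion_le_add {α : Type*} [MeasurableSpace α] {μ : Measure α}
    {s : ℕ → Set α} (hs : Monotone s) (hfin : μ (⋃ n, s n) ≠ ⊤) {τ : ENNReal} (hτ : 0 < τ) :
    ∀ᶠ n in atTop, μ (⋃ n, s n) ≤ μ (s n) + τ := by
  by_cases h0 : μ (⋃ n, s n) = 0
  · simp [h0]
  · have h1 : μ (⋃ n, s n) - τ < μ (⋃ n, s n) := ENNReal.sub_lt_self hfin h0 hτ.ne'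
    filter_upwards [(tendsto_measure_iUnion_atTop hs).eventually_const_lt h1] with n hn
    exact tsub_le_iff_right.1 hn.le

theorem tendsto_tailBound {κ : ℝ} (hκ : 0 < κ) (C : ℝ) :
    Tendsto (fun n : ℕ => C * (cfRatio κ ^ n / (1 - cfRatio κ))) atTop (𝓝 0) := by
  have h := ((tendsto_pow_atTop_nhds_zero_of_lt_one (cfRatio_pos κ).le
    (cfRatio_lt_one hκ)).div_const (1 - cfRatio κ)).const_mul C
  simpa using h

theorem fract_eq_self_of_irrational {x : ℝ} (hx : Irrational x) (h : x ∈ Icc (0 : ℝ) 1) :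
    Int.fract x = x :=
  Int.fract_eq_self.2 ⟨h.1, lt_of_le_of_ne h.2 hx.ne_one⟩

/-- The event f† ∈ O is replaced by an open condition on finitely many digits, at a cost of three
times τ: one for points close to fractions, one for fixing the truncation level n, and one for
bounding the n-th denominator. A whole ball lies in O, so any continuation with a controlled tail
stays in O. -/
theorem exists_open_set_truncation {k : ℂ} (hk : 0 < k.re) {f : ℚ → ℂ} {h : ℝ → ℂ}
    (hper : ∀ x : ℚ, x ∉ Icc (-1 : ℚ) 0 → f (x + 1) = f x)
    (hrec : ∀ x : ℚ, x ≠ 0 → h (x : ℝ) = f x - (((|x| : ℚ) : ℂ) ^ (-k)) * f (-1 / x))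
    {C e : ℝ} (hC : 0 ≤ C) (he : 0 < e) (hh : InvExpBound h C e) {O : Set ℂ} (hO : IsOpen O)
    {τ : ENNReal} (hτ : 0 < τ) {C₀ : ℕ}
    (hC₀ : volume {y : ℝ | y ∈ Icc (0 : ℝ) 1 ∧ CloseToFrac k.re (1 / e) C₀ y} ≤ τ) :
    ∃ n R : ℕ, C₀ ≤ n ∧ 2 ≤ n ∧ ∃ U : Set ℝ, IsOpen U ∧ U ⊆ Ioo 0 1 ∧
      volume {x : ℝ | x ∈ Icc (0 : ℝ) 1 ∧ dagger k f x ∈ O} ≤ volume U + 3 * τ ∧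
      ∀ x ∈ U, Irrational x →
        Metric.closedBall (f (-1) + ∑ i ∈ Finset.range n, cfTerm k h 0 1 (cfDigit x) i)
          (C * (cfRatio k.re ^ n / (1 - cfRatio k.re))) ⊆ O ∧
        contDen (cfDigit x) (n + 1) ≤ R := by
  set t : ℕ → ℝ := fun n => C * (cfRatio k.re ^ n / (1 - cfRatio k.re)) with ht
  set S : ℕ → ℝ → ℂ := fun n x =>
    f (-1) + ∑ i ∈ Finset.range n, cfTerm k h 0 1 (cfDigit x) i with hS
  set E : Set ℝ := {x : ℝ | x ∈ Icc (0 : ℝ) 1 ∧ dagger k f x ∈ O} with hE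
  set A : ℕ → Set ℝ := fun N =>
    {x | x ∈ Icc (0 : ℝ) 1 ∧ Irrational x ∧ ∀ n, N ≤ n → Metric.closedBall (S n x) (t n) ⊆ O}
    with hA
  have hAmono : Monotone A := fun N N' hN x hx => ⟨hx.1, hx.2.1, fun n hn => hx.2.2 n (hN.trans hn)⟩
  have hfin : ∀ s : Set ℝ, s ⊆ Icc 0 1 → volume s ≠ ⊤ := fun s hs =>
    ((measure_mono hs).trans_lt (by simp [Real.volume_Icc])).ne
  have hsub : E ⊆ (⋃ N, A N) ∪
      ({y : ℝ | y ∈ Icc (0 : ℝ) 1 ∧ CloseToFrac k.re (1 / e) C₀ y} ∪ {x | ¬ Irrational x}) := by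
    rintro x ⟨hx, hxO⟩
    by_cases hirr : Irrational x
    swap
    · exact Or.inr (Or.inr hirr)
    by_cases hcl : CloseToFrac k.re (1 / e) C₀ x
    · exact Or.inr (Or.inl ⟨hx, hcl⟩)
    left
    have hgood : ∀ j, max C₀ 2 ≤ j → GoodDigit k.re e (cfDigit x) j := fun j hj =>
      goodDigit_of_not_closeToFrac hk he hirr
        (by rwa [fract_eq_self_of_irrational hirr hx]) ((le_max_right _ _).trans hj)
        ((le_max_left _ _).trans hj)
    have hdag := dagger_eq hk hper hrec hC he hh hirr (eventually_atTop.2 ⟨_, hgood⟩)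
    obtain ⟨ε, hε, hεO⟩ := Metric.isOpen_iff.1 hO _ hxO
    obtain ⟨N, hN⟩ := eventually_atTop.1
      ((tendsto_tailBound hk C).eventually_lt_const (half_pos hε))
    refine mem_iUnion.2 ⟨max N (max C₀ 2), hx, hirr, fun n hn z hz => hεO ?_⟩
    have hn1 := hN n ((le_max_left _ _).trans hn)
    have hn2 := (le_max_right _ _).trans hn
    have htail := norm_tsum_sub_sum_le hk hC he hh le_rfl zero_le_one abs_one
      (one_le_cfDigit hirr) (M := n) (by omega) fun j hj => hgood j (hn2.trans hj)
    rw [Metric.mem_closedBall] at hz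
    rw [Metric.mem_ball]
    have hd : dist (S n x) (dagger k f x) ≤ t n := by
      rw [dist_comm, dist_eq_norm, hdag, hS]
      simp only [add_sub_add_left_eq_sub]
      exact htail
    calc dist z (dagger k f x) ≤ dist z (S n x) + dist (S n x) (dagger k f x) :=
          dist_triangle _ _ _
      _ < ε := by linarith
  have h1 : volume E ≤ volume (⋃ N, A N) + τ := by
    refine (measure_mono hsub).trans ((measure_union_le _ _).trans ?_)
    gcongr
    refine (measure_union_le _ _).trans ?_
    have : volume {x : ℝ | ¬ Irrational x} = 0 := ae_iff.1 ae_irrational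
    rw [this, add_zero]
    exact hC₀
  obtain ⟨N, hN⟩ := (exists_measure_iUnion_le_add hAmono
    (hfin _ (iUnion_subset fun N x hx => hx.1)) hτ).exists
  set n := max N (max C₀ 2) with hn
  -- Bounding the denominator guarantees that every q > R has an expansion reaching beyond the
  -- truncation level.
  set B : ℕ → Set ℝ := fun R => {x | x ∈ A N ∧ contDen (cfDigit x) (n + 1) ≤ R} with hB
  have hBmono : Monotone B := fun R R' hR x hx => ⟨hx.1, hx.2.trans hR⟩
  have hBun : (⋃ R, B R) = A N := by
    refine subset_antisymm (iUnion_subset fun R x hx => hx.1) fun x hx => ?_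
    exact mem_iUnion.2 ⟨_, hx, le_rfl⟩
  obtain ⟨R, hR⟩ := (exists_measure_iUnion_le_add hBmono
    (by rw [hBun]; exact hfin _ fun x hx => hx.1) hτ).exists
  rw [hBun] at hR
  set V : Set ℝ := {x | Irrational x →
    Metric.closedBall (S n x) (t n) ⊆ O ∧ contDen (cfDigit x) (n + 1) ≤ R} with hV
  have hn2 : max C₀ 2 ≤ n := le_max_right _ _
  refine ⟨n, R, (le_max_left _ _).trans hn2, (le_max_right _ _).trans hn2,
    interior V ∩ Ioo 0 1, isOpen_interior.inter isOpen_Ioo, inter_subset_right, ?_,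
    fun x hx => interior_subset hx.1⟩
  have hBU : B R ⊆ interior V ∩ Ioo 0 1 := by
    rintro x ⟨⟨hx, hirr, hball⟩, hxR⟩
    refine ⟨?_, lt_of_le_of_ne hx.1 hirr.ne_zero.symm, lt_of_le_of_ne hx.2 hirr.ne_one⟩
    rw [mem_interior_iff_mem_nhds]
    filter_upwards [eventually_cfDigit_eq_of_lt hirr n] with y hy _
    have h2 : S n y = S n x := by
      simp only [hS]
      congr 1
      refine Finset.sum_congr rfl fun i hi => cfTerm_zero_congr k h 1 fun j hj => hy j ?_
      have := Finset.mem_range.1 hi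
      omega
    have h3 : contDen (cfDigit y) (n + 1) = contDen (cfDigit x) (n + 1) :=
      contDen_congr fun i hi => hy i (by omega)
    rw [h2, h3]
    exact ⟨hball n (le_max_left _ _), hxR⟩
  calc volume E ≤ volume (⋃ N, A N) + τ := h1
    _ ≤ (volume (B R) + τ + τ) + τ := by
        gcongr
        exact hN.trans (by gcongr)
    _ ≤ (volume (interior V ∩ Ioo 0 1) + τ + τ) + τ := by gcongr
    _ = _ := by ring

/-- A residue whose attached irrational lies in U either is a close residue or has only good digits
between the truncation level and the end of the expansion of a/q. In the second case its value stays
in the ball provided by U. -/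
theorem eventually_card_mem_ge {k : ℂ} (hk : 0 < k.re) {f : ℚ → ℂ} {h : ℝ → ℂ}
    (hper : ∀ x : ℚ, x ∉ Icc (-1 : ℚ) 0 → f (x + 1) = f x)
    (hrec : ∀ x : ℚ, x ≠ 0 → h (x : ℝ) = f x - (((|x| : ℚ) : ℂ) ^ (-k)) * f (-1 / x))
    {C e : ℝ} (hC : 0 ≤ C) (he : 0 < e) (he1 : e < 1) (hh : InvExpBound h C e) {O : Set ℂ}
    (hO : IsOpen O) {τ : ℝ} (hτ : 0 < τ) :
    open Classical in ∀ᶠ q : ℕ in atTop,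
      (volume.real {x : ℝ | x ∈ Icc (0 : ℝ) 1 ∧ dagger k f x ∈ O} - τ) * q.totient ≤
      (((reducedResidues q).filter fun a : ℕ =>
        (q : ℂ) ^ (-k) * f (invRat ((a : ℚ) / q)) ∈ O).card : ℝ) := by
  classical
  have hβ : 1 < 1 / e := by rw [lt_div_iff₀ he]; linarith
  -- Three parts for the truncation, one for equidistribution, one for the close residues.
  set τ' := τ / 5 with hτ'
  have hτ'0 : 0 < τ' := by positivity
  obtain ⟨C₁, hC₁⟩ := exists_card_closeResidues_le hk hβ hτ'0
  obtain ⟨C₀, hC₀, hC₁₀⟩ := ((exists_volume_closeToFrac_le hk hβ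
    (ENNReal.ofReal_pos.2 hτ'0)).and (eventually_ge_atTop C₁)).exists
  obtain ⟨n, R, hnC, hn2, U, hU, hU1, hvol, hprop⟩ :=
    exists_open_set_truncation hk hper hrec hC he hh hO (ENNReal.ofReal_pos.2 hτ'0) hC₀
  choose X J hXirr hXabs hXlt hXconv using exists_irrational_convergent_eq
  have hXq : ∀ q, ∀ a ∈ reducedResidues q,
      |X ((a : ℚ) / q) - (a : ℝ) / q| < 1 / (2 * (q : ℝ) ^ 2) := by
    intro q a ha
    have := hXabs ((a : ℚ) / q)
    rw [(den_num_of_mem_reducedResidues ha).1] at this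
    push_cast at this
    exact this
  have hXq' : ∀ q, ∀ a ∈ reducedResidues q, |X ((a : ℚ) / q) - (a : ℝ) / q| ≤ 1 / q := by
    intro q a ha
    refine (hXq q a ha).le.trans ?_
    obtain ⟨⟨h1, h2⟩, -⟩ := mem_reducedResidues.1 ha
    have hq1 : (1 : ℝ) ≤ q := by exact_mod_cast h1.trans h2
    exact one_div_le_one_div_of_le (by linarith) (by nlinarith)
  have hvol' : volume.real {x : ℝ | x ∈ Icc (0 : ℝ) 1 ∧ dagger k f x ∈ O} ≤
      volume.real U + 3 * τ' := by
    have hUfin : volume U ≠ ⊤ := ((measure_mono hU1).trans_lt (by simp [Real.volume_Ioo])).ne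
    have h3 : 3 * ENNReal.ofReal τ' ≠ ⊤ := ENNReal.mul_ne_top (by simp) ENNReal.ofReal_ne_top
    have h1 := ENNReal.toReal_mono (ENNReal.add_ne_top.2 ⟨hUfin, h3⟩) hvol
    rw [ENNReal.toReal_add hUfin h3, ENNReal.toReal_mul, ENNReal.toReal_ofReal hτ'0.le] at h1
    simpa [Measure.real] using h1
  filter_upwards [hC₁ C₀ hC₁₀, eventually_gt_atTop R,
    eventually_card_mem_open_ge (X := fun q a => X ((a : ℚ) / q)) hXq' hU hU1 hτ'0]
    with q hq1 hqR hq2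
  have hsub : ((reducedResidues q).filter fun a : ℕ => X ((a : ℚ) / q) ∈ U) ⊆
      closeResidues k.re (1 / e) C₀ q ∪ ((reducedResidues q).filter fun a : ℕ =>
        (q : ℂ) ^ (-k) * f (invRat ((a : ℚ) / q)) ∈ O) := by
    intro a ha
    obtain ⟨ha, haU⟩ := Finset.mem_filter.1 ha
    rw [Finset.mem_union, or_iff_not_imp_left]
    intro hclose
    refine Finset.mem_filter.2 ⟨ha, ?_⟩
    obtain ⟨hden, -⟩ := den_num_of_mem_reducedResidues ha
    set r : ℚ := (a : ℚ) / q with hr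
    have hirr := hXirr r
    have hdig := one_le_cfDigit hirr
    have hden' : contDen (cfDigit (X r)) (2 * J r + 2) = q := by
      rw [← (convergent_den_num hirr _).1, hXconv, hden]
    obtain ⟨hball, hR⟩ := hprop _ haU hirr
    have hlt : n + 1 < 2 * J r + 2 := by
      by_contra hle
      have := contDen_mono hdig (not_lt.1 hle)
      rw [hden'] at this
      omega
    have hY : (q : ℂ) ^ (-k) * f (invRat r) =
        f (-1) + ∑ i ∈ Finset.range (2 * J r + 1), cfTerm k h 0 1 (cfDigit (X r)) i := by
      rw [← daggerSeq_eq hper hrec hirr, daggerSeq, hXconv, hden]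
    rw [hY]
    refine hball ?_
    rw [Metric.mem_closedBall, dist_eq_norm, add_sub_add_left_eq_sub]
    refine norm_sum_sub_sum_le hk hC he hh le_rfl zero_le_one abs_one hdig (by omega) (by omega)
      fun j hj1 hj2 => ?_
    by_contra hg
    refine hclose ?_
    rw [closeResidues, Finset.mem_filter]
    have hjlt : contDen (cfDigit (X r)) (j + 1) < contDen (cfDigit (X r)) (j + 2) := by
      obtain ⟨i, rfl⟩ := Nat.exists_eq_add_of_le' (show 1 ≤ j by omega)
      exact contDen_lt_succ hdig i
    have hjq : contDen (cfDigit (X r)) (j + 2) ≤ q := by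
      rw [← hden']; exact contDen_mono hdig (by omega)
    have hcpos : 0 < contDen (cfDigit (X r)) (j + 1) := contDen_pos hdig j
    -- A bad digit makes a/q close to the convergent of denominator c preceding it. The distances
    -- from a/q to the irrational and from there to p/c are each at most 1/(cd), matching the
    -- numerator 2 in `two_div_lt_logGap_of_not_goodDigit`.
    refine ⟨ha, contDen (cfDigit (X r)) (j + 1), by have := le_contDen hdig j; omega, by omega,
      (contDen (fun i => cfDigit (X r) (i + 1)) j : ℤ),
      le_trans ?_ (two_div_lt_logGap_of_not_goodDigit hk he hdig (by omega) hg).le⟩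
    have h1 := abs_fract_sub_lt hirr j
    rw [fract_eq_self_of_irrational hirr ⟨(hU1 haU).1.le, (hU1 haU).2.le⟩] at h1
    have h2 := hXq q a ha
    rw [← hr] at h2
    have hc0 : (0 : ℝ) < contDen (cfDigit (X r)) (j + 1) := by exact_mod_cast hcpos
    have hd0 : (0 : ℝ) < contDen (cfDigit (X r)) (j + 2) := by exact_mod_cast hcpos.trans hjlt
    have hcd : (contDen (cfDigit (X r)) (j + 1) : ℝ) ≤ contDen (cfDigit (X r)) (j + 2) := by
      exact_mod_cast hjlt.le
    have hdq : (contDen (cfDigit (X r)) (j + 2) : ℝ) ≤ q := by exact_mod_cast hjq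
    set c : ℝ := (contDen (cfDigit (X r)) (j + 1) : ℝ)
    set d : ℝ := (contDen (cfDigit (X r)) (j + 2) : ℝ)
    have h3 : 1 / (2 * (q : ℝ) ^ 2) ≤ 1 / (c * d) := by
      refine one_div_le_one_div_of_le (by positivity) ?_
      nlinarith
    rw [abs_sub_comm] at h2
    calc _ ≤ |(a : ℝ) / q - X r| + |X r -
          ((contDen (fun i => cfDigit (X r) (i + 1)) j : ℤ) : ℝ) / c| := abs_sub_le _ _ _
      _ ≤ 1 / (c * d) + 1 / (c * d) := by linarith
      _ = _ := by ring
  have hcard : (((reducedResidues q).filter fun a : ℕ => X ((a : ℚ) / q) ∈ U).card : ℝ) ≤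
      (closeResidues k.re (1 / e) C₀ q).card + ((reducedResidues q).filter fun a : ℕ =>
        (q : ℂ) ^ (-k) * f (invRat ((a : ℚ) / q)) ∈ O).card := by
    exact_mod_cast (Finset.card_le_card hsub).trans (Finset.card_union_le _ _)
  have hφ : (0 : ℝ) ≤ q.totient := Nat.cast_nonneg _
  have h5 : (volume.real {x : ℝ | x ∈ Icc (0 : ℝ) 1 ∧ dagger k f x ∈ O} - τ) * q.totient ≤
      (volume.real U - τ' - τ') * q.totient :=
    mul_le_mul_of_nonneg_right (by linarith) hφ
  linarith

/-- The uniform probability measure on the values of a function on a nonempty finite set. -/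
noncomputable def uniformLaw (s : Finset ℕ) (Y : ℕ → ℂ) : Measure ℂ :=
  (s.card : ENNReal)⁻¹ • ∑ a ∈ s, Measure.dirac (Y a)

theorem isProbabilityMeasure_uniformLaw {s : Finset ℕ} (hs : s.Nonempty) (Y : ℕ → ℂ) :
    IsProbabilityMeasure (uniformLaw s Y) := by
  refine ⟨?_⟩
  rw [uniformLaw, Measure.smul_apply, Measure.finsetSum_apply]
  simp only [measure_univ, Finset.sum_const, nsmul_eq_mul, mul_one, smul_eq_mul]
  exact ENNReal.inv_mul_cancel (by simpa using hs.ne_empty) (by simp)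

theorem integral_uniformLaw (s : Finset ℕ) (Y : ℕ → ℂ) (G : ℂ →ᵇ ℝ) :
    ∫ z, G z ∂(uniformLaw s Y) = (∑ a ∈ s, G (Y a)) / s.card := by
  rw [uniformLaw, integral_smul_measure, integral_finsetSum_measure]
  · simp [div_eq_inv_mul]
  · intro a _
    exact integrable_dirac (by simp [enorm])

open Classical in
theorem uniformLaw_apply (s : Finset ℕ) (Y : ℕ → ℂ) {O : Set ℂ} (hO : MeasurableSet O) :
    uniformLaw s Y O = (s.card : ENNReal)⁻¹ * ((s.filter fun a => Y a ∈ O).card : ENNReal) := by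
  rw [uniformLaw, Measure.smul_apply, Measure.finsetSum_apply, smul_eq_mul]
  congr 1
  simp only [Measure.dirac_apply' _ hO, Set.indicator_apply, Pi.one_apply]
  rw [Finset.card_filter]
  push_cast
  rfl

theorem tendsto_reducedAverage {k : ℂ} (hk : 0 < k.re) {f : ℚ → ℂ} {h : ℝ → ℂ}
    (hper : ∀ x : ℚ, x ∉ Icc (-1 : ℚ) 0 → f (x + 1) = f x)
    (hrec : ∀ x : ℚ, x ≠ 0 → h (x : ℝ) = f x - (((|x| : ℚ) : ℂ) ^ (-k)) * f (-1 / x))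
    {C e : ℝ} (hC : 0 ≤ C) (he : 0 < e) (he1 : e < 1) (hh : InvExpBound h C e) (G : ℂ →ᵇ ℝ) :
    Tendsto (fun q : ℕ => reducedAverage k f G q) atTop (𝓝 (∫ z, G z ∂(daggerLaw k f))) := by
  classical
  have hmeas : AEMeasurable (dagger k f) (volume.restrict (Icc (0 : ℝ) 1)) :=
    (aemeasurable_dagger (ae_tendsto_dagger hk hper hrec hC he he1 hh)).restrict
  have : IsProbabilityMeasure (volume.restrict (Icc (0 : ℝ) 1)) := ⟨by simp⟩
  have : IsProbabilityMeasure (daggerLaw k f) := Measure.isProbabilityMeasure_map hmeas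
  set Y : ℕ → ℕ → ℂ := fun q a => (q : ℂ) ^ (-k) * f (invRat ((a : ℚ) / q)) with hY
  -- Shifting q by one avoids q = 0, for which there are no residues and no probability measure.
  have hne : ∀ q, (reducedResidues (q + 1)).Nonempty := fun q =>
    ⟨1, mem_reducedResidues.2 ⟨⟨le_rfl, by omega⟩, Nat.coprime_one_left _⟩⟩
  have hprob := fun q => isProbabilityMeasure_uniformLaw (hne q) (Y (q + 1))
  let ν : ProbabilityMeasure ℂ := ⟨daggerLaw k f, this⟩
  let νs : ℕ → ProbabilityMeasure ℂ := fun q =>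
    ⟨uniformLaw (reducedResidues (q + 1)) (Y (q + 1)), hprob q⟩
  have key : Tendsto νs atTop (𝓝 ν) := by
    refine tendsto_of_forall_isOpen_le_liminf' fun O hO => ?_
    change daggerLaw k f O ≤
      liminf (fun q => uniformLaw (reducedResidues (q + 1)) (Y (q + 1)) O) atTop
    have hlaw : daggerLaw k f O = volume {x : ℝ | x ∈ Icc (0 : ℝ) 1 ∧ dagger k f x ∈ O} := by
      rw [daggerLaw, Measure.map_apply_of_aemeasurable hmeas hO.measurableSet,
        Measure.restrict_apply' measurableSet_Icc, inter_comm]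
      rfl
    refine ENNReal.le_of_forall_pos_le_add fun τ hτ _ => ?_
    rw [← tsub_le_iff_right]
    refine le_liminf_of_le (by isBoundedDefault) ?_
    have hev := (tendsto_add_atTop_iff_nat 1).2 tendsto_id |>.eventually
      (eventually_card_mem_ge hk hper hrec hC he he1 hh hO (τ := τ) (by exact_mod_cast hτ))
    filter_upwards [hev] with q hq
    simp only [id] at hq
    rw [tsub_le_iff_right, uniformLaw_apply _ _ hO.measurableSet, hlaw, card_reducedResidues]
    have hφ : (0 : ℝ) < (q + 1).totient := by
      exact_mod_cast Nat.totient_pos.2 (Nat.succ_pos q)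
    have hfin : volume {x : ℝ | x ∈ Icc (0 : ℝ) 1 ∧ dagger k f x ∈ O} ≠ ⊤ :=
      ((measure_mono fun x hx => hx.1).trans_lt (by simp [Real.volume_Icc] : volume (Icc (0 : ℝ) 1) < ⊤)).ne
    have h1 : volume.real {x : ℝ | x ∈ Icc (0 : ℝ) 1 ∧ dagger k f x ∈ O} ≤
        ((q + 1).totient : ℝ)⁻¹ * ((reducedResidues (q + 1)).filter fun a : ℕ =>
        ((q + 1 : ℕ) : ℂ) ^ (-k) * f (invRat ((a : ℚ) / (q + 1 : ℕ))) ∈ O).card + τ := by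
      rw [← sub_le_iff_le_add, ← div_eq_inv_mul, le_div_iff₀ hφ]
      exact hq
    rw [← ENNReal.ofReal_toReal hfin]
    refine (ENNReal.ofReal_le_ofReal h1).trans (le_of_eq ?_)
    rw [ENNReal.ofReal_add (by positivity) τ.coe_nonneg, ENNReal.ofReal_mul (by positivity),
      ENNReal.ofReal_inv_of_pos hφ, ENNReal.ofReal_natCast, ENNReal.ofReal_natCast,
      ENNReal.ofReal_coe_nnreal]
  rw [ProbabilityMeasure.tendsto_iff_forall_integral_tendsto] at key
  rw [← tendsto_add_atTop_iff_nat 1]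
  refine (key G).congr fun q => ?_
  rw [reducedAverage_eq, ← card_reducedResidues]
  exact integral_uniformLaw _ _ G

/-! ### Almost constant states -/

/-- The inverse of g on the image is Lipschitz, and one-dimensional Hausdorff measure is Lebesgue
measure; s need not be measurable. -/
theorem volume_le_of_antilipschitzOn {g : ℝ → ℝ} {s : Set ℝ} {K : ℝ}
    (hg : ∀ x ∈ s, ∀ y ∈ s, |x - y| ≤ K * |g x - g y|) :
    volume s ≤ ENNReal.ofReal K * volume (g '' s) := by
  have hinj : InjOn g s := fun x hx y hy hxy => by
    have := hg x hx y hy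
    rw [hxy, sub_self, abs_zero, mul_zero] at this
    exact sub_eq_zero.1 (abs_nonpos_iff.1 this)
  have hlip : LipschitzOnWith K.toNNReal (Function.invFunOn g s) (g '' s) := by
    refine LipschitzOnWith.of_dist_le_mul ?_
    rintro _ ⟨x, hx, rfl⟩ _ ⟨y, hy, rfl⟩
    rw [hinj.leftInvOn_invFunOn hx, hinj.leftInvOn_invFunOn hy, Real.dist_eq, Real.dist_eq]
    refine (hg x hx y hy).trans ?_
    gcongr
    exact Real.le_coe_toNNReal K
  have h1 := hlip.hausdorffMeasure_image_le zero_le_one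
  rw [hausdorffMeasure_real, hinj.leftInvOn_invFunOn.image_image, ENNReal.rpow_one] at h1
  exact h1

/-- The series with parameters `r, s` equals `w` up to a set of measure at most `η`. -/
structure IsState (k : ℂ) (h : ℝ → ℂ) (η r s : ℝ) (w : ℂ) : Prop where
  pos : 0 < r
  le_one : r ≤ 1
  abs_sign : |s| = 1
  volume_le : volume {y | y ∈ Ioo (0 : ℝ) 1 ∧ cfSum k h r s y ≠ w} ≤ ENNReal.ofReal η

theorem IsState.mono {k : ℂ} {h : ℝ → ℂ} {η η' r s : ℝ} {w : ℂ} (hs : IsState k h η r s w)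
    (hη : η ≤ η') : IsState k h η' r s w :=
  ⟨hs.pos, hs.le_one, hs.abs_sign, hs.volume_le.trans (ENNReal.ofReal_le_ofReal hη)⟩

/-- For almost every point, all the series attached to its digits converge. -/
def AESummable (k : ℂ) (h : ℝ → ℂ) : Prop :=
  ∀ᵐ y : ℝ, Irrational y ∧ ∀ r s : ℝ, 0 ≤ r → r ≤ 1 → |s| = 1 →
    Summable (cfTerm k h r s (cfDigit y))

theorem aeSummable {k : ℂ} (hk : 0 < k.re) {h : ℝ → ℂ} {C e : ℝ} (hC : 0 ≤ C) (he : 0 < e)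
    (he1 : e < 1) (hh : InvExpBound h C e) : AESummable k h := by
  filter_upwards [ae_irrational, ae_eventually_goodDigit hk he he1] with y hy hg
  exact ⟨hy, fun r s hr hr1 hs =>
    (summable_norm_cfTerm hk hC he hh hr hr1 hs (one_le_cfDigit hy) hg).of_norm⟩

/-- On the cylinder of first digit b the relation `cfSum_branch` can be solved for the next series.
The branch y ↦ 1/(b+y) shrinks distances by a factor of at most (b+1)², which is the loss in η. -/
theorem IsState.branch {k : ℂ} {h : ℝ → ℂ} (hsum : AESummable k h) {η r s : ℝ} {w : ℂ}
    (hs : IsState k h η r s w) {b : ℕ} (hb : 1 ≤ b) :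
    IsState k h ((b + 1) ^ 2 * η) (1 / (b + r)) (-s)
      (((b + r : ℝ) : ℂ) ^ k * w - h (s / (b + r))) := by
  have hb1 : (1 : ℝ) ≤ b := by exact_mod_cast hb
  have hbr : 0 < (b : ℝ) + r := by linarith [hs.pos]
  refine ⟨by positivity, ?_, by rw [abs_neg, hs.abs_sign], ?_⟩
  · rw [div_le_one hbr]; linarith [hs.pos]
  set w' := ((b + r : ℝ) : ℂ) ^ k * w - h (s / (b + r)) with hw'
  set T : Set ℝ := {y | y ∈ Ioo (0 : ℝ) 1 ∧ cfSum k h r s (1 / (b + y)) ≠ w} with hT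
  have hsub : {y | y ∈ Ioo (0 : ℝ) 1 ∧ cfSum k h (1 / (b + r)) (-s) y ≠ w'} ⊆
      T ∪ {y | ¬ (Irrational y ∧ ∀ r s : ℝ, 0 ≤ r → r ≤ 1 → |s| = 1 →
        Summable (cfTerm k h r s (cfDigit y)))} := by
    rintro y ⟨hy, hne⟩
    by_cases hgood : Irrational y ∧ ∀ r s : ℝ, 0 ≤ r → r ≤ 1 → |s| = 1 →
        Summable (cfTerm k h r s (cfDigit y))
    swap
    · exact Or.inr hgood
    refine Or.inl ⟨hy, fun heq => hne ?_⟩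
    have h1 := (cfSum_branch k h hs.pos.le s hb hy hgood.1 (hgood.2 _ _ (by positivity)
      (by rw [div_le_one hbr]; linarith [hs.pos]) (by rw [abs_neg, hs.abs_sign]))).2
    have hc : ((b + r : ℝ) : ℂ) ≠ 0 := by exact_mod_cast hbr.ne'
    have hc' : ((b + r : ℝ) : ℂ) ^ k * ((b + r : ℝ) : ℂ) ^ (-k) = 1 := by
      rw [← Complex.cpow_add _ _ hc, add_neg_cancel, Complex.cpow_zero]
    rw [hw', ← heq, h1, ← mul_assoc, hc']
    ring
  have himg : (fun y : ℝ => 1 / (b + y)) '' T ⊆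
      {y | y ∈ Ioo (0 : ℝ) 1 ∧ cfSum k h r s y ≠ w} := by
    rintro _ ⟨y, ⟨hy, hne⟩, rfl⟩
    have : 0 < (b : ℝ) + y := by linarith [hy.1]
    exact ⟨⟨by positivity, by rw [div_lt_one this]; linarith [hy.1]⟩, hne⟩
  have hanti : ∀ x ∈ T, ∀ y ∈ T, |x - y| ≤ (b + 1) ^ 2 * |1 / (b + x) - 1 / (b + y)| := by
    rintro x ⟨hx, -⟩ y ⟨hy, -⟩
    have hx0 : 0 < (b : ℝ) + x := by linarith [hx.1]
    have hy0 : 0 < (b : ℝ) + y := by linarith [hy.1]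
    have h1 : 1 / ((b : ℝ) + x) - 1 / (b + y) = (y - x) / ((b + x) * (b + y)) := by
      field_simp; ring
    rw [h1, abs_div, abs_of_pos (mul_pos hx0 hy0), abs_sub_comm, mul_div_assoc',
      le_div_iff₀ (mul_pos hx0 hy0), mul_comm]
    refine mul_le_mul_of_nonneg_right ?_ (abs_nonneg _)
    nlinarith [hx.2, hy.2]
  have hnull := ae_iff.1 hsum
  calc _ ≤ volume T + 0 := by
        rw [← hnull]; exact (measure_mono hsub).trans (measure_union_le _ _)
    _ = volume T := add_zero _
    _ ≤ ENNReal.ofReal ((b + 1) ^ 2) * volume ((fun y : ℝ => 1 / (b + y)) '' T) :=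
        volume_le_of_antilipschitzOn hanti
    _ ≤ ENNReal.ofReal ((b + 1) ^ 2) * ENNReal.ofReal η := by
        gcongr; exact (measure_mono himg).trans hs.volume_le
    _ = _ := by rw [← ENNReal.ofReal_mul (by positivity)]

theorem exists_digit_tail {y : ℝ} (hy : y ∈ Ioo (0 : ℝ) 1) (hirr : Irrational y) :
    ∃ b : ℕ, 1 ≤ b ∧ ∃ y' ∈ Ioo (0 : ℝ) 1, Irrational y' ∧ y = 1 / (b + y') := by
  have h1 : Int.fract y = y := Int.fract_eq_self.2 ⟨hy.1.le, hy.2⟩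
  have h2 := one_lt_cfStep hirr
  refine ⟨⌊cfStep y⌋₊, Nat.le_floor (by simpa using h2.le), Int.fract (cfStep y),
    ⟨fract_pos_of_irrational (irrational_cfStep hirr), Int.fract_lt_one _⟩,
    irrational_fract (irrational_cfStep hirr), ?_⟩
  rw [natCast_floor_eq_intCast_floor (by linarith), Int.floor_add_fract, cfStep, h1, one_div,
    inv_inv]

/-- The cylinder of the first n digits of x is parametrised by a Möbius map of determinant ±1, on
which the series is an affine function of a series with new parameters. Positivity of Q' from the
first step on makes Q grow at least like n. -/
theorem exists_cylinder_chart (k : ℂ) (h : ℝ → ℂ) {x : ℝ} (hx : x ∈ Ioo (0 : ℝ) 1)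
    (hirr : Irrational x) {r₀ s₀ : ℝ} (hr₀ : 0 ≤ r₀) (hr₀1 : r₀ ≤ 1) (hs₀ : |s₀| = 1) (n : ℕ) :
    ∃ (P P' : ℝ) (Q Q' : ℕ) (r s : ℝ) (c₀ c₁ : ℂ) (y₀ : ℝ),
      n ≤ Q ∧ 1 ≤ Q ∧ Q' ≤ Q ∧ (1 ≤ n → 1 ≤ Q') ∧ |P * Q' - P' * Q| = 1 ∧
      0 ≤ r ∧ (1 ≤ n → 0 < r) ∧ r ≤ 1 ∧ |s| = 1 ∧ c₁ ≠ 0 ∧ y₀ ∈ Ioo (0 : ℝ) 1 ∧ Irrational y₀ ∧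
      x = (P + P' * y₀) / (Q + Q' * y₀) ∧
      ∀ y ∈ Ioo (0 : ℝ) 1, Irrational y → Summable (cfTerm k h r s (cfDigit y)) →
        cfSum k h r₀ s₀ ((P + P' * y) / (Q + Q' * y)) = c₀ + c₁ * cfSum k h r s y := by
  induction n with
  | zero =>
    exact ⟨0, 1, 1, 0, r₀, s₀, 0, 1, x, by simp, le_rfl, by simp, by simp, by simp, hr₀, by simp,
      hr₀1, hs₀, one_ne_zero, hx, hirr, by simp, fun y _ _ _ => by simp⟩
  | succ n ih =>
    obtain ⟨P, P', Q, Q', r, s, c₀, c₁, y₀, hnQ, hQ1, hQ', hnQ', hdet, hr, hnr, hr1, hs, hc₁, hy₀,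
      hy₀irr, hxy, hsum⟩ := ih
    obtain ⟨b, hb, y₁, hy₁, hy₁irr, hyy⟩ := exists_digit_tail hy₀ hy₀irr
    have hb1 : (1 : ℝ) ≤ b := by exact_mod_cast hb
    have hbr : 0 < (b : ℝ) + r := by linarith
    have hc : ((b + r : ℝ) : ℂ) ≠ 0 := by exact_mod_cast hbr.ne'
    have hmob : ∀ y ∈ Ioo (0 : ℝ) 1, (P + P' * (1 / (b + y))) / (Q + Q' * (1 / (b + y))) =
        (P * b + P' + P * y) / (((Q * b + Q' : ℕ) : ℝ) + Q * y) := by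
      intro y hy
      have hby : (b : ℝ) + y ≠ 0 := by linarith [hy.1]
      have hQ0 : (1 : ℝ) ≤ Q := by exact_mod_cast hQ1
      have h1 : (0 : ℝ) < Q * (b + y) + Q' := by
        have : (0 : ℝ) ≤ Q' := Nat.cast_nonneg _
        nlinarith [hy.1]
      have h2 : (0 : ℝ) < ((Q * b + Q' : ℕ) : ℝ) + Q * y := by push_cast; linarith
      have h3 : (Q : ℝ) + Q' * (1 / (b + y)) = (((Q * b + Q' : ℕ) : ℝ) + Q * y) / (b + y) := by
        push_cast; field_simp; ring
      have h4 : P + P' * (1 / (b + y)) = (P * b + P' + P * y) / (b + y) := by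
        field_simp; ring
      rw [h3, h4, div_div_div_cancel_right₀ hby]
    refine ⟨P * b + P', P, Q * b + Q', Q, 1 / (b + r), -s,
      c₀ + c₁ * (((b + r : ℝ) : ℂ) ^ (-k) * h (s / (b + r))),
      c₁ * ((b + r : ℝ) : ℂ) ^ (-k), y₁, ?_, ?_, ?_, fun _ => hQ1, ?_, by positivity,
      fun _ => by positivity, ?_, by rwa [abs_neg], ?_, hy₁, hy₁irr, ?_, ?_⟩
    · rcases Nat.eq_zero_or_pos n with h0 | h0
      · subst h0; nlinarith
      · have := hnQ' h0; nlinarith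
    · nlinarith
    · nlinarith
    · rw [← hdet, ← abs_neg]; congr 1; push_cast; ring
    · rw [div_le_one hbr]; linarith
    · exact mul_ne_zero hc₁ (by rw [Complex.cpow_ne_zero_iff]; exact Or.inl hc)
    · rw [hxy, hyy, hmob y₁ hy₁]
    · intro y hy hyirr hys
      obtain ⟨h1, h2⟩ := cfSum_branch k h hr s hb hy hyirr hys
      have hby : 0 < (b : ℝ) + y := by linarith [hy.1]
      have hu : 1 / ((b : ℝ) + y) ∈ Ioo (0 : ℝ) 1 :=
        ⟨by positivity, by rw [div_lt_one hby]; linarith [hy.1]⟩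
      have huirr : Irrational (1 / ((b : ℝ) + y)) := by
        rw [one_div]; exact (hyirr.natCast_add b).inv
      rw [← hmob y hy, hsum _ hu huirr h1, h2]
      ring

theorem eventually_volume_closedBall_diff_le {A : Set ℝ} (hA : NullMeasurableSet A volume) {x : ℝ}
    (hx : Tendsto (fun r => volume (A ∩ Metric.closedBall x r) / volume (Metric.closedBall x r))
      (𝓝[>] 0) (𝓝 1)) {η : ℝ} (hη : 0 < η) :
    ∀ᶠ r in 𝓝[>] (0 : ℝ), volume (Metric.closedBall x r \ A) ≤ ENNReal.ofReal (2 * r * η) := by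
  have h1 : ENNReal.ofReal (1 - η) < 1 := by
    rw [← ENNReal.ofReal_one]
    exact (ENNReal.ofReal_lt_ofReal_iff one_pos).2 (by linarith)
  filter_upwards [hx.eventually_const_lt h1, self_mem_nhdsWithin] with r hr hr0
  have hr0 : 0 < r := hr0
  have hfin : ∀ s ⊆ Metric.closedBall x r, volume s ≠ ⊤ := fun s hs =>
    ((measure_mono hs).trans_lt (by rw [Real.volume_closedBall]; exact ENNReal.ofReal_lt_top)).ne
  have h2 := ENNReal.mul_lt_of_lt_div hr
  rw [Real.volume_closedBall, ← ENNReal.ofReal_mul' (by positivity)] at h2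
  have h3 := (ENNReal.ofReal_le_iff_le_toReal (hfin _ inter_subset_right)).1 h2.le
  have h4 := measure_inter_add_sdiff₀ (μ := volume) (Metric.closedBall x r) hA
  have h5 := congrArg ENNReal.toReal h4
  rw [ENNReal.toReal_add (hfin _ inter_subset_left) (hfin _ sdiff_subset), Real.volume_closedBall,
    ENNReal.toReal_ofReal (by positivity), inter_comm] at h5
  rw [← ENNReal.ofReal_toReal (hfin _ sdiff_subset)]
  exact ENNReal.ofReal_le_ofReal (by linarith)

/-- At a Lebesgue density point of the level set, a deep cylinder lies almost entirely in the level
set. Pulling back by its chart gives a nearly constant series on the whole unit interval. -/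
theorem exists_isState {k : ℂ} {h : ℝ → ℂ} (hsum : AESummable k h) {w₀ : ℂ}
    (hmeas : AEMeasurable (cfSum k h 0 1) volume)
    (hpos : volume {x | x ∈ Icc (0 : ℝ) 1 ∧ cfSum k h 0 1 x = w₀} ≠ 0) {η : ℝ} (hη : 0 < η) :
    ∃ r s w, IsState k h η r s w := by
  set A : Set ℝ := {x | x ∈ Icc (0 : ℝ) 1 ∧ cfSum k h 0 1 x = w₀} with hA
  have hAm : NullMeasurableSet A volume :=
    measurableSet_Icc.nullMeasurableSet.inter (hmeas.nullMeasurable (measurableSet_singleton w₀))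
  have hae := Besicovitch.ae_tendsto_measure_inter_div (volume : Measure ℝ) A
  have hne : (ae (volume.restrict A)).NeBot := by
    rw [ae_neBot]; intro h0; exact hpos (Measure.restrict_eq_zero.1 h0)
  obtain ⟨x, hx, hxA, hxirr⟩ := (hae.and ((ae_restrict_mem₀ hAm).and
    (ae_restrict_of_ae ae_irrational))).exists
  have hx01 : x ∈ Ioo (0 : ℝ) 1 :=
    ⟨lt_of_le_of_ne hxA.1.1 hxirr.ne_zero.symm, lt_of_le_of_ne hxA.1.2 hxirr.ne_one⟩
  -- The image of the chart lies in the ball of radius 1/Q², and pulling back costs a factor 4Q²;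
  -- since 4Q² · (2/Q²) · (η/8) = η, the constant is 8.
  have hev := eventually_volume_closedBall_diff_le hAm hx (η := η / 8) (by positivity)
  obtain ⟨ρ, hρ, hball⟩ := (mem_nhdsGT_iff_exists_Ioo_subset).1 hev
  have hρ : 0 < ρ := hρ
  obtain ⟨n, hn⟩ := exists_nat_gt (max 1 (1 / ρ))
  have hn1 : (1 : ℝ) < n := (le_max_left _ _).trans_lt hn
  have hnρ : 1 / ρ < n := (le_max_right _ _).trans_lt hn
  have hn1' : 1 ≤ n := by exact_mod_cast hn1.le
  obtain ⟨P, P', Q, Q', r, s, c₀, c₁, y₀, hnQ, hQ1, hQ', -, hdet, hr, hnr, hr1, hs, hc₁, hy₀,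
      hy₀irr, hxy, hchart⟩ := exists_cylinder_chart k h hx01 hxirr le_rfl zero_le_one abs_one n
  refine ⟨r, s, (w₀ - c₀) / c₁, hnr hn1', hr1, hs, ?_⟩
  set w := (w₀ - c₀) / c₁ with hw
  have hQ0 : (1 : ℝ) ≤ Q := by exact_mod_cast hQ1
  have hQ'0 : (0 : ℝ) ≤ Q' := Nat.cast_nonneg _
  have hQ'Q : (Q' : ℝ) ≤ Q := by exact_mod_cast hQ'
  have hnQr : (n : ℝ) ≤ Q := by exact_mod_cast hnQ
  set g : ℝ → ℝ := fun y => (P + P' * y) / (Q + Q' * y) with hg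
  have hden : ∀ y ∈ Ioo (0 : ℝ) 1, (Q : ℝ) ≤ Q + Q' * y ∧ (Q : ℝ) + Q' * y ≤ 2 * Q := fun y hy =>
    ⟨by nlinarith [hy.1], by nlinarith [hy.2]⟩
  have hgsub : ∀ y ∈ Ioo (0 : ℝ) 1, ∀ z ∈ Ioo (0 : ℝ) 1,
      |g y - g z| = |y - z| / ((Q + Q' * y) * (Q + Q' * z)) := by
    intro y hy z hz
    have h1 : 0 < (Q : ℝ) + Q' * y := by linarith [(hden y hy).1]
    have h2 : 0 < (Q : ℝ) + Q' * z := by linarith [(hden z hz).1]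
    have h3 : g y - g z = -((P * Q' - P' * Q) * (y - z)) / ((Q + Q' * y) * (Q + Q' * z)) := by
      simp only [hg]
      rw [div_sub_div _ _ h1.ne' h2.ne']
      congr 1
      ring
    rw [h3, abs_div, abs_neg, abs_mul, hdet, one_mul, abs_of_pos (mul_pos h1 h2)]
  set T : Set ℝ := {y | y ∈ Ioo (0 : ℝ) 1 ∧ cfSum k h r s y ≠ w ∧ Irrational y ∧
    Summable (cfTerm k h r s (cfDigit y))} with hT
  have hsub : {y | y ∈ Ioo (0 : ℝ) 1 ∧ cfSum k h r s y ≠ w} ⊆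
      T ∪ {y | ¬ (Irrational y ∧ ∀ r s : ℝ, 0 ≤ r → r ≤ 1 → |s| = 1 →
        Summable (cfTerm k h r s (cfDigit y)))} := by
    rintro y ⟨hy, hne⟩
    by_cases hgood : Irrational y ∧ ∀ r s : ℝ, 0 ≤ r → r ≤ 1 → |s| = 1 →
        Summable (cfTerm k h r s (cfDigit y))
    · exact Or.inl ⟨hy, hne, hgood.1, hgood.2 r s hr hr1 hs⟩
    · exact Or.inr hgood
  have himg : g '' T ⊆ Metric.closedBall x (1 / (Q : ℝ) ^ 2) \ A := by
    rintro _ ⟨y, ⟨hy, hne, hyirr, hys⟩, rfl⟩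
    refine ⟨?_, fun hyA => hne ?_⟩
    · rw [Metric.mem_closedBall, Real.dist_eq, hxy, hgsub y hy y₀ hy₀]
      have h1 := (hden y hy).1
      have h2 := (hden y₀ hy₀).1
      refine div_le_div₀ zero_le_one ?_ (by positivity) (by nlinarith)
      rw [abs_le]
      constructor <;> linarith [hy.1, hy.2, hy₀.1, hy₀.2]
    · have h1 := hchart y hy hyirr hys
      have h2 : cfSum k h 0 1 (g y) = w₀ := hyA.2
      rw [hw, eq_div_iff hc₁, ← h2, h1]
      ring
  have hanti : ∀ y ∈ T, ∀ z ∈ T, |y - z| ≤ 4 * (Q : ℝ) ^ 2 * |g y - g z| := by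
    rintro y ⟨hy, -⟩ z ⟨hz, -⟩
    have h1 := hden y hy
    have h2 := hden z hz
    have h3 : 0 < ((Q : ℝ) + Q' * y) * (Q + Q' * z) := mul_pos (by linarith) (by linarith)
    rw [hgsub y hy z hz, mul_div_assoc', le_div_iff₀ h3, mul_comm]
    refine mul_le_mul_of_nonneg_right ?_ (abs_nonneg _)
    nlinarith
  have hball' : volume (Metric.closedBall x (1 / (Q : ℝ) ^ 2) \ A) ≤
      ENNReal.ofReal (2 * (1 / (Q : ℝ) ^ 2) * (η / 8)) := by
    refine hball ⟨by positivity, ?_⟩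
    rw [div_lt_iff₀ (by positivity)]
    rw [div_lt_iff₀ hρ] at hnρ
    nlinarith
  have hnull := ae_iff.1 hsum
  calc _ ≤ volume T + 0 := by
        rw [← hnull]; exact (measure_mono hsub).trans (measure_union_le _ _)
    _ = volume T := add_zero _
    _ ≤ ENNReal.ofReal (4 * (Q : ℝ) ^ 2) * volume (g '' T) := volume_le_of_antilipschitzOn hanti
    _ ≤ ENNReal.ofReal (4 * (Q : ℝ) ^ 2) *
        ENNReal.ofReal (2 * (1 / (Q : ℝ) ^ 2) * (η / 8)) := by
        gcongr; exact (measure_mono himg).trans hball'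
    _ = ENNReal.ofReal η := by
        rw [← ENNReal.ofReal_mul (by positivity)]
        congr 1
        field_simp
        norm_num

/-- One branch with digit 1 flips the sign and multiplies η by 4. -/
theorem exists_isState_sign {k : ℂ} {h : ℝ → ℂ} (hsum : AESummable k h)
    (hex : ∀ η : ℝ, 0 < η → ∃ r s w, IsState k h η r s w) {σ : ℝ} (hσ : |σ| = 1) {η : ℝ}
    (hη : 0 < η) : ∃ r w, IsState k h η r σ w := by
  obtain ⟨r, s, w, hs⟩ := hex (η / 4) (by positivity)
  have hsq : s = σ ∨ s = -σ := by
    rcases abs_eq_abs.1 (hs.abs_sign.trans hσ.symm) with h | h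
    · exact Or.inl h
    · exact Or.inr h
  rcases hsq with rfl | rfl
  · exact ⟨r, w, hs.mono (by linarith)⟩
  · have := hs.branch hsum (b := 1) le_rfl
    rw [neg_neg] at this
    exact ⟨_, _, this.mono (by push_cast; linarith)⟩

/-- Almost everywhere the series is bounded uniformly in r and s, so some N bounds it off a set of
measure 1/3. A state holds off a set of measure 1/2; since 1/2 + 1/3 < 1, some point satisfies both
conditions. -/
theorem exists_norm_le_of_isState {k : ℂ} (hk : 0 < k.re) {h : ℝ → ℂ} {C e : ℝ} (hC : 0 ≤ C)
    (he : 0 < e) (he1 : e < 1) (hh : InvExpBound h C e) :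
    ∃ K : ℝ, ∀ r s w, IsState k h (1 / 2) r s w → ‖w‖ ≤ K := by
  set G : ℕ → Set ℝ := fun N => {y | y ∈ Ioo (0 : ℝ) 1 ∧
    ∀ r s : ℝ, 0 < r → r ≤ 1 → |s| = 1 → ‖cfSum k h r s y‖ ≤ N} with hG
  have hmono : Monotone G := fun N N' hN y hy =>
    ⟨hy.1, fun r s hr hr1 hs => (hy.2 r s hr hr1 hs).trans (by exact_mod_cast hN)⟩
  have hfin : volume (⋃ N, G N) ≠ ⊤ :=
    ((measure_mono (iUnion_subset fun N y hy => hy.1 : ⋃ N, G N ⊆ Ioo 0 1)).trans_lt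
      (by simp [Real.volume_Ioo])).ne
  have hone : (1 : ENNReal) ≤ volume (⋃ N, G N) := by
    have h1 : volume (Ioo (0 : ℝ) 1) = 1 := by simp [Real.volume_Ioo]
    rw [← h1]
    refine measure_mono_ae ?_
    filter_upwards [ae_irrational, ae_eventually_goodDigit hk he he1] with y hy hg hy01
    obtain ⟨N, hN⟩ := exists_nat_ge (∑' j, C * ((contDen (cfDigit y) (j + 2) : ℝ) ^ (-k.re) *
      Real.exp (((cfDigit y j : ℝ) + 1) ^ e)))
    exact mem_iUnion.2 ⟨N, hy01, fun r s hr hr1 hs =>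
      (norm_tsum_cfTerm_le hk hC he hh hr hr1 hs (one_le_cfDigit hy) hg).trans hN⟩
  obtain ⟨N, hN⟩ := (exists_measure_iUnion_le_add hmono hfin
    (ENNReal.ofReal_pos.2 (show (0 : ℝ) < 1 / 3 by norm_num))).exists
  refine ⟨N, fun r s w hs => ?_⟩
  by_contra hlt
  have hsub : G N ⊆ {y | y ∈ Ioo (0 : ℝ) 1 ∧ cfSum k h r s y ≠ w} := by
    rintro y ⟨hy, hb⟩
    refine ⟨hy, fun heq => hlt ?_⟩
    rw [← heq]
    exact hb r s hs.pos hs.le_one hs.abs_sign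
  have h1 : ENNReal.ofReal 1 ≤ ENNReal.ofReal (1 / 2 + 1 / 3) := by
    rw [ENNReal.ofReal_add (by norm_num) (by norm_num), ENNReal.ofReal_one]
    refine hone.trans (hN.trans ?_)
    gcongr
    exact (measure_mono hsub).trans hs.volume_le
  rw [ENNReal.ofReal_le_ofReal_iff (by norm_num)] at h1
  norm_num at h1

/-! ### Exclusion of atoms: power asymptotics -/

/-- Each z log(1 + 1/N) is a multiple of 2πi, and these numbers tend to 0, so one of them vanishes.
-/
theorem eq_zero_of_forall_cpow_eq_one {z : ℂ}
    (hz : ∀ N : ℕ, 1 ≤ N → ((1 + 1 / (N : ℝ) : ℝ) : ℂ) ^ z = 1) : z = 0 := by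
  by_contra hz0
  have hlim : Tendsto (fun N : ℕ => z * (Real.log (1 + 1 / (N : ℝ)) : ℂ)) atTop (𝓝 0) := by
    have h1 : Tendsto (fun N : ℕ => Real.log (1 + 1 / (N : ℝ))) atTop (𝓝 0) := by
      have h2 : Tendsto (fun N : ℕ => 1 + 1 / (N : ℝ)) atTop (𝓝 (1 + 0)) :=
        tendsto_one_div_atTop_nhds_zero_nat.const_add 1
      rw [add_zero] at h2
      have := (Real.continuousAt_log one_ne_zero).tendsto.comp h2
      rwa [Real.log_one] at this
    have h3 := (Complex.continuous_ofReal.tendsto 0).comp h1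
    simpa using h3.const_mul z
  have hsmall : ∀ᶠ N : ℕ in atTop, ‖z * (Real.log (1 + 1 / (N : ℝ)) : ℂ)‖ < 2 * Real.pi := by
    have := hlim.norm
    rw [norm_zero] at this
    exact this.eventually_lt_const Real.two_pi_pos
  obtain ⟨N, hN, hN1⟩ := (hsmall.and (eventually_ge_atTop 1)).exists
  have hN0 : (0 : ℝ) < N := by exact_mod_cast hN1
  have hpos : 1 < 1 + 1 / (N : ℝ) := by
    have : 0 < 1 / (N : ℝ) := by positivity
    linarith
  have hlog : 0 < Real.log (1 + 1 / (N : ℝ)) := Real.log_pos hpos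
  have h1 := hz N hN1
  rw [Complex.cpow_def_of_ne_zero (by exact_mod_cast (by linarith : (1 + 1 / (N : ℝ)) ≠ 0)),
    ← Complex.ofReal_log (by linarith), mul_comm, Complex.exp_eq_one_iff] at h1
  obtain ⟨m, hm⟩ := h1
  rw [hm, norm_mul, norm_mul, norm_mul, Complex.norm_I, mul_one, Complex.norm_real,
    Real.norm_of_nonneg Real.pi_pos.le, Complex.norm_two, Complex.norm_intCast] at hN
  have hm0 : m = 0 := by
    by_contra hne
    have : (1 : ℝ) ≤ |(m : ℝ)| := by exact_mod_cast Int.one_le_abs hne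
    nlinarith [Real.two_pi_pos]
  rw [hm0, Int.cast_zero, zero_mul, mul_eq_zero] at hm
  rcases hm with h | h
  · exact hz0 h
  · exact hlog.ne' (by exact_mod_cast h)

/-- The bounded error becomes negligible after division by c u^l, leaving only the asymptotics of h
at 1/u. -/
theorem tendsto_normalized_value {k c : ℂ} {l K : ℝ} (hl : 0 < l) (hc : c ≠ 0) {h : ℝ → ℂ}
    (hasym : h ~[𝓝[>] (0 : ℝ)] fun x : ℝ => c * ((x ^ (-l) : ℝ) : ℂ)) {u : ℕ → ℝ}
    (hu : Tendsto u atTop atTop) {w : ℕ → ℂ}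
    (hw : ∀ᶠ m in atTop, ‖((u m : ℝ) : ℂ) ^ k * w m - h (1 / u m)‖ ≤ K) :
    Tendsto (fun m => ((u m : ℝ) : ℂ) ^ (k - l) * w m / c) atTop (𝓝 1) := by
  have hinv : Tendsto (fun m => 1 / u m) atTop (𝓝[>] (0 : ℝ)) := by
    simp only [one_div]
    exact tendsto_inv_atTop_nhdsGT_zero.comp hu
  have h1 : Tendsto (fun m => h (1 / u m) / (c * (((1 / u m) ^ (-l) : ℝ) : ℂ))) atTop (𝓝 1) := by
    have h2 := (isEquivalent_iff_tendsto_one (by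
      filter_upwards [self_mem_nhdsWithin] with x hx
      have hx : (0 : ℝ) < x := hx
      have : x ^ (-l) ≠ 0 := (Real.rpow_pos_of_pos hx _).ne'
      exact mul_ne_zero hc (by exact_mod_cast this))).1 hasym
    exact h2.comp hinv
  have h3 : Tendsto (fun m => ((u m : ℝ) : ℂ) ^ (k - l) * w m / c -
      h (1 / u m) / (c * (((1 / u m) ^ (-l) : ℝ) : ℂ))) atTop (𝓝 0) := by
    have h4 : Tendsto (fun m => K / ‖c‖ * (u m) ^ (-l)) atTop (𝓝 0) := by
      simpa using ((tendsto_rpow_neg_atTop hl).comp hu).const_mul (K / ‖c‖)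
    refine squeeze_zero_norm' ?_ h4
    filter_upwards [hw, hu.eventually_gt_atTop 0] with m hm hm0
    have hum : ((u m : ℝ) : ℂ) ≠ 0 := by exact_mod_cast hm0.ne'
    have h5 : (((1 / u m) ^ (-l) : ℝ) : ℂ) = ((u m : ℝ) : ℂ) ^ (l : ℂ) := by
      rw [one_div, Real.inv_rpow hm0.le, ← Real.rpow_neg hm0.le, neg_neg,
        Complex.ofReal_cpow hm0.le]
    have hcp : ((u m : ℝ) : ℂ) ^ (l : ℂ) ≠ 0 := by
      rw [Complex.cpow_ne_zero_iff]; exact Or.inl hum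
    have h6 : ((u m : ℝ) : ℂ) ^ (k - l) * w m / c - h (1 / u m) / (c * ((u m : ℝ) : ℂ) ^ (l : ℂ)) =
        (((u m : ℝ) : ℂ) ^ k * w m - h (1 / u m)) / (c * ((u m : ℝ) : ℂ) ^ (l : ℂ)) := by
      rw [Complex.cpow_sub _ _ hum]
      field_simp
    rw [h5, h6, norm_div, norm_mul, Complex.norm_cpow_eq_rpow_re_of_pos hm0, Complex.ofReal_re,
      Real.rpow_neg hm0.le, ← div_eq_mul_inv, div_div]
    gcongr
  simpa using h3.add h1

/-- One value w serves two digits, Nm and (N+1)m. Both normalised quantities tend to 1, so their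
ratio gives (1 + 1/N)^{k-l} = 1 for every N. -/
theorem eq_of_asymptotic {k : ℂ} {h : ℝ → ℂ} (hsum : AESummable k h)
    (hst : ∀ η : ℝ, 0 < η → ∃ r w, IsState k h η r 1 w) {K : ℝ}
    (hK : ∀ r s w, IsState k h (1 / 2) r s w → ‖w‖ ≤ K) {c : ℂ} (hc : c ≠ 0) {l : ℝ} (hl : 0 < l)
    (hasym : h ~[𝓝[>] (0 : ℝ)] fun x : ℝ => c * ((x ^ (-l) : ℝ) : ℂ)) : (l : ℂ) = k := by
  suffices k - l = 0 by rw [sub_eq_zero] at this; exact this.symm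
  refine eq_zero_of_forall_cpow_eq_one fun N hN => ?_
  have hN0 : (0 : ℝ) < N := by exact_mod_cast hN
  -- Small enough that branching on any digit up to (N+1)m leaves an exceptional set of measure at
  -- most 1/2, where the bound K applies.
  have hη : ∀ m : ℕ, 0 < (1 / 2) / (((N + 1) * m : ℕ) + 1 : ℝ) ^ 2 := fun m => by positivity
  choose r w hrw using fun m : ℕ => hst _ (hη m)
  have hbound : ∀ m b : ℕ, 1 ≤ b → b ≤ (N + 1) * m →
      ‖((b + r m : ℝ) : ℂ) ^ k * w m - h (1 / (b + r m))‖ ≤ K := by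
    intro m b hb hbm
    refine hK _ _ _ (((hrw m).branch hsum hb).mono ?_)
    have hbm' : (b : ℝ) ≤ ((N + 1) * m : ℕ) := by exact_mod_cast hbm
    rw [mul_div_assoc', div_le_iff₀ (by positivity), mul_comm]
    gcongr
  have hmulN : ∀ a : ℕ, 1 ≤ a → a ≤ N + 1 →
      Tendsto (fun m : ℕ => ((a * m : ℕ) : ℝ) + r m) atTop atTop ∧
      Tendsto (fun m => ((((a * m : ℕ) : ℝ) + r m : ℝ) : ℂ) ^ (k - l) * w m / c) atTop (𝓝 1) := by
    intro a ha haN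
    have hu : Tendsto (fun m : ℕ => ((a * m : ℕ) : ℝ) + r m) atTop atTop := by
      refine tendsto_atTop_mono (fun m => ?_) tendsto_natCast_atTop_atTop
      have h1 : (m : ℝ) ≤ (a * m : ℕ) := by
        exact_mod_cast Nat.le_mul_of_pos_left m ha
      linarith [(hrw m).pos]
    refine ⟨hu, tendsto_normalized_value hl hc hasym hu (K := K) ?_⟩
    filter_upwards [eventually_ge_atTop 1] with m hm
    exact hbound m (a * m) (Nat.mul_pos ha hm) (Nat.mul_le_mul_right m haN)
  obtain ⟨hu1, hv1⟩ := hmulN N hN (Nat.le_succ N)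
  obtain ⟨hu2, hv2⟩ := hmulN (N + 1) (by omega) le_rfl
  have hratio : Tendsto (fun m : ℕ => (((N + 1) * m : ℕ) + r m) / ((N * m : ℕ) + r m)) atTop
      (𝓝 (1 + 1 / (N : ℝ))) := by
    have h1 : Tendsto (fun m : ℕ => 1 + 1 / (N : ℝ) - (1 / N) * (r m / ((N * m : ℕ) + r m)))
        atTop (𝓝 (1 + 1 / (N : ℝ) - (1 / N) * 0)) := by
      refine (Tendsto.const_mul _ ?_).const_sub _
      refine squeeze_zero_norm' (Eventually.of_forall fun m => ?_)
        (tendsto_inv_atTop_zero.comp hu1)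
      have h2 := (hrw m).pos
      have h3 : 0 < ((N * m : ℕ) : ℝ) + r m := by positivity
      rw [Real.norm_of_nonneg (by positivity), Function.comp_apply, ← one_div]
      gcongr
      exact (hrw m).le_one
    rw [mul_zero, sub_zero] at h1
    refine h1.congr fun m => ?_
    have h2 := (hrw m).pos
    have h3 : 0 < ((N * m : ℕ) : ℝ) + r m := by positivity
    push_cast at h3 ⊢
    field_simp
    ring
  have hlim1 : Tendsto (fun m : ℕ => ((((((N + 1) * m : ℕ) + r m) / ((N * m : ℕ) + r m) : ℝ) : ℂ)
      ^ (k - l)) * (((((N * m : ℕ) : ℝ) + r m : ℝ) : ℂ) ^ (k - l) * w m / c)) atTop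
      (𝓝 (((1 + 1 / (N : ℝ) : ℝ) : ℂ) ^ (k - l) * 1)) := by
    refine Tendsto.mul ?_ hv1
    have hcont : ContinuousAt (fun x : ℝ => (x : ℂ) ^ (k - l)) (1 + 1 / (N : ℝ)) := by
      refine ContinuousAt.cpow Complex.continuous_ofReal.continuousAt continuousAt_const ?_
      exact Complex.ofReal_mem_slitPlane.2 (by positivity)
    exact hcont.tendsto.comp hratio
  have hlim2 : Tendsto (fun m : ℕ => ((((((N + 1) * m : ℕ) + r m) / ((N * m : ℕ) + r m) : ℝ) : ℂ)
      ^ (k - l)) * (((((N * m : ℕ) : ℝ) + r m : ℝ) : ℂ) ^ (k - l) * w m / c)) atTop (𝓝 1) := by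
    refine hv2.congr fun m => ?_
    have h2 := (hrw m).pos
    have h3 : 0 < ((N * m : ℕ) : ℝ) + r m := by positivity
    have h4 : 0 < (((N + 1) * m : ℕ) : ℝ) + r m := by positivity
    rw [mul_div_assoc', ← mul_assoc, ← Complex.mul_cpow_ofReal_nonneg (by positivity) h3.le,
      ← Complex.ofReal_mul, div_mul_cancel₀ _ h3.ne']
  rw [mul_one] at hlim1
  exact tendsto_nhds_unique hlim1 hlim2

/-! ### Exclusion of atoms: continuous period functions -/

/-- For bounded h, branching on a large digit b gives (b+r)^{Re k} ‖w‖ ≤ K + H; b is chosen from ε,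
and η from b. -/
theorem exists_forall_state_norm_le {k : ℂ} (hk : 0 < k.re) {h : ℝ → ℂ} (hsum : AESummable k h)
    {K H : ℝ} (hK : ∀ r s w, IsState k h (1 / 2) r s w → ‖w‖ ≤ K)
    (hH : ∀ x : ℝ, |x| ≤ 1 → x ≠ 0 → ‖h x‖ ≤ H) {ε : ℝ} (hε : 0 < ε) :
    ∃ η : ℝ, 0 < η ∧ ∀ r s w, IsState k h η r s w → ‖w‖ ≤ ε := by
  have hH0 : 0 ≤ H := (norm_nonneg _).trans (hH 1 (by simp) one_ne_zero)
  have hlim : Tendsto (fun b : ℕ => (K + H) * (b : ℝ) ^ (-k.re)) atTop (𝓝 0) := by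
    simpa using ((tendsto_rpow_neg_atTop hk).comp tendsto_natCast_atTop_atTop).const_mul (K + H)
  obtain ⟨b, hbε, hb⟩ := ((hlim.eventually_le_const hε).and (eventually_ge_atTop 1)).exists
  refine ⟨(1 / 2) / ((b : ℝ) + 1) ^ 2, by positivity, fun r s w hs => ?_⟩
  have hb1 : (1 : ℝ) ≤ b := by exact_mod_cast hb
  have hbr : 0 < (b : ℝ) + r := by linarith [hs.pos]
  have h1 := hK _ _ _ ((hs.branch hsum hb).mono (by rw [mul_div_cancel₀]; positivity))
  have habs : |s / (b + r)| = 1 / (b + r) := by rw [abs_div, hs.abs_sign, abs_of_pos hbr]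
  have h2 := hH (s / (b + r)) (by rw [habs, div_le_one hbr]; linarith [hs.pos])
    (by rw [← abs_pos, habs]; positivity)
  have h3 : ‖((b + r : ℝ) : ℂ) ^ k * w‖ ≤ K + H := by
    calc ‖((b + r : ℝ) : ℂ) ^ k * w‖ = ‖(((b + r : ℝ) : ℂ) ^ k * w - h (s / (b + r))) +
          h (s / (b + r))‖ := by rw [sub_add_cancel]
      _ ≤ _ := norm_add_le_of_le h1 h2
  rw [norm_mul, Complex.norm_cpow_eq_rpow_re_of_pos hbr] at h3
  have h4 : (b : ℝ) ^ k.re * ‖w‖ ≤ K + H := by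
    refine le_trans ?_ h3
    gcongr
    linarith [hs.pos]
  refine le_trans ?_ hbε
  rw [Real.rpow_neg (by linarith), ← div_eq_mul_inv, le_div_iff₀ (by positivity), mul_comm]
  exact h4

/-- Branching places the newest digit at the front of r, so the digits of t are prescribed in
reverse order. They are used in pairs to preserve the sign, and each pair contracts distances by at
least 4. -/
theorem exists_isState_near {k : ℂ} {h : ℝ → ℂ} (hsum : AESummable k h)
    (hst : ∀ σ : ℝ, |σ| = 1 → ∀ η : ℝ, 0 < η → ∃ r w, IsState k h η r σ w) (n : ℕ) {σ : ℝ}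
    (hσ : |σ| = 1) : ∀ {t : ℝ}, t ∈ Ioo (0 : ℝ) 1 → Irrational t → ∀ {η : ℝ}, 0 < η →
      ∃ r w, IsState k h η r σ w ∧ |r - t| ≤ (1 / 4) ^ n := by
  induction n with
  | zero =>
    intro t ht _ η hη
    obtain ⟨r, w, hs⟩ := hst σ hσ η hη
    refine ⟨r, w, hs, ?_⟩
    rw [pow_zero, abs_le]
    constructor <;> linarith [hs.pos, hs.le_one, ht.1, ht.2]
  | succ n ih =>
    intro t ht hirr η hη
    obtain ⟨a, ha, t₁, ht₁, hirr₁, hta⟩ := exists_digit_tail ht hirr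
    obtain ⟨b, hb, t₂, ht₂, hirr₂, htb⟩ := exists_digit_tail ht₁ hirr₁
    obtain ⟨r, w, hs, hr⟩ := ih ht₂ hirr₂
      (show 0 < η / (((a : ℝ) + 1) ^ 2 * ((b : ℝ) + 1) ^ 2) by positivity)
    have h2 := (hs.branch hsum hb).branch hsum ha
    rw [neg_neg] at h2
    refine ⟨_, _, h2.mono (le_of_eq (by field_simp)), ?_⟩
    have ha1 : (1 : ℝ) ≤ a := by exact_mod_cast ha
    have hb1 : (1 : ℝ) ≤ b := by exact_mod_cast hb
    have hbr : 0 < (b : ℝ) + r := by linarith [hs.pos]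
    have hbt : 0 < (b : ℝ) + t₂ := by linarith [ht₂.1]
    have h3 : ∀ x : ℝ, 0 < b + x → 1 / ((a : ℝ) + 1 / (b + x)) = (b + x) / (a * (b + x) + 1) := by
      intro x hx
      have : 0 < (a : ℝ) * (b + x) + 1 := by positivity
      rw [eq_div_iff this.ne']
      field_simp
    have hd1 : 2 ≤ (a : ℝ) * (b + r) + 1 := by nlinarith [hs.pos]
    have hd2 : 2 ≤ (a : ℝ) * (b + t₂) + 1 := by nlinarith [ht₂.1]
    rw [hta, htb, h3 r hbr, h3 t₂ hbt, div_sub_div _ _ (by linarith) (by linarith),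
      show (b + r) * ((a : ℝ) * (b + t₂) + 1) - (a * (b + r) + 1) * (b + t₂) = r - t₂ by ring,
      abs_div, abs_of_pos (by positivity : 0 < ((a : ℝ) * (b + r) + 1) * (a * (b + t₂) + 1)),
      div_le_iff₀ (by positivity), pow_succ]
    have h4 : (4 : ℝ) ≤ (a * (b + r) + 1) * (a * (b + t₂) + 1) := by nlinarith
    have h5 : (0 : ℝ) < (1 / 4) ^ n := by positivity
    nlinarith

/-- For a state with tiny η both w and the branched value are tiny, hence so is their combination
h(σ/(b+r)). Letting r approach t gives a zero at σ/(b+t), and every irrational in (-1, 1) has this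
form. -/
theorem eq_zero_of_continuousOn {k : ℂ} (hk : 0 < k.re) {h : ℝ → ℂ} (hsum : AESummable k h)
    (hst : ∀ σ : ℝ, |σ| = 1 → ∀ η : ℝ, 0 < η → ∃ r w, IsState k h η r σ w) {K : ℝ}
    (hK : ∀ r s w, IsState k h (1 / 2) r s w → ‖w‖ ≤ K) {g : ℝ → ℂ}
    (hg : ContinuousOn g (Icc (-1) 1)) (hgh : EqOn g h (Icc (-1) 1 \ {0})) :
    EqOn g 0 (Icc (-1) 1) := by
  obtain ⟨H, hH⟩ := isCompact_Icc.exists_bound_of_continuousOn hg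
  have hgh' : ∀ x : ℝ, |x| ≤ 1 → x ≠ 0 → g x = h x := fun x hx hx0 => hgh ⟨abs_le.1 hx, hx0⟩
  have hH' : ∀ x : ℝ, |x| ≤ 1 → x ≠ 0 → ‖h x‖ ≤ H := fun x hx hx0 => by
    rw [← hgh' x hx hx0]; exact hH x (abs_le.1 hx)
  have hzero : ∀ (b : ℕ), 1 ≤ b → ∀ σ : ℝ, |σ| = 1 → ∀ t ∈ Ioo (0 : ℝ) 1, Irrational t →
      g (σ / (b + t)) = 0 := by
    intro b hb σ hσ t ht hirr
    have hb1 : (1 : ℝ) ≤ b := by exact_mod_cast hb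
    have hex : ∀ n : ℕ, ∃ r : ℝ, 0 < r ∧ |r - t| ≤ (1 / 4) ^ n ∧
        ‖g (σ / (b + r))‖ ≤ (1 + ((b : ℝ) + 1) ^ k.re) * (1 / 4) ^ n := by
      intro n
      have hε : (0 : ℝ) < (1 / 4) ^ n := by positivity
      obtain ⟨η, hη, hηw⟩ := exists_forall_state_norm_le hk hsum hK hH' hε
      obtain ⟨r, w, hs, hr⟩ := exists_isState_near hsum hst n hσ ht hirr
        (show 0 < η / ((b : ℝ) + 1) ^ 2 by positivity)
      have h1 := hηw _ _ _ (hs.mono (div_le_self hη.le (by nlinarith)))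
      have h2 := hηw _ _ _ ((hs.branch hsum hb).mono (by rw [mul_div_cancel₀]; positivity))
      have hbr : 0 < (b : ℝ) + r := by linarith [hs.pos]
      have habs : |σ / (b + r)| = 1 / (b + r) := by rw [abs_div, hσ, abs_of_pos hbr]
      refine ⟨r, hs.pos, hr, ?_⟩
      rw [hgh' _ (by rw [habs, div_le_one hbr]; linarith [hs.pos])
        (by rw [← abs_pos, habs]; positivity)]
      have h3 : ‖((b + r : ℝ) : ℂ) ^ k * w‖ ≤ ((b : ℝ) + 1) ^ k.re * (1 / 4) ^ n := by
        rw [norm_mul, Complex.norm_cpow_eq_rpow_re_of_pos hbr]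
        gcongr
        exact hs.le_one
      calc ‖h (σ / (b + r))‖ = ‖((b + r : ℝ) : ℂ) ^ k * w -
            (((b + r : ℝ) : ℂ) ^ k * w - h (σ / (b + r)))‖ := by rw [sub_sub_cancel]
        _ ≤ ((b : ℝ) + 1) ^ k.re * (1 / 4) ^ n + (1 / 4) ^ n := norm_sub_le_of_le h3 h2
        _ = _ := by ring
    choose r hr0 hrt hrg using hex
    have hpow : Tendsto (fun n : ℕ => (1 / 4 : ℝ) ^ n) atTop (𝓝 0) :=
      tendsto_pow_atTop_nhds_zero_of_lt_one (by norm_num) (by norm_num)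
    have hrlim : Tendsto r atTop (𝓝 t) := by
      rw [tendsto_iff_norm_sub_tendsto_zero]
      exact squeeze_zero (fun n => norm_nonneg _) hrt hpow
    have hmem : ∀ x : ℝ, 0 < x → σ / (b + x) ∈ Icc (-1 : ℝ) 1 := fun x hx => by
      have hbx : 0 < (b : ℝ) + x := by linarith
      rw [mem_Icc, ← abs_le, abs_div, hσ, abs_of_pos hbx, div_le_one hbx]
      linarith
    have hglim : Tendsto (fun n => g (σ / (b + r n))) atTop (𝓝 (g (σ / (b + t)))) := by
      refine (hg _ (hmem t ht.1)).tendsto.comp (tendsto_nhdsWithin_iff.2 ⟨?_, ?_⟩)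
      · exact tendsto_const_nhds.div (hrlim.const_add (b : ℝ)) (by linarith [ht.1])
      · exact Eventually.of_forall fun n => hmem _ (hr0 n)
    have hg0 : Tendsto (fun n => g (σ / (b + r n))) atTop (𝓝 0) := by
      refine squeeze_zero_norm hrg ?_
      simpa using hpow.const_mul (1 + ((b : ℝ) + 1) ^ k.re)
    exact tendsto_nhds_unique hglim hg0
  have hirrzero : EqOn g 0 (Ioo (-1 : ℝ) 1 ∩ {x | Irrational x}) := by
    rintro x ⟨hx, hirr⟩
    have hirr : Irrational x := hirr
    have hx0 : x ≠ 0 := hirr.ne_zero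
    have habs0 : 0 < |x| := abs_pos.2 hx0
    have habs : |x| ∈ Ioo (0 : ℝ) 1 := ⟨habs0, abs_lt.2 hx⟩
    have hirr' : Irrational |x| := by
      rcases abs_choice x with h | h <;> rw [h]
      · exact hirr
      · exact hirr.neg
    obtain ⟨b, hb, t, ht, htirr, hxt⟩ := exists_digit_tail habs hirr'
    have h1 := hzero b hb (x / |x|) (by rw [abs_div, abs_abs, div_self habs0.ne']) t ht htirr
    have h2 : x / |x| / (b + t) = x := by
      rw [div_div, div_eq_iff, hxt, one_div_mul_cancel, mul_one]
      · linarith [ht.1, (Nat.cast_nonneg b : (0 : ℝ) ≤ b)]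
      · exact mul_ne_zero habs0.ne' (by linarith [ht.1, (Nat.cast_nonneg b : (0 : ℝ) ≤ b)])
    rwa [h2] at h1
  refine hirrzero.of_subset_closure hg continuousOn_const ?_ ?_
  · exact inter_subset_left.trans Ioo_subset_Icc_self
  · rw [← closure_Ioo (by norm_num : (-1 : ℝ) ≠ 1)]
    exact closure_minimal (dense_irrational.open_subset_closure_inter isOpen_Ioo) isClosed_closure

/-- The reciprocity formula at x and at -1/x gives h(x) = -|x|^{-k} h(-1/x), which carries the
vanishing from [-1, 1] to the rest of the line. -/
theorem eq_zero_of_eq_zero_on_unit {k : ℂ} {f : ℚ → ℂ} {h : ℝ → ℂ}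
    (hrec : ∀ x : ℚ, x ≠ 0 → h (x : ℝ) = f x - (((|x| : ℚ) : ℂ) ^ (-k)) * f (-1 / x))
    (h0 : ∀ x : ℝ, |x| ≤ 1 → x ≠ 0 → h x = 0) {x : ℚ} (hx : x ≠ 0) : h (x : ℝ) = 0 := by
  have hx' : (x : ℝ) ≠ 0 := by exact_mod_cast hx
  rcases le_or_gt |(x : ℝ)| 1 with h1 | h1
  · exact h0 _ h1 hx'
  have hy : -1 / x ≠ 0 := div_ne_zero (by norm_num) hx
  have hyabs : |((-1 / x : ℚ) : ℝ)| ≤ 1 := by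
    push_cast
    rw [abs_div, abs_neg, abs_one, div_le_one (by linarith)]
    exact h1.le
  have h2 := hrec _ hy
  rw [h0 _ hyabs (by exact_mod_cast hy), show -1 / (-1 / x) = x by field_simp, abs_div, abs_neg,
    abs_one] at h2
  have hpos : (0 : ℝ) < |(x : ℝ)| := abs_pos.2 hx'
  have hc : (((1 / |x| : ℚ) : ℂ)) ^ (-k) * ((|x| : ℚ) : ℂ) ^ (-k) = 1 := by
    have := Complex.mul_cpow_ofReal_nonneg (a := 1 / |(x : ℝ)|) (b := |(x : ℝ)|)
      (by positivity) hpos.le (-k)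
    rw [← Complex.ofReal_mul, one_div_mul_cancel hpos.ne', Complex.ofReal_one,
      Complex.one_cpow] at this
    have hcast : ((|x| : ℚ) : ℂ) = ((|(x : ℝ)| : ℝ) : ℂ) := by
      rw [← Rat.cast_abs, Complex.ofReal_ratCast]
    rw [this, Rat.cast_div, Rat.cast_one, hcast, Complex.ofReal_div, Complex.ofReal_one]
  rw [hrec x hx]
  linear_combination ((|x| : ℚ) : ℂ) ^ (-k) * h2 - f x * hc

/-! ### From atoms of the limit law to level sets of the series, and conclusion -/

theorem volume_cfSum_ne_zero {k : ℂ} (hk : 0 < k.re) {f : ℚ → ℂ} {h : ℝ → ℂ}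
    (hper : ∀ x : ℚ, x ∉ Icc (-1 : ℚ) 0 → f (x + 1) = f x)
    (hrec : ∀ x : ℚ, x ≠ 0 → h (x : ℝ) = f x - (((|x| : ℚ) : ℂ) ^ (-k)) * f (-1 / x))
    {C e : ℝ} (hC : 0 ≤ C) (he : 0 < e) (he1 : e < 1) (hh : InvExpBound h C e) {z : ℂ}
    (hz : daggerLaw k f {z} ≠ 0) :
    AEMeasurable (cfSum k h 0 1) volume ∧
      volume {x | x ∈ Icc (0 : ℝ) 1 ∧ cfSum k h 0 1 x = z - f (-1)} ≠ 0 := by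
  have hmeas : AEMeasurable (dagger k f) volume :=
    aemeasurable_dagger (ae_tendsto_dagger hk hper hrec hC he he1 hh)
  have heq : ∀ᵐ x : ℝ, dagger k f x = f (-1) + cfSum k h 0 1 x := by
    filter_upwards [ae_irrational, ae_eventually_goodDigit hk he he1] with x hx hg
    exact dagger_eq hk hper hrec hC he hh hx hg
  refine ⟨(hmeas.sub_const (f (-1))).congr ?_, ?_⟩
  · filter_upwards [heq] with x hx
    rw [hx, add_sub_cancel_left]
  · rw [daggerLaw, Measure.map_apply_of_aemeasurable hmeas.restrict (measurableSet_singleton z),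
      Measure.restrict_apply' measurableSet_Icc] at hz
    refine fun h0 => hz (le_antisymm (h0 ▸ (measure_mono_ae ?_)) bot_le)
    filter_upwards [heq] with x hx hxz
    have h1 : dagger k f x = z := hxz.1
    exact ⟨hxz.2, by rw [← h1, hx, add_sub_cancel_left]⟩

theorem theorem6 (k : ℂ) (hk : 0 < k.re) (f : ℚ → ℂ) (h : ℝ → ℂ)
    (hper : ∀ x : ℚ, x ∉ Icc (-1 : ℚ) 0 → f (x + 1) = f x)
    (hrec : ∀ x : ℚ, x ≠ 0 → h (x : ℝ) = f x - (((|x| : ℚ) : ℂ) ^ (-k)) * f (-1 / x))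
    (hgrowth : ∃ δ : ℝ, 0 < δ ∧ ∃ C : ℝ, ∀ x ∈ Ioo (-1 : ℝ) 1, x ≠ 0 →
      ‖h x‖ ≤ C * Real.exp (|x| ^ (-1 + δ))) :
    -- the limit defining `f†` exists almost everywhere, and `f†` is Lebesgue-measurable
    (∀ᵐ x : ℝ, Tendsto (daggerSeq k f x) atTop (𝓝 (dagger k f x))) ∧
    AEMeasurable (dagger k f) (volume : Measure ℝ) ∧
    -- equidistribution, i.e. weak convergence
    (∀ G : ℂ →ᵇ ℝ,
      Tendsto (fun q : ℕ => reducedAverage k f G q) atTop (𝓝 (∫ z, G z ∂(daggerLaw k f)))) ∧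
    -- diffuseness
    ((∃ x : ℚ, x ≠ 0 ∧ h (x : ℝ) ≠ 0) →
      ((∃ g : ℝ → ℂ, ContinuousOn g (Icc (-1) 1) ∧ EqOn g h (Icc (-1) 1 \ {0})) ∨
        (∃ c : ℂ, c ≠ 0 ∧ ∃ l : ℝ, 0 < l ∧ (l : ℂ) ≠ k ∧
          h ~[𝓝[>] (0 : ℝ)] fun x : ℝ => c * ((x ^ (-l) : ℝ) : ℂ))) →
      ∀ z : ℂ, daggerLaw k f {z} = 0) := by
  obtain ⟨C, e, hC, he, he1, hh⟩ := exists_invExpBound hgrowth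
  have hae := ae_tendsto_dagger hk hper hrec hC he he1 hh
  refine ⟨hae, aemeasurable_dagger hae,
    fun G => tendsto_reducedAverage hk hper hrec hC he he1 hh G, ?_⟩
  rintro ⟨x₀, hx₀, hne⟩ hcase z
  by_contra hz
  obtain ⟨hmeas, hpos⟩ := volume_cfSum_ne_zero hk hper hrec hC he he1 hh hz
  have hsum := aeSummable hk hC he he1 hh
  have hst : ∀ σ : ℝ, |σ| = 1 → ∀ η : ℝ, 0 < η → ∃ r w, IsState k h η r σ w :=
    fun σ hσ η hη => exists_isState_sign hsum (fun η hη => exists_isState hsum hmeas hpos hη) hσ hη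
  obtain ⟨K, hK⟩ := exists_norm_le_of_isState hk hC he he1 hh
  rcases hcase with ⟨g, hg, hgh⟩ | ⟨c, hc, l, hl, hlk, hasym⟩
  · have hg0 := eq_zero_of_continuousOn hk hsum hst hK hg hgh
    refine hne (eq_zero_of_eq_zero_on_unit hrec (fun x hx hx0 => ?_) hx₀)
    rw [← hgh ⟨abs_le.1 hx, hx0⟩]
    exact hg0 (abs_le.1 hx)
  · exact hlk (eq_of_asymptotic hsum (hst 1 abs_one) hK hc hl hasym)
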